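/- \textbf{Setting.} Norms of matrices are spectral norms. The model is the Real RAM: real numbers are stored in infinite precision, the operations $+,-,\times,/,\sqrt{\cdot}$ and the comparison $<$ are exact and have unit cost (a division by zero or a square root of a negative number is an error). In addition a black-box approximate fast multipole method (FMM) with exponent $\xi\ge 1$ is available: on a kernel $k\in\{\log x,\,1/x,\,1/x^2\}$ (with $\log x$ read as $\log|x|$ for $x<0$), an accuracy $\epsilon\in(0,1/2)$, sizes $m\le n$ with $n\ge 1$, a constant $C$, and reals $x_1,\dots,x_m$, $c_1,\dots,c_n$, $y_1,\dots,y_n$ with $|x_i|,|c_j|,|y_j|<C$ and $|x_i-y_j|\ge a(\epsilon/n)^p$ for all $i,j$, where $a>0$ and $p\in\mathbb N$, it returns $\tilde f_1,\dots,\tilde f_m$ with $\bigl|\tilde f_i-\sum_{j=1}^n c_j\,k(x_i-y_j)\bigr|\le\epsilon$ for all $i$, in at most $K_{C,a,p}\; n\log^{\xi}(n/\epsilon)$ arithmetic operations, where $K_{C,a,p}$ depends only on $C,a,p$ (and on the implementation). \textbf{Algorithm.} The Gu--Eisenstat recursive divide-and-conquer algorithm diagonalizes a symmetric tridiagonal matrix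 $T$ as follows. If $n\le 2$, compute the exact diagonalization. Otherwise write $$T=\begin{pmatrix}T_1&\beta_1e_k&\\ \beta_1e_k^\top&\alpha&\beta_2e_1^\top\\ &\beta_2e_1&T_2\end{pmatrix}$$ with $T_1,T_2$ of sizes differing by at most $1$, recursively compute approximate eigendecompositions $(\tilde U_1,\tilde D_1)$, $(\tilde U_2,\tilde D_2)$ of $T_1,T_2$, and form the arrowhead matrix with head $\alpha$, diagonal entries those of $\tilde D_1,\tilde D_2$, and shaft consisting of $\beta_1$ times the last row of $\tilde U_1$ and $\beta_2$ times the first row of $\tilde U_2$. The arrowhead matrix is diagonalized by deflation (of small shaft entries, and of close diagonal entries by rotations), bisection on the secular equation for its eigenvalues, reconstruction of a shaft from the computed eigenvalues, and application of the transposed eigenvector matrix to the matrix assembled from $\tilde U_1,1,\tilde U_2$; the secular function and the sums in the products with the eigenvectors are evaluated by the FMM. \textbf{Theorem.} Let $\xi\ge1$ and let an FMM implementation with exponent $\xi$ as above be given. The tolerances of the FMM-accelerated Gu--Eisenstat algorithm can be chosen explicitly (as fixed powers of $\epsilon/(64n)$), and there is a constant $K>0$, depending only on $\xi$ and the FMM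 implementation, such that the following holds for all $n\ge 1$, all $\epsilon\in(0,1/2)$, and all symmetric tridiagonal $T\in\mathbb R^{n\times n}$ that are unreduced (all entries next to the diagonal are nonzero) with $\|T\|\le 1$. On input $(T,\epsilon)$ the algorithm terminates without error and returns a matrix $\tilde U\in\mathbb{R}^{n\times n}$ and a diagonal matrix $\tilde\Lambda\in\mathbb{R}^{n\times n}$ such that $$\|T-\tilde U\tilde\Lambda\tilde U^\top\|\le\epsilon,\qquad \|\tilde U^\top\tilde U-I\|\le\epsilon/n^2,$$ and also, for some $U,E\in\mathbb{R}^{n\times n}$, $$\tilde U=U+E,\qquad U^\top U=I,\qquad \|E\|\le\epsilon/n^2,\qquad \|T-U\tilde\Lambda U^\top\|\le\epsilon.$$ It uses at most $K\,n^2\log^{\xi+1}(n/\epsilon)$ arithmetic operations and comparisons, including the operations spent in the FMM calls. -/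

import Mathlib

open scoped Matrix.Norms.L2Operator

/-! ## The black-box fast multipole method -/

/-- The kernels `log x`, `1 / x` and `1 / x ^ 2`. -/
inductive FMMKernel where
  | log
  | inv
  | invSq

/-- The kernel as a function. On negative arguments `Real.log x` is `log |x|`, the usual convention
for the logarithmic kernel. -/
noncomputable def FMMKernel.fn : FMMKernel → ℝ → ℝ
  | .log, x => Real.log x
  | .inv, x => 1 / x
  | .invSq, x => 1 / x ^ 2

/-- The inputs on which an approximate FMM with accuracy `ε` has to work: at most `n` evaluation
points `x`, exactly `n` weights `c` and `n` sources `y`, all of magnitude less than `C`, with every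
evaluation point at distance at least `a * (ε / n) ^ p` (that is, `Ω(poly(ε / n))`) from every
source. -/
structure FMMAdmissible (ε C a : ℝ) (p m n : ℕ)
    (x : Fin m → ℝ) (c y : Fin n → ℝ) : Prop where
  n_pos : 0 < n
  eps_pos : 0 < ε
  eps_lt : ε < 1 / 2
  a_pos : 0 < a
  m_le : m ≤ n
  x_lt : ∀ i, |x i| < C
  c_lt : ∀ j, |c j| < C
  y_lt : ∀ j, |y j| < C
  sep : ∀ i j, a * (ε / n) ^ p ≤ |x i - y j|

/-- A black-box approximate FMM with exponent `ξ`, available for every accuracy `ε` and size `n`.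
`eval` are the returned values, `ops` is the number of arithmetic operations spent on the call.
For fixed `C`, `a`, `p` the number of operations is `O(n * log(n / ε) ^ ξ)`. -/
structure ApproxFMM (ξ : ℝ) where
  eval : FMMKernel → (ε C a : ℝ) → (p m n : ℕ) →
    (Fin m → ℝ) → (Fin n → ℝ) → (Fin n → ℝ) → Fin m → ℝ
  ops : FMMKernel → (ε C a : ℝ) → (p m n : ℕ) →
    (Fin m → ℝ) → (Fin n → ℝ) → (Fin n → ℝ) → ℕ
  accurate : ∀ (k : FMMKernel) (ε C a : ℝ) (p m n : ℕ)
    (x : Fin m → ℝ) (c y : Fin n → ℝ), FMMAdmissible ε C a p m n x c y →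
      ∀ i, |eval k ε C a p m n x c y i - ∑ j, c j * k.fn (x i - y j)| ≤ ε
  efficient : ∀ (C a : ℝ) (p : ℕ), ∃ K : ℝ, ∀ (k : FMMKernel) (ε : ℝ) (m n : ℕ)
    (x : Fin m → ℝ) (c y : Fin n → ℝ), FMMAdmissible ε C a p m n x c y →
      (ops k ε C a p m n x c y : ℝ) ≤ K * n * Real.log (n / ε) ^ ξ

/-! ## The Real RAM -/

/-- The binary arithmetic instructions. -/
inductive ArithOp where
  | add
  | sub
  | mul
  | div

/-- Real RAM programs returning a value of type `α`, where `R` is the type of the contents of the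
real registers. The programs below are polymorphic in `R`: they have no access to the numbers other
than through these instructions. Moving numbers, and integer and Boolean bookkeeping, is free. -/
inductive RAM (R α : Type) where
  /-- halt successfully -/
  | ret (v : α)
  /-- halt unsuccessfully -/
  | abort
  /-- load a natural number constant -/
  | const (k : ℕ) (next : R → RAM R α)
  /-- `+`, `-`, `*`, `/` -/
  | arith (o : ArithOp) (x y : R) (next : R → RAM R α)
  /-- square root -/
  | sqrt (x : R) (next : R → RAM R α)
  /-- the comparison `x < y` -/
  | less (x y : R) (next : Bool → RAM R α)
  /-- a call of the black-box FMM -/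
  | fmm (k : FMMKernel) (ε C a : R) (p m n : ℕ) (x : Fin m → R) (c y : Fin n → R)
      (next : (Fin m → R) → RAM R α)

namespace RAM

/-- Sequential composition. -/
def seq {R α β : Type} : RAM R α → (α → RAM R β) → RAM R β
  | ret v, f => f v
  | abort, _ => abort
  | const k next, f => const k fun r => (next r).seq f
  | arith o x y next, f => arith o x y fun r => (next r).seq f
  | sqrt x next, f => sqrt x fun r => (next r).seq f
  | less x y next, f => less x y fun b => (next b).seq f
  | fmm k ε C a p m n x c y next, f => fmm k ε C a p m n x c y fun r => (next r).seq f

instance {R : Type} : Monad (RAM R) where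
  pure := ret
  bind := seq

open Classical in
/-- Execution over the real numbers in infinite precision, with a given FMM implementation. The
result is `none` if the program aborts, divides by zero or takes the square root of a negative
number, and otherwise the returned value together with the number of operations: every instruction
counts one, a call of the FMM counts as many operations as the implementation spends on it. -/
noncomputable def run {ξ : ℝ} (F : ApproxFMM ξ) {α : Type} : RAM ℝ α → Option (α × ℕ)
  | ret v => some (v, 0)
  | abort => none
  | const k next => (run F (next k)).map fun r => (r.1, r.2 + 1)
  | arith .add x y next => (run F (next (x + y))).map fun r => (r.1, r.2 + 1)
  | arith .sub x y next => (run F (next (x - y))).map fun r => (r.1, r.2 + 1)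
  | arith .mul x y next => (run F (next (x * y))).map fun r => (r.1, r.2 + 1)
  | arith .div x y next =>
      if y = 0 then none else (run F (next (x / y))).map fun r => (r.1, r.2 + 1)
  | sqrt x next =>
      if x < 0 then none else (run F (next (Real.sqrt x))).map fun r => (r.1, r.2 + 1)
  | less x y next => (run F (next (decide (x < y)))).map fun r => (r.1, r.2 + 1)
  | fmm k ε C a p m n x c y next =>
      (run F (next (F.eval k ε C a p m n x c y))).map fun r =>
        (r.1, r.2 + F.ops k ε C a p m n x c y)

/-- Run `f 0`, …, `f (n - 1)` and collect the results. -/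
def tabulate {R α : Type} : (n : ℕ) → (Fin n → RAM R α) → RAM R (Fin n → α)
  | 0, _ => pure fun i => i.elim0
  | n + 1, f => do
      let v ← f 0
      let t ← tabulate n fun i => f i.succ
      pure (Fin.cons v t)

/-- Run `f` on the entries of a list. -/
def mapList {R α β : Type} (f : α → RAM R β) : List α → RAM R (List β)
  | [] => pure []
  | e :: es => do
      let v ← f e
      let t ← mapList f es
      pure (v :: t)

/-- Run the loop body `f` over the entries of a list, updating an accumulator. -/
def foldList {R α β : Type} (f : β → α → RAM R β) : β → List α → RAM R β
  | v, [] => pure v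
  | v, e :: es => do
      let w ← f v e
      foldList f w es

end RAM

/-! ## The divide-and-conquer eigensolver -/

namespace GuEisenstat

variable {R : Type}

def lit (k : ℕ) : RAM R R := .const k .ret
def plus (x y : R) : RAM R R := .arith .add x y .ret
def minus (x y : R) : RAM R R := .arith .sub x y .ret
def times (x y : R) : RAM R R := .arith .mul x y .ret
def divide (x y : R) : RAM R R := .arith .div x y .ret
def root (x : R) : RAM R R := .sqrt x .ret
def lessThan (x y : R) : RAM R Bool := .less x y .ret

/-- `-x` -/
def negate (x : R) : RAM R R := do
  let zero ← lit 0
  minus zero x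

/-- `|x|` -/
def absolute (x : R) : RAM R R := do
  let zero ← lit 0
  let isNeg ← lessThan x zero
  if isNeg then minus zero x else pure x

/-- `x ^ k` -/
def power (x : R) : ℕ → RAM R R
  | 0 => lit 1
  | k + 1 => do
      let y ← power x k
      times y x

/-- `s * u + t * v` -/
def combine {n : ℕ} (s t : R) (u v : Fin n → R) : RAM R (Fin n → R) :=
  RAM.tabulate n fun i => do
    let x ← times s (u i)
    let y ← times t (v i)
    plus x y

/-- A computed eigenvalue with the corresponding column of the eigenvector matrix. -/
structure EigenPair (R : Type) (n : ℕ) where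
  val : R
  vec : Fin n → R

/-- An index `j` of the shaft of an arrowhead matrix: the entry `z j` of the shaft, the diagonal
entry `d j`, and row `j` of the matrix `B` that is to be multiplied by the transposed eigenvector
matrix. -/
structure ShaftEntry (R : Type) (n : ℕ) where
  z : R
  d : R
  row : Fin n → R

/-- The tolerances: `tau` for deflation, `gap` for the distance between approximate eigenvalues and
poles, `epsEig` for the eigenvalues, `epsFMM` for the FMM. -/
structure Tolerances (R : Type) where
  tau : R
  gap : R
  epsEig : R
  epsFMM : R

/-- For the input size `n` and the target accuracy `ε`, all tolerances are powers of
`ε / (64 * n)`. -/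
def tolerances (n : ℕ) (ε : R) : RAM R (Tolerances R) := do
  let N ← lit (64 * n)
  let η ← divide ε N
  let tau ← power η 3
  let gap ← power η 10
  let epsEig ← power η 16
  let epsFMM ← power η 17
  pure ⟨tau, gap, epsEig, epsFMM⟩

/-- Call of the FMM on the sources `d`, with weights `w`. A source at `3` with weight `0` is added,
so that there are as many sources as evaluation points. -/
def callFMM (P : Tolerances R) (k : FMMKernel) {m : ℕ} (x : Fin (m + 1) → R)
    (w d : Fin m → R) : RAM R (Fin (m + 1) → R) := do
  let zero ← lit 0
  let one ← lit 1
  let three ← lit 3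
  let eight ← lit 8
  .fmm k P.epsFMM eight one 1 (m + 1) (m + 1) x (Fin.cons zero w : Fin (m + 1) → R)
    (Fin.cons three d : Fin (m + 1) → R) .ret

/-! ### Deflation of an arrowhead matrix -/

/-- Insertion into a list that is sorted by `d`. -/
def insertByD {n : ℕ} (e : ShaftEntry R n) : List (ShaftEntry R n) → RAM R (List (ShaftEntry R n))
  | [] => pure [e]
  | f :: fs => do
      let gt ← lessThan f.d e.d
      if gt then do
        let t ← insertByD e fs
        pure (f :: t)
      else pure (e :: f :: fs)

/-- Sort the shaft by ascending `d`. -/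
def sortByD {n : ℕ} : List (ShaftEntry R n) → RAM R (List (ShaftEntry R n))
  | [] => pure []
  | e :: es => do
      let t ← sortByD es
      insertByD e t

/-- Entries with `|z| < tau` are deflated: `z` is replaced by zero, and `d` becomes an eigenvalue.
Returns the remaining shaft and the deflated eigenvalues. -/
def deflateShaft {n : ℕ} (tau : R) :
    List (ShaftEntry R n) → RAM R (List (ShaftEntry R n) × List (EigenPair R n))
  | [] => pure ([], [])
  | e :: es => do
      let r ← deflateShaft tau es
      let s ← absolute e.z
      let small ← lessThan s tau
      if small then pure (r.1, ⟨e.d, e.row⟩ :: r.2) else pure (e :: r.1, r.2)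

/-- Rotation of two indices that annihilates the second shaft entry; the off-diagonal entry that
arises between the two indices is dropped, so that the second index is deflated. -/
def rotate {n : ℕ} (e f : ShaftEntry R n) : RAM R (ShaftEntry R n × EigenPair R n) := do
  let ze2 ← times e.z e.z
  let zf2 ← times f.z f.z
  let r2 ← plus ze2 zf2
  let r ← root r2
  let c ← divide e.z r
  let s ← divide f.z r
  let ns ← negate s
  let c2 ← times c c
  let s2 ← times s s
  let x ← times c2 e.d
  let y ← times s2 f.d
  let d1 ← plus x y
  let x' ← times s2 e.d
  let y' ← times c2 f.d
  let d2 ← plus x' y'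
  let row1 ← combine c s e.row f.row
  let row2 ← combine ns c e.row f.row
  pure (⟨r, d1, row1⟩, ⟨d2, row2⟩)

/-- For a sorted shaft, from the last index to the first, an index whose `d` is within `tau` of the
next remaining one is rotated with it, which deflates one of the two. -/
def deflateDiagonal {n : ℕ} (tau : R) :
    List (ShaftEntry R n) → RAM R (List (ShaftEntry R n) × List (EigenPair R n))
  | [] => pure ([], [])
  | e :: es => do
      let r ← deflateDiagonal tau es
      match r.1 with
      | [] => pure ([e], r.2)
      | f :: fs => do
          let g ← minus f.d e.d
          let far ← lessThan tau g
          if far then pure (e :: f :: fs, r.2)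
          else do
            let ef ← rotate e f
            pure (ef.1 :: fs, ef.2 :: r.2)

/-! ### Eigenvalues of a deflated arrowhead matrix -/

/-- Approximate values of the secular function `x - α + ∑ j, z j ^ 2 / (d j - x)` at the points
`x i`, by one call of the FMM. -/
def secular (P : Tolerances R) {m : ℕ} (α : R) (z d : Fin m → R) (x : Fin (m + 1) → R) :
    RAM R (Fin (m + 1) → R) := do
  let w ← RAM.tabulate m fun j => times (z j) (z j)
  let v ← callFMM P .inv x w d
  RAM.tabulate (m + 1) fun i => do
    let y ← minus (x i) α
    minus y (v i)

/-- Initial interval for eigenvalue `i`: between the poles `d (i - 1)` and `d i`, at distance `gap`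
from them, where `-2` and `2` bound the two outer intervals. -/
def initialInterval (P : Tolerances R) {m : ℕ} (d : Fin m → R) (i : Fin (m + 1)) :
    RAM R (R × R) := do
  let two ← lit 2
  let lo ← if h : 0 < i.val then plus (d ⟨i.val - 1, by omega⟩) P.gap else negate two
  let hi ← if h : i.val < m then minus (d ⟨i.val, h⟩) P.gap else pure two
  pure (lo, hi)

/-- Simultaneous bisection for all eigenvalues, until all intervals have width at most `epsEig`. An
interval is collapsed to its midpoint if the sign of the secular function there is uncertain. The
first argument bounds the number of iterations; the program aborts if it is exhausted. -/
def bisect (P : Tolerances R) {m : ℕ} (α : R) (z d : Fin m → R) :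
    ℕ → (Fin (m + 1) → R × R) → RAM R (Fin (m + 1) → R)
  | 0, _ => .abort
  | fuel + 1, I => do
      let two ← lit 2
      let wide ← RAM.tabulate (m + 1) fun i => do
        let w ← minus (I i).2 (I i).1
        lessThan P.epsEig w
      let mid ← RAM.tabulate (m + 1) fun i => do
        let t ← plus (I i).1 (I i).2
        divide t two
      if ∃ i, wide i = true then do
        let v ← secular P α z d mid
        let negEps ← negate P.epsFMM
        let I' ← RAM.tabulate (m + 1) fun i => do
          let isPos ← lessThan P.epsFMM (v i)
          if isPos then pure ((I i).1, mid i)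
          else do
            let isNeg ← lessThan (v i) negEps
            if isNeg then pure (mid i, (I i).2) else pure (mid i, mid i)
        bisect P α z d fuel I'
      else pure mid

/-! ### Eigenvectors of an arrowhead matrix with the computed eigenvalues -/

/-- The shaft entry `i` of the arrowhead matrix with poles `d` and eigenvalues `ev`, with the sign
of `z i`; its square is
`(d i - ev 0) * (ev (i + 1) - d i) * ∏ j ≠ i, (ev (j + 1) - d i) / (d j - d i)`. -/
def shaftFromEigenvalues {m : ℕ} (z d : Fin m → R) (ev : Fin (m + 1) → R) (i : Fin m) :
    RAM R R := do
  let zero ← lit 0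
  let x ← minus (d i) (ev 0)
  let y ← minus (ev i.succ) (d i)
  let xy ← times x y
  let sq ← RAM.foldList (fun acc j =>
    if j = i then pure acc
    else do
      let num ← minus (ev j.succ) (d i)
      let den ← minus (d j) (d i)
      let q ← divide num den
      times acc q) xy (List.finRange m)
  let r ← root sq
  let isNeg ← lessThan (z i) zero
  if isNeg then negate r else pure r

/-- Approximate eigenvalues `ev i` of the arrowhead matrix with head `α` and the given shaft, and
the approximate products of the transposed eigenvector matrix with `B`, column by column. With the
reconstructed shaft `zh`, the product of eigenvector `i` with a column `q` is
`(-q₀ + ∑ j, zh j * q j / (d j - ev i)) / √(1 + ∑ j, zh j ^ 2 / (d j - ev i) ^ 2)`; both sums are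
evaluated by the FMM. -/
def solveDeflated (fuel : ℕ) (P : Tolerances R) {n : ℕ} (α : R) (headRow : Fin n → R)
    (L : List (ShaftEntry R n)) : RAM R (List (EigenPair R n)) := do
  let z : Fin L.length → R := fun j => (L.get j).z
  let d : Fin L.length → R := fun j => (L.get j).d
  let I ← RAM.tabulate (L.length + 1) (initialInterval P d)
  let ev ← bisect P α z d fuel I
  let zh ← RAM.tabulate L.length (shaftFromEigenvalues z d ev)
  let zh2 ← RAM.tabulate L.length fun j => times (zh j) (zh j)
  let psi ← callFMM P .invSq ev zh2 d
  let one ← lit 1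
  let nrm ← RAM.tabulate (L.length + 1) fun i => do
    let s ← plus one (psi i)
    root s
  let cols ← RAM.tabulate n fun t => do
    let w ← RAM.tabulate L.length fun j => times (zh j) ((L.get j).row t)
    let phi ← callFMM P .inv ev w d
    RAM.tabulate (L.length + 1) fun i => do
      let x ← negate (headRow t)
      let y ← minus x (phi i)
      divide y (nrm i)
  pure (List.ofFn fun i : Fin (L.length + 1) => ⟨ev i, fun t => cols t i⟩)

/-- Diagonalization of the arrowhead matrix with head `α` and shaft `L`: deflation, then solution of
the deflated problem. -/
def solveArrowhead (fuel : ℕ) (P : Tolerances R) {n : ℕ} (α : R) (headRow : Fin n → R)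
    (L : List (ShaftEntry R n)) : RAM R (List (EigenPair R n)) := do
  let sorted ← sortByD L
  let r ← deflateShaft P.tau sorted
  let s ← deflateDiagonal P.tau r.1
  let t ← solveDeflated fuel P α headRow s.1
  pure (t ++ s.2 ++ r.2)

/-! ### Tridiagonal matrices -/

/-- Exact diagonalization of the matrix with rows `(p, q)` and `(q, r)`, where `q ≠ 0`. -/
def solveTwo (p q r : R) : RAM R (List (EigenPair R 2)) := do
  let two ← lit 2
  let sum ← plus p r
  let c ← divide sum two
  let dif ← minus p r
  let h ← divide dif two
  let h2 ← times h h
  let q2 ← times q q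
  let t2 ← plus h2 q2
  let t ← root t2
  let ev1 ← plus c t
  let ev2 ← minus c t
  let y ← minus t h
  let y2 ← times y y
  let s ← plus q2 y2
  let nrm ← root s
  let u ← divide q nrm
  let v ← divide y nrm
  let nv ← negate v
  pure [⟨ev1, ![u, v]⟩, ⟨ev2, ![nv, u]⟩]

/-- Assembly of the eigendecomposition of the tridiagonal matrix with diagonal blocks `T₁` (size
`k`), `α`, `T₂` (size `l`) and couplings `β₁`, `β₂`, from approximate eigendecompositions of `T₁` and
`T₂`: the matrix is similar, through `W`, to the arrowhead matrix with head `α`, diagonal entries the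
eigenvalues of the blocks, and shaft `β₁` times the last row of the eigenvector matrix of `T₁`
followed by `β₂` times the first row of that of `T₂`. The arrowhead matrix is diagonalized and its
transposed eigenvector matrix is multiplied with the transpose of `W`. -/
def assemble (fuel : ℕ) (P : Tolerances R) {k l n : ℕ} (hk : 0 < k) (hl : 0 < l)
    (hn : n = k + 1 + l) (α β₁ β₂ : R) (E₁ : List (EigenPair R k)) (E₂ : List (EigenPair R l)) :
    RAM R (List (EigenPair R n)) := do
  let zero ← lit 0
  let one ← lit 1
  let L₁ ← RAM.mapList (fun e => do
    let z ← times β₁ (e.vec ⟨k - 1, by omega⟩)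
    pure (⟨z, e.val, fun i => if h : i.val < k then e.vec ⟨i.val, h⟩ else zero⟩ :
      ShaftEntry R n)) E₁
  let L₂ ← RAM.mapList (fun e => do
    let z ← times β₂ (e.vec ⟨0, hl⟩)
    pure (⟨z, e.val, fun i =>
        if h : k < i.val then e.vec ⟨i.val - (k + 1), by omega⟩ else zero⟩ :
      ShaftEntry R n)) E₂
  solveArrowhead fuel P α (fun i => if i.val = k then one else zero) (L₁ ++ L₂)

/-- The recursion on the diagonal block of size `n` that starts at index `s`, of the tridiagonal
matrix with diagonal entries `a i` and off-diagonal entries `b i` (in rows `i`, `i + 1`). -/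
def diagonalizeBlock (fuel : ℕ) (P : Tolerances R) (a b : ℕ → R) :
    (n s : ℕ) → RAM R (List (EigenPair R n))
  | 0, _ => pure []
  | 1, s => do
      let one ← lit 1
      pure [⟨a s, fun _ => one⟩]
  | 2, s => solveTwo (a s) (b s) (a (s + 1))
  | n + 3, s => do
      let E₁ ← diagonalizeBlock fuel P a b ((n + 2) / 2) s
      let E₂ ← diagonalizeBlock fuel P a b ((n + 3) / 2) (s + (n + 2) / 2 + 1)
      assemble fuel P (by omega) (by omega) (by omega)
        (a (s + (n + 2) / 2)) (b (s + (n + 2) / 2 - 1)) (b (s + (n + 2) / 2)) E₁ E₂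
termination_by n => n

/-- The algorithm: for a tridiagonal matrix of size `n` with diagonal `a` and off-diagonal `b`, and
accuracy `ε`, returns approximate eigenpairs. In each bisection at most `fuel` iterations are
allowed. -/
def diagonalize (fuel n : ℕ) (a b : ℕ → R) (ε : R) : RAM R (List (EigenPair R n)) := do
  let P ← tolerances n ε
  diagonalizeBlock fuel P a b n 0

end GuEisenstat

/-! ## Input and output -/

/-- Symmetric tridiagonal matrices without vanishing entries next to the diagonal. -/
structure IsUnreducedSymmTridiagonal {n : ℕ} (T : Matrix (Fin n) (Fin n) ℝ) : Prop where
  symm : T.IsSymm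
  tridiagonal : ∀ i j : Fin n, i.val + 1 < j.val → T i j = 0
  unreduced : ∀ i j : Fin n, i.val + 1 = j.val → T i j ≠ 0

/-- The input memory that holds the diagonal of `T`. -/
def diagEntries {n : ℕ} (T : Matrix (Fin n) (Fin n) ℝ) (i : ℕ) : ℝ :=
  if h : i < n then T ⟨i, h⟩ ⟨i, h⟩ else 0

/-- The input memory that holds the entries of `T` next to the diagonal. -/
def offDiagEntries {n : ℕ} (T : Matrix (Fin n) (Fin n) ℝ) (i : ℕ) : ℝ :=
  if h : i + 1 < n then T ⟨i, by omega⟩ ⟨i + 1, h⟩ else 0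

/-- The output memory that holds the diagonal matrix with entries `Λ` and the columns of `U`. -/
def outputPairs {n : ℕ} (U : Matrix (Fin n) (Fin n) ℝ) (Λ : Fin n → ℝ) :
    List (GuEisenstat.EigenPair ℝ n) :=
  List.ofFn fun j => ⟨Λ j, fun i => U i j⟩

/-! ## Execution of programs -/

namespace RAM

variable {ξ : ℝ} {F : ApproxFMM ξ} {α β : Type}

/-! The proof is a backward error analysis in which orthogonality is never lost. A list of computed
eigenpairs is always written as the image, under a matrix `A` close to the identity, of an exactly
orthonormal list (`ApproxDiagonalizes`). The branches of the algorithm depend only on shafts and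
poles, and the vectors enter linearly. A run on vectors `A *ᵥ r` is therefore shadowed by an ideal
run on the orthonormal vectors `r`, with `A` applied at the end. Only two errors are tracked: the
distance of `A` from the identity, which comes from the FMM, and the distance between the quadratic
form of the ideal list and that of the tridiagonal block. Both are additive along the recursion.

One arrowhead problem, with `η = ε / (64 * n)`. Deflation changes the form by at most `2 * N * η ^
3`; afterwards distinct poles are more than `η ^ 3` apart and all shaft entries are at least `η ^ 3`
in modulus. Close to a pole its own term then dominates the secular function, so there is a root in
every interval at distance `η ^ 10` from the poles. The secular function has slope at least one
between poles, so bisection with function values accurate to `η ^ 17` finds each root up to `η ^ 16`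
(`fuelExec_bisect`).

The computed numbers interlace the poles strictly. By Loewner's formula they are the exact
eigenvalues of an arrowhead matrix with the same poles (`secular_loewner`), and a comparison of
products shows that its head and shaft are within `2 * η ^ 5` of the given ones
(`IsDeflated.loewner_close`). The eigenvectors of this matrix are exactly orthonormal
(`arrow_diagonalization`). The FMM evaluates the required products with them up to `6 * η ^ 17` in
each entry, and this error is absorbed into `A` (`exists_transform`).

Assembling blocks of sizes `k` and `l` into one of size `n = k + 1 + l` thus adds at most `4 * N * η
^ 3` to the form error and `6 * N * η ^ 17` to the error of `A` (`fuelExec_assemble`). Budgets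
proportional to the block size, with these numbers as the share of one coordinate, close the
induction, and at the root they are below `ε / 4` and `ε / (32 * n ^ 2)`.

Cost: with `t` bisection steps and `X` FMM operations per source, an arrowhead problem of size `n`
takes at most `n ^ 2 * (t + 7) * (X + 17)` operations. Since the block sizes halve, the root
dominates the recursion (`recursion_cost_le`); `t` is of order `log (n / ε)` and `X` of order `log
(n / ε) ^ ξ`. -/

theorem run_bind (p : RAM ℝ α) (f : α → RAM ℝ β) :
    (p >>= f).run F =
      (p.run F).bind fun r => ((f r.1).run F).map fun s => (s.1, r.2 + s.2) := by
  have key : ∀ p : RAM ℝ α, (p.seq f).run F =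
      (p.run F).bind fun r => ((f r.1).run F).map fun s => (s.1, r.2 + s.2) := by
    intro p
    induction p with
    | ret v => cases h : (f v).run F <;> simp [seq, run, h]
    | abort => simp [seq, run]
    | const k next ih =>
      simp only [seq, run, ih, Option.map_bind, Option.bind_map]
      congr 1; funext r; simp [Function.comp_def, add_right_comm]
    | arith o x y next ih =>
      cases o
      case div =>
        simp only [seq, run]
        split_ifs
        · simp
        · simp only [ih, Option.map_bind, Option.bind_map]
          congr 1; funext r; simp [Function.comp_def, add_right_comm]
      all_goals
        simp only [seq, run, ih, Option.map_bind, Option.bind_map]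
        congr 1; funext r; simp [Function.comp_def, add_right_comm]
    | sqrt x next ih =>
      simp only [seq, run]
      split_ifs
      · simp
      · simp only [ih, Option.map_bind, Option.bind_map]
        congr 1; funext r; simp [Function.comp_def, add_right_comm]
    | less x y next ih =>
      simp only [seq, run, ih, Option.map_bind, Option.bind_map]
      congr 1; funext r; simp [Function.comp_def, add_right_comm]
    | fmm k ε C a p m n x c y next ih =>
      simp only [seq, run, ih, Option.map_bind, Option.bind_map]
      congr 1; funext r; simp [Function.comp_def, add_right_comm]
  exact key p

/-- The program succeeds with value `v`, in at most `C` operations. -/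
def Exec (F : ApproxFMM ξ) (p : RAM ℝ α) (v : α) (C : ℕ) : Prop :=
  ∃ c, c ≤ C ∧ p.run F = some (v, c)

/-- For all sufficiently large amounts of fuel, the program succeeds with value `v`, in one and the
same number of at most `C` operations. -/
def FuelExec (F : ApproxFMM ξ) (p : ℕ → RAM ℝ α) (v : α) (C : ℕ) : Prop :=
  ∃ c, c ≤ C ∧ ∃ f₀, ∀ fuel, f₀ ≤ fuel → (p fuel).run F = some (v, c)

theorem Exec.pure (v : α) : Exec F (Pure.pure v) v 0 := ⟨0, le_rfl, rfl⟩

theorem Exec.mono {p : RAM ℝ α} {v : α} {C C' : ℕ} (h : Exec F p v C) (hC : C ≤ C') :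
    Exec F p v C' := by
  obtain ⟨c, hc, h⟩ := h
  exact ⟨c, hc.trans hC, h⟩

theorem Exec.bind {p : RAM ℝ α} {f : α → RAM ℝ β} {v : α} {w : β} {C C' : ℕ}
    (h : Exec F p v C) (h' : Exec F (f v) w C') : Exec F (p >>= f) w (C + C') := by
  obtain ⟨c, hc, h⟩ := h
  obtain ⟨c', hc', h'⟩ := h'
  exact ⟨c + c', by omega, by simp [run_bind, h, h']⟩

theorem Exec.fuelExec {p : RAM ℝ α} {v : α} {C : ℕ} (h : Exec F p v C) :
    FuelExec F (fun _ => p) v C := by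
  obtain ⟨c, hc, h⟩ := h
  exact ⟨c, hc, 0, fun _ _ => h⟩

theorem FuelExec.mono {p : ℕ → RAM ℝ α} {v : α} {C C' : ℕ} (h : FuelExec F p v C)
    (hC : C ≤ C') : FuelExec F p v C' := by
  obtain ⟨c, hc, h⟩ := h
  exact ⟨c, hc.trans hC, h⟩

theorem FuelExec.bind {p : ℕ → RAM ℝ α} {f : ℕ → α → RAM ℝ β} {v : α} {w : β} {C C' : ℕ}
    (h : FuelExec F p v C) (h' : FuelExec F (fun n => f n v) w C') :
    FuelExec F (fun n => p n >>= f n) w (C + C') := by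
  obtain ⟨c, hc, f₀, h⟩ := h
  obtain ⟨c', hc', f₁, h'⟩ := h'
  refine ⟨c + c', by omega, max f₀ f₁, fun n hn => ?_⟩
  have h1 := h n (le_trans (le_max_left _ _) hn)
  have h2 := h' n (le_trans (le_max_right _ _) hn)
  simp only at h2
  simp [run_bind, h1, h2]

theorem Exec.bindFuel {p : RAM ℝ α} {f : ℕ → α → RAM ℝ β} {v : α} {w : β} {C C' : ℕ}
    (h : Exec F p v C) (h' : FuelExec F (fun n => f n v) w C') :
    FuelExec F (fun n => p >>= f n) w (C + C') :=
  h.fuelExec.bind h'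

theorem exec_tabulate {n : ℕ} {f : Fin n → RAM ℝ α} {v : Fin n → α} {C : ℕ}
    (h : ∀ i, Exec F (f i) (v i) C) : Exec F (tabulate n f) v (n * C) := by
  induction n with
  | zero =>
    have : v = fun i => i.elim0 := funext fun i => i.elim0
    subst this
    exact (Exec.pure _).mono (Nat.zero_le _)
  | succ n ih =>
    have hv : v = Fin.cons (v 0) fun i => v i.succ := (Fin.cons_self_tail v).symm
    rw [hv, tabulate]
    refine Exec.mono (Exec.bind (h 0) (Exec.bind (ih fun i => h i.succ) (Exec.pure _))) ?_
    rw [Nat.succ_mul]; omega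

theorem exec_mapList {f : α → RAM ℝ β} {g : α → β} {C : ℕ} (h : ∀ a, Exec F (f a) (g a) C) :
    ∀ l : List α, Exec F (mapList f l) (l.map g) (l.length * C)
  | [] => (Exec.pure _).mono (Nat.zero_le _)
  | a :: l => by
    rw [mapList, List.map_cons]
    refine Exec.mono (Exec.bind (h a) (Exec.bind (exec_mapList h l) (Exec.pure _))) ?_
    rw [List.length_cons, Nat.succ_mul]; omega

theorem exec_foldList {f : β → α → RAM ℝ β} {g : β → α → β} {C : ℕ} {l : List α}
    (h : ∀ b, ∀ a ∈ l, Exec F (f b a) (g b a) C) (b : β) :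
    Exec F (foldList f b l) (l.foldl g b) (l.length * C) := by
  induction l generalizing b with
  | nil => exact (Exec.pure _).mono (Nat.zero_le _)
  | cons a l ih =>
    rw [foldList]
    refine Exec.mono (Exec.bind (h b a (by simp)) (ih (fun b a ha => h b a (by simp [ha])) _)) ?_
    rw [List.length_cons, Nat.succ_mul]; omega

end RAM

/-! ### Values and costs of the elementary programs -/

namespace GuEisenstat

open RAM

variable {ξ : ℝ} {F : ApproxFMM ξ}

theorem exec_lit (k : ℕ) : Exec F (lit k) (k : ℝ) 1 := ⟨1, le_rfl, rfl⟩

theorem exec_plus (x y : ℝ) : Exec F (plus x y) (x + y) 1 := ⟨1, le_rfl, rfl⟩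

theorem exec_minus (x y : ℝ) : Exec F (minus x y) (x - y) 1 := ⟨1, le_rfl, rfl⟩

theorem exec_times (x y : ℝ) : Exec F (times x y) (x * y) 1 := ⟨1, le_rfl, rfl⟩

theorem exec_divide (x : ℝ) {y : ℝ} (hy : y ≠ 0) : Exec F (divide x y) (x / y) 1 :=
  ⟨1, le_rfl, by simp [divide, run, hy]⟩

theorem exec_root {x : ℝ} (hx : 0 ≤ x) : Exec F (root x) (Real.sqrt x) 1 :=
  ⟨1, le_rfl, by simp [root, run, hx.not_gt]⟩

theorem exec_lessThan (x y : ℝ) : Exec F (lessThan x y) (decide (x < y)) 1 :=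
  ⟨1, le_rfl, by simp [lessThan, run]⟩

theorem exec_lit_zero : Exec F (lit 0) (0 : ℝ) 1 := by
  simpa only [Nat.cast_zero] using exec_lit (F := F) 0

theorem exec_lit_one : Exec F (lit 1) (1 : ℝ) 1 := by
  simpa only [Nat.cast_one] using exec_lit (F := F) 1

theorem exec_negate (x : ℝ) : Exec F (negate x) (-x) 2 := by
  unfold negate
  refine Exec.bind (C' := 1) exec_lit_zero ?_
  rw [← zero_sub x]
  exact exec_minus _ x

theorem exec_absolute (x : ℝ) : Exec F (absolute x) |x| 3 := by
  unfold absolute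
  refine Exec.bind (C' := 2) (exec_lit 0) (Exec.bind (C' := 1) (exec_lessThan _ _) ?_)
  by_cases hx : x < 0
  · have h := exec_minus (F := F) 0 x
    simpa [hx, abs_of_neg hx] using h
  · simpa [hx, abs_of_nonneg (not_lt.1 hx)] using (Exec.pure (F := F) x).mono (Nat.zero_le 1)

theorem exec_power (x : ℝ) : ∀ k : ℕ, Exec F (power x k) (x ^ k) (k + 1)
  | 0 => by
    rw [power, pow_zero]
    exact exec_lit_one
  | k + 1 => by
    rw [power, pow_succ]
    exact Exec.bind (exec_power x k) (exec_times _ _)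

theorem exec_combine {n : ℕ} (s t : ℝ) (u v : Fin n → ℝ) :
    Exec F (combine s t u v) (fun i => s * u i + t * v i) (n * 3) :=
  exec_tabulate fun _ => Exec.bind (C' := 2) (exec_times _ _)
    (Exec.bind (C' := 1) (exec_times _ _) (exec_plus _ _))

/-- The tolerances for `η = ε / (64 * n)`. -/
noncomputable def powTolerances (η : ℝ) : Tolerances ℝ := ⟨η ^ 3, η ^ 10, η ^ 16, η ^ 17⟩

theorem exec_tolerances {n : ℕ} (hn : 0 < n) (ε : ℝ) :
    Exec F (tolerances n ε) (powTolerances (ε / (64 * n))) 60 := by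
  have h64 : ((64 * n : ℕ) : ℝ) ≠ 0 := by positivity
  have h : powTolerances (ε / (64 * n)) = powTolerances (ε / ((64 * n : ℕ) : ℝ)) := by
    push_cast; rfl
  rw [h]
  unfold tolerances
  refine Exec.mono (Exec.bind (exec_lit (64 * n)) (Exec.bind (exec_divide ε h64)
    (Exec.bind (exec_power _ 3) (Exec.bind (exec_power _ 10) (Exec.bind (exec_power _ 16)
      (Exec.bind (exec_power _ 17) (Exec.pure _))))))) ?_
  omega

end GuEisenstat

/-! ## Deflation -/

namespace GuEisenstat

open RAM Matrix

variable {ξ : ℝ} {F : ApproxFMM ξ} {n : ℕ}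

/-- Application of a matrix to the row of a shaft entry. -/
def ShaftEntry.transform (A : Matrix (Fin n) (Fin n) ℝ) (e : ShaftEntry ℝ n) : ShaftEntry ℝ n :=
  ⟨e.z, e.d, A *ᵥ e.row⟩

/-- Application of a matrix to an approximate eigenvector. -/
def EigenPair.transform (A : Matrix (Fin n) (Fin n) ℝ) (e : EigenPair ℝ n) : EigenPair ℝ n :=
  ⟨e.val, A *ᵥ e.vec⟩

/-- The quadratic form of the Gram operator of the rows of a shaft. -/
def shaftGram (L : List (ShaftEntry ℝ n)) (x : Fin n → ℝ) : ℝ :=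
  (L.map fun e => (e.row ⬝ᵥ x) ^ 2).sum

/-- The quadratic form of the arrowhead matrix with head row `h` and head entry zero. -/
def shaftForm (h : Fin n → ℝ) (L : List (ShaftEntry ℝ n)) (x : Fin n → ℝ) : ℝ :=
  (L.map fun e => e.d * (e.row ⬝ᵥ x) ^ 2 + 2 * e.z * (h ⬝ᵥ x) * (e.row ⬝ᵥ x)).sum

/-- The quadratic form of the Gram operator of a list of vectors. -/
def pairGram (D : List (EigenPair ℝ n)) (x : Fin n → ℝ) : ℝ :=
  (D.map fun e => (e.vec ⬝ᵥ x) ^ 2).sum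

/-- The quadratic form of the matrix given by a list of eigenpairs. -/
def pairForm (D : List (EigenPair ℝ n)) (x : Fin n → ℝ) : ℝ :=
  (D.map fun e => e.val * (e.vec ⬝ᵥ x) ^ 2).sum

theorem shaftGram_nonneg (L : List (ShaftEntry ℝ n)) (x : Fin n → ℝ) : 0 ≤ shaftGram L x :=
  List.sum_nonneg (by simp only [List.mem_map]; rintro _ ⟨e, -, rfl⟩; positivity)

theorem pairGram_nonneg (L : List (EigenPair ℝ n)) (x : Fin n → ℝ) : 0 ≤ pairGram L x :=
  List.sum_nonneg (by simp only [List.mem_map]; rintro _ ⟨e, -, rfl⟩; positivity)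

@[simp] theorem shaftGram_nil (x : Fin n → ℝ) : shaftGram [] x = 0 := rfl
@[simp] theorem shaftForm_nil (h x : Fin n → ℝ) : shaftForm h [] x = 0 := rfl
@[simp] theorem pairGram_nil (x : Fin n → ℝ) : pairGram [] x = 0 := rfl
@[simp] theorem pairForm_nil (x : Fin n → ℝ) : pairForm [] x = 0 := rfl

@[simp] theorem shaftGram_cons (e : ShaftEntry ℝ n) (L : List (ShaftEntry ℝ n)) (x : Fin n → ℝ) :
    shaftGram (e :: L) x = (e.row ⬝ᵥ x) ^ 2 + shaftGram L x := rfl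

@[simp] theorem shaftForm_cons (h : Fin n → ℝ) (e : ShaftEntry ℝ n) (L : List (ShaftEntry ℝ n))
    (x : Fin n → ℝ) : shaftForm h (e :: L) x =
      e.d * (e.row ⬝ᵥ x) ^ 2 + 2 * e.z * (h ⬝ᵥ x) * (e.row ⬝ᵥ x) + shaftForm h L x := rfl

@[simp] theorem pairGram_cons (e : EigenPair ℝ n) (L : List (EigenPair ℝ n)) (x : Fin n → ℝ) :
    pairGram (e :: L) x = (e.vec ⬝ᵥ x) ^ 2 + pairGram L x := rfl

@[simp] theorem pairForm_cons (e : EigenPair ℝ n) (L : List (EigenPair ℝ n)) (x : Fin n → ℝ) :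
    pairForm (e :: L) x = e.val * (e.vec ⬝ᵥ x) ^ 2 + pairForm L x := rfl

@[simp] theorem pairGram_append (D D' : List (EigenPair ℝ n)) (x : Fin n → ℝ) :
    pairGram (D ++ D') x = pairGram D x + pairGram D' x := by simp [pairGram]

@[simp] theorem pairForm_append (D D' : List (EigenPair ℝ n)) (x : Fin n → ℝ) :
    pairForm (D ++ D') x = pairForm D x + pairForm D' x := by simp [pairForm]

@[simp] theorem shaftGram_append (D D' : List (ShaftEntry ℝ n)) (x : Fin n → ℝ) :
    shaftGram (D ++ D') x = shaftGram D x + shaftGram D' x := by simp [shaftGram]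

@[simp] theorem shaftForm_append (h : Fin n → ℝ) (D D' : List (ShaftEntry ℝ n)) (x : Fin n → ℝ) :
    shaftForm h (D ++ D') x = shaftForm h D x + shaftForm h D' x := by simp [shaftForm]

theorem shaftGram_perm {L L' : List (ShaftEntry ℝ n)} (h : L.Perm L') (x : Fin n → ℝ) :
    shaftGram L x = shaftGram L' x := (h.map _).sum_eq

theorem shaftForm_perm {L L' : List (ShaftEntry ℝ n)} (hL : L.Perm L') (h x : Fin n → ℝ) :
    shaftForm h L x = shaftForm h L' x := (hL.map _).sum_eq

/-- The comparisons look at `d` alone, which `transform` leaves unchanged. The program on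
transformed entries therefore takes the branches of the run on the original list. All deflation
lemmas are stated in this equivariant form. -/
theorem exec_insertByD (A : Matrix (Fin n) (Fin n) ℝ) (e : ShaftEntry ℝ n) :
    ∀ L : List (ShaftEntry ℝ n), L.Pairwise (fun e f => e.d ≤ f.d) →
      ∃ L' : List (ShaftEntry ℝ n), L'.Perm (e :: L) ∧ L'.Pairwise (fun e f => e.d ≤ f.d) ∧
        Exec F (insertByD (e.transform A) (L.map (·.transform A)))
          (L'.map (·.transform A)) L.length
  | [], _ => ⟨[e], .refl _, by simp, Exec.pure _⟩
  | f :: L, hL => by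
    rw [List.pairwise_cons] at hL
    obtain ⟨L', hp, hs, hx⟩ := exec_insertByD A e L hL.2
    by_cases h : f.d < e.d
    · refine ⟨f :: L', ((hp.cons f).trans (.swap _ _ _)), ?_, ?_⟩
      · rw [List.pairwise_cons]
        refine ⟨fun a ha => ?_, hs⟩
        rcases List.mem_cons.1 (hp.mem_iff.1 ha) with rfl | ha
        · exact h.le
        · exact hL.1 a ha
      · rw [List.map_cons, insertByD]
        refine Exec.mono (Exec.bind (C' := L.length) (exec_lessThan _ _) ?_)
          (by rw [List.length_cons, Nat.add_comm])
        simp only [ShaftEntry.transform, h, decide_true, if_true]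
        exact Exec.bind (C' := 0) hx (Exec.pure _)
    · refine ⟨e :: f :: L, .refl _, ?_, ?_⟩
      · simp only [List.pairwise_cons, List.mem_cons, forall_eq_or_imp]
        exact ⟨⟨not_lt.1 h, fun a ha => (not_lt.1 h).trans (hL.1 a ha)⟩, hL⟩
      · rw [List.map_cons, insertByD]
        refine Exec.mono (Exec.bind (C' := 0) (exec_lessThan _ _) ?_)
          (by rw [List.length_cons]; omega)
        simp only [ShaftEntry.transform, h, decide_false]
        exact Exec.pure _

theorem exec_sortByD (A : Matrix (Fin n) (Fin n) ℝ) : ∀ L : List (ShaftEntry ℝ n),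
    ∃ L' : List (ShaftEntry ℝ n), L'.Perm L ∧ L'.Pairwise (fun e f => e.d ≤ f.d) ∧
      Exec F (sortByD (L.map (·.transform A))) (L'.map (·.transform A)) (L.length * L.length)
  | [] => ⟨[], .refl _, .nil, Exec.pure _⟩
  | e :: L => by
    obtain ⟨L₁, hp₁, hs₁, hx₁⟩ := exec_sortByD A L
    obtain ⟨L₂, hp₂, hs₂, hx₂⟩ := exec_insertByD (F := F) A e L₁ hs₁
    refine ⟨L₂, hp₂.trans (hp₁.cons e), hs₂, ?_⟩
    rw [List.map_cons, sortByD]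
    refine Exec.mono (Exec.bind hx₁ hx₂) ?_
    rw [hp₁.length_eq, List.length_cons]
    nlinarith

/-- Dropping the coupling `z` removes `2 * z * (h ⬝ᵥ x) * (e.row ⬝ᵥ x)` from the form, which is at
most `τ` times the sum of the two squares. Every deflated entry is charged `(h ⬝ᵥ x) ^ 2` once,
hence the factor `L.length`, whereas the squares of the rows add up to the Gram form. -/
theorem exec_deflateShaft (A : Matrix (Fin n) (Fin n) ℝ) (h : Fin n → ℝ) {τ : ℝ} (hτ : 0 < τ) :
    ∀ L : List (ShaftEntry ℝ n), ∃ L' D, L'.Sublist L ∧ (∀ e ∈ L', τ ≤ |e.z|) ∧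
      L'.length + D.length = L.length ∧
      (∀ x, shaftGram L' x + pairGram D x = shaftGram L x) ∧
      (∀ x, |shaftForm h L' x + pairForm D x - shaftForm h L x| ≤
        τ * (L.length * (h ⬝ᵥ x) ^ 2 + shaftGram L x)) ∧
      Exec F (deflateShaft τ (L.map (·.transform A)))
        (L'.map (·.transform A), D.map (·.transform A)) (L.length * 4)
  | [] => ⟨[], [], .refl _, by simp, rfl, by simp, by simp, Exec.pure _⟩
  | e :: L => by
    obtain ⟨L', D, hs, hz, hl, hg, hf, hx⟩ := exec_deflateShaft A h hτ L
    by_cases hez : |e.z| < τ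
    · refine ⟨L', ⟨e.d, e.row⟩ :: D, hs.cons _, hz, by simp [← hl, add_assoc],
        fun x => ?_, fun x => ?_, ?_⟩
      · simp [← hg]; ring
      · simp only [pairForm_cons, shaftForm_cons, shaftGram_cons, List.length_cons, Nat.cast_succ]
        have h1 := hf x
        have h2 : |2 * e.z * (h ⬝ᵥ x) * (e.row ⬝ᵥ x)| ≤
            τ * ((h ⬝ᵥ x) ^ 2 + (e.row ⬝ᵥ x) ^ 2) := by
          have h3 : 2 * |h ⬝ᵥ x| * |e.row ⬝ᵥ x| ≤ (h ⬝ᵥ x) ^ 2 + (e.row ⬝ᵥ x) ^ 2 := by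
            rw [← sq_abs (h ⬝ᵥ x), ← sq_abs (e.row ⬝ᵥ x)]
            exact two_mul_le_add_sq _ _
          calc |2 * e.z * (h ⬝ᵥ x) * (e.row ⬝ᵥ x)|
              = |e.z| * (2 * |h ⬝ᵥ x| * |e.row ⬝ᵥ x|) := by
                simp only [abs_mul, abs_two]; ring
            _ ≤ τ * (2 * |h ⬝ᵥ x| * |e.row ⬝ᵥ x|) := by gcongr
            _ ≤ _ := by gcongr
        rw [abs_le] at h1 h2 ⊢
        constructor <;> nlinarith
      · rw [List.map_cons, deflateShaft]
        refine Exec.mono (Exec.bind hx (Exec.bind (exec_absolute _)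
          (Exec.bind (C' := 0) (exec_lessThan _ _) ?_))) (by rw [List.length_cons]; omega)
        simp only [ShaftEntry.transform, hez, decide_true, if_true]
        exact Exec.pure _
    · refine ⟨e :: L', D, hs.cons_cons _, ?_, by simp [← hl]; omega,
        fun x => ?_, fun x => ?_, ?_⟩
      · simp only [List.mem_cons, forall_eq_or_imp]
        exact ⟨not_lt.1 hez, hz⟩
      · simp [← hg]; ring
      · simp only [shaftForm_cons, shaftGram_cons, List.length_cons, Nat.cast_succ]
        have h1 := hf x
        have h2 : 0 ≤ τ * ((h ⬝ᵥ x) ^ 2 + (e.row ⬝ᵥ x) ^ 2) := by positivity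
        rw [abs_le] at h1 ⊢
        constructor <;> nlinarith
      · rw [List.map_cons, deflateShaft]
        refine Exec.mono (Exec.bind hx (Exec.bind (exec_absolute _)
          (Exec.bind (C' := 0) (exec_lessThan _ _) ?_))) (by rw [List.length_cons]; omega)
        simp only [ShaftEntry.transform, hez, decide_false]
        exact Exec.pure _

/-- The value of the program `rotate`. -/
noncomputable def rotated (e f : ShaftEntry ℝ n) : ShaftEntry ℝ n × EigenPair ℝ n :=
  let r := √(e.z * e.z + f.z * f.z)
  let c := e.z / r
  let s := f.z / r
  (⟨r, c * c * e.d + s * s * f.d, fun i => c * e.row i + s * f.row i⟩,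
    ⟨s * s * e.d + c * c * f.d, fun i => -s * e.row i + c * f.row i⟩)

theorem exec_rotate {e f : ShaftEntry ℝ n} (he : e.z ≠ 0) :
    Exec F (rotate e f) (rotated e f) (20 + 6 * n) := by
  have h1 : 0 < e.z * e.z + f.z * f.z := by
    have := mul_self_pos.2 he
    nlinarith [mul_self_nonneg f.z]
  have h2 : √(e.z * e.z + f.z * f.z) ≠ 0 := (Real.sqrt_pos.2 h1).ne'
  unfold rotate
  refine Exec.mono (Exec.bind (exec_times _ _) <| Exec.bind (exec_times _ _) <|
    Exec.bind (exec_plus _ _) <| Exec.bind (exec_root h1.le) <| Exec.bind (exec_divide _ h2) <|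
    Exec.bind (exec_divide _ h2) <| Exec.bind (exec_negate _) <| Exec.bind (exec_times _ _) <|
    Exec.bind (exec_times _ _) <| Exec.bind (exec_times _ _) <| Exec.bind (exec_times _ _) <|
    Exec.bind (exec_plus _ _) <| Exec.bind (exec_times _ _) <| Exec.bind (exec_times _ _) <|
    Exec.bind (exec_plus _ _) <| Exec.bind (exec_combine _ _ _ _) <|
    Exec.bind (exec_combine _ _ _ _) <| Exec.pure _) ?_
  omega

theorem rotated_transform (A : Matrix (Fin n) (Fin n) ℝ) (e f : ShaftEntry ℝ n) :
    rotated (e.transform A) (f.transform A) =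
      ((rotated e f).1.transform A, (rotated e f).2.transform A) := by
  have key : ∀ (s t : ℝ) (u v : Fin n → ℝ),
      (fun i => s * (A *ᵥ u) i + t * (A *ᵥ v) i) = A *ᵥ fun i => s * u i + t * v i := by
    intro s t u v
    have : (fun i => s * u i + t * v i) = s • u + t • v := rfl
    rw [this, mulVec_add, mulVec_smul, mulVec_smul]
    rfl
  simp only [rotated, ShaftEntry.transform, EigenPair.transform, key]

/-- The rotation is orthogonal and carries the shaft pair `(e.z, f.z)` to `(r, 0)`, so the only loss
is the dropped off-diagonal entry, of size `(f.d - e.d) * c * s`. The new pole is a convex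
combination of the old ones and the shaft entry does not shrink, so the rotated entry may stay in a
deflated list. -/
theorem rotated_bounds {τ : ℝ} (h : Fin n → ℝ) {e f : ShaftEntry ℝ n} (he : e.z ≠ 0)
    (hef : e.d ≤ f.d) (hτ : f.d - e.d ≤ τ) :
    |e.z| ≤ (rotated e f).1.z ∧ e.d ≤ (rotated e f).1.d ∧ (rotated e f).1.d ≤ f.d ∧
    (∀ x, ((rotated e f).1.row ⬝ᵥ x) ^ 2 + ((rotated e f).2.vec ⬝ᵥ x) ^ 2 =
      (e.row ⬝ᵥ x) ^ 2 + (f.row ⬝ᵥ x) ^ 2) ∧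
    ∀ x, |shaftForm h [(rotated e f).1] x + pairForm [(rotated e f).2] x -
      shaftForm h [e, f] x| ≤ τ * ((e.row ⬝ᵥ x) ^ 2 + (f.row ⬝ᵥ x) ^ 2) := by
  have h1 : 0 < e.z * e.z + f.z * f.z := by
    have := mul_self_pos.2 he
    nlinarith [mul_self_nonneg f.z]
  obtain ⟨r, hr⟩ : ∃ r, r = √(e.z * e.z + f.z * f.z) := ⟨_, rfl⟩
  have hr0 : 0 < r := hr ▸ Real.sqrt_pos.2 h1
  have hr2 : r * r = e.z * e.z + f.z * f.z := hr ▸ Real.mul_self_sqrt h1.le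
  obtain ⟨c, hc⟩ : ∃ c, c = e.z / r := ⟨_, rfl⟩
  obtain ⟨s, hs⟩ : ∃ s, s = f.z / r := ⟨_, rfl⟩
  have hcr : e.z = r * c := by rw [hc]; field_simp
  have hsr : f.z = r * s := by rw [hs]; field_simp
  have hcs : c * c + s * s = 1 := by
    rw [hc, hs]; field_simp; nlinarith
  have hrot : rotated e f = (⟨r, c * c * e.d + s * s * f.d, fun i => c * e.row i + s * f.row i⟩,
    ⟨s * s * e.d + c * c * f.d, fun i => -s * e.row i + c * f.row i⟩) := by
    simp only [rotated, ← hr, ← hc, ← hs]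
  have hdot : ∀ (s t : ℝ) (x : Fin n → ℝ), (fun i => s * e.row i + t * f.row i) ⬝ᵥ x =
      s * (e.row ⬝ᵥ x) + t * (f.row ⬝ᵥ x) := by
    intro s t x
    have : (fun i => s * e.row i + t * f.row i) = s • e.row + t • f.row := rfl
    rw [this, add_dotProduct, smul_dotProduct, smul_dotProduct, smul_eq_mul, smul_eq_mul]
  rw [hrot]
  simp only [shaftForm_cons, pairForm_cons, shaftForm_nil, pairForm_nil, hdot]
  refine ⟨?_, ?_, ?_, fun x => ?_, fun x => ?_⟩
  · rw [hr]
    apply Real.le_sqrt_of_sq_le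
    rw [sq_abs]; nlinarith [mul_self_nonneg f.z]
  · have := mul_nonneg (mul_self_nonneg s) (sub_nonneg.2 hef)
    linear_combination this - e.d * hcs
  · have := mul_nonneg (mul_self_nonneg c) (sub_nonneg.2 hef)
    linear_combination this + f.d * hcs
  · linear_combination ((e.row ⬝ᵥ x) ^ 2 + (f.row ⬝ᵥ x) ^ 2) * hcs
  · set u := e.row ⬝ᵥ x
    set v := f.row ⬝ᵥ x
    set g := h ⬝ᵥ x
    have hid : (c * c * e.d + s * s * f.d) * (c * u + s * v) ^ 2 +
        2 * r * g * (c * u + s * v) + 0 +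
        ((s * s * e.d + c * c * f.d) * (-s * u + c * v) ^ 2 + 0) -
        (e.d * u ^ 2 + 2 * e.z * g * u + (f.d * v ^ 2 + 2 * f.z * g * v + 0)) =
        -- This is the dropped off-diagonal term in rotated coordinates; all other terms cancel
        -- because `c * c + s * s = 1`.
        - ((f.d - e.d) * (2 * c * s) * ((c * u + s * v) * (-s * u + c * v))) := by
      have hs2 : s * s = 1 - c * c := by linarith
      rw [hcr, hsr]
      linear_combination (e.d * u ^ 2 + f.d * v ^ 2) * (c * c + s * s + 1) * hcs
    rw [hid, abs_neg, abs_mul, abs_mul, abs_of_nonneg (sub_nonneg.2 hef)]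
    have h2 : |2 * c * s| ≤ 1 := by
      rw [abs_le]; constructor <;> nlinarith [sq_nonneg (c + s), sq_nonneg (c - s)]
    have h3 : |(c * u + s * v) * (-s * u + c * v)| ≤ u ^ 2 + v ^ 2 := by
      have h4 : (c * u + s * v) ^ 2 + (-s * u + c * v) ^ 2 = u ^ 2 + v ^ 2 := by
        linear_combination (u ^ 2 + v ^ 2) * hcs
      rw [abs_le]
      constructor <;> nlinarith [sq_nonneg ((c * u + s * v) + (-s * u + c * v)),
        sq_nonneg ((c * u + s * v) - (-s * u + c * v)), sq_nonneg u, sq_nonneg v]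
    have hτ0 : 0 ≤ τ := (sub_nonneg.2 hef).trans hτ
    calc (f.d - e.d) * |2 * c * s| * |(c * u + s * v) * (-s * u + c * v)|
        ≤ τ * 1 * (u ^ 2 + v ^ 2) := by gcongr
      _ = _ := by ring

/-- The list is treated from its end. A rotation can only lower the pole of the first retained
entry, so its distance to the later ones stays above `τ`. Retained poles need not occur in `L`; the
clause with the lower bound `b` is what shows that the next pole to be treated is still the
smallest. -/
theorem exec_deflateDiagonal (A : Matrix (Fin n) (Fin n) ℝ) (h : Fin n → ℝ) {τ : ℝ} (hτ : 0 < τ) :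
    ∀ L : List (ShaftEntry ℝ n), L.Pairwise (fun e f => e.d ≤ f.d) → (∀ e ∈ L, τ ≤ |e.z|) →
      ∃ L' D, L'.Pairwise (fun e f => τ < f.d - e.d) ∧ (∀ e ∈ L', τ ≤ |e.z|) ∧
      (∀ b, (∀ e ∈ L, b ≤ e.d) → ∀ e ∈ L', b ≤ e.d) ∧
      L'.length + D.length = L.length ∧
      (∀ x, shaftGram L' x + pairGram D x = shaftGram L x) ∧
      (∀ x, |shaftForm h L' x + pairForm D x - shaftForm h L x| ≤
        τ * (L.length * shaftGram L x)) ∧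
      Exec F (deflateDiagonal τ (L.map (·.transform A)))
        (L'.map (·.transform A), D.map (·.transform A)) (L.length * (22 + 6 * n))
  | [], _, _ => ⟨[], [], by simp, by simp, by simp, rfl, by simp, by simp,
      (Exec.pure _).mono (Nat.zero_le _)⟩
  | e :: L, hL, hz => by
    rw [List.pairwise_cons] at hL
    simp only [List.mem_cons, forall_eq_or_imp] at hz
    obtain ⟨L', D, hs, hz', hb, hl, hg, hf, hx⟩ := exec_deflateDiagonal A h hτ L hL.2 hz.2
    have he0 : e.z ≠ 0 := abs_pos.1 (hτ.trans_le hz.1)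
    have hmono : ∀ x, (L.length : ℝ) * shaftGram L x ≤
        (L.length : ℝ) * ((e.row ⬝ᵥ x) ^ 2 + shaftGram L x) := fun x => by
      gcongr; nlinarith [sq_nonneg (e.row ⬝ᵥ x)]
    cases L' with
    | nil =>
      refine ⟨[e], D, by simp, by simpa using hz.1, fun b hb' => by simpa using hb' e (by simp),
        ?_, fun x => ?_, fun x => ?_, ?_⟩
      · simp at hl ⊢; omega
      · simp [← hg]
      · have h1 := hf x
        have h2 : 0 ≤ (e.row ⬝ᵥ x) ^ 2 + shaftGram L x := by
          have := shaftGram_nonneg L x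
          positivity
        have h3 := mul_le_mul_of_nonneg_left (hmono x) hτ.le
        have h4 := mul_nonneg hτ.le h2
        simp only [shaftForm_cons, shaftForm_nil, shaftGram_cons, List.length_cons,
          Nat.cast_succ] at h1 ⊢
        rw [abs_le] at h1 ⊢
        constructor <;> nlinarith
      · rw [List.map_cons, deflateDiagonal]
        exact Exec.mono (Exec.bind (C' := 0) hx (Exec.pure _)) (by
          rw [List.length_cons]; nlinarith)
    | cons f L' =>
      rw [List.pairwise_cons] at hs
      simp only [List.mem_cons, forall_eq_or_imp] at hz'
      have hef : e.d ≤ f.d := hb e.d hL.1 f (by simp)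
      by_cases hfar : τ < f.d - e.d
      · refine ⟨e :: f :: L', D, ?_, ?_, fun b hb' => ?_, ?_, fun x => ?_, fun x => ?_, ?_⟩
        · simp only [List.pairwise_cons, List.mem_cons, forall_eq_or_imp]
          exact ⟨⟨hfar, fun a ha => by linarith [hs.1 a ha]⟩, hs⟩
        · simp only [List.mem_cons, forall_eq_or_imp]
          exact ⟨hz.1, hz'⟩
        · have hbe := hb' e (by simp)
          have := hb b fun a ha => hb' a (by simp [ha])
          simp only [List.mem_cons, forall_eq_or_imp] at this ⊢
          exact ⟨hbe, this⟩
        · simp at hl ⊢; omega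
        · rw [shaftGram_cons e, shaftGram_cons e, ← hg]; ring
        · have h1 := hf x
          have h2 : 0 ≤ (e.row ⬝ᵥ x) ^ 2 + shaftGram L x := by
            have := shaftGram_nonneg L x
            positivity
          have h3 := mul_le_mul_of_nonneg_left (hmono x) hτ.le
          have h4 := mul_nonneg hτ.le h2
          rw [shaftForm_cons h e, shaftForm_cons h e]
          simp only [shaftGram_cons e L, List.length_cons, Nat.cast_succ] at h1 ⊢
          rw [abs_le] at h1 ⊢
          constructor <;> nlinarith
        · rw [List.map_cons, deflateDiagonal]
          refine Exec.mono (Exec.bind (C' := 2) hx ?_) (by rw [List.length_cons]; nlinarith)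
          simp only [List.map_cons]
          refine Exec.bind (C' := 1) (exec_minus _ _) (Exec.bind (C' := 0) (exec_lessThan _ _) ?_)
          simp only [ShaftEntry.transform, hfar, decide_true, if_true]
          exact Exec.pure _
      · obtain ⟨hrz, hrd, hrd', hrg, hrf⟩ := rotated_bounds h he0 hef (not_lt.1 hfar)
        refine ⟨(rotated e f).1 :: L', (rotated e f).2 :: D, ?_, ?_, fun b hb' => ?_, ?_,
          fun x => ?_, fun x => ?_, ?_⟩
        · rw [List.pairwise_cons]
          exact ⟨fun a ha => by linarith [hs.1 a ha], hs.2⟩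
        · simp only [List.mem_cons, forall_eq_or_imp]
          exact ⟨hz.1.trans (hrz.trans (le_abs_self _)), hz'.2⟩
        · have hbe := hb' e (by simp)
          have := hb b fun a ha => hb' a (by simp [ha])
          simp only [List.mem_cons, forall_eq_or_imp] at this ⊢
          exact ⟨hbe.trans hrd, this.2⟩
        · simp at hl ⊢; omega
        · have h1 := hg x
          have h2 := hrg x
          simp only [shaftGram_cons, pairGram_cons] at h1 ⊢
          linarith
        · have h1 := hf x
          have h2 := hrf x
          have h3 := mul_le_mul_of_nonneg_left (hmono x) hτ.le
          -- The row of `f` may result from many rotations, but it is still part of an orthogonal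
          -- change of the rows of `L`. Hence one rotation costs at most `τ` times the Gram form of
          -- `e :: L`, and there is at most one for each entry.
          have h5 : (f.row ⬝ᵥ x) ^ 2 ≤ shaftGram L x := by
            rw [← hg, shaftGram_cons]
            have := shaftGram_nonneg L' x
            have := pairGram_nonneg D x
            linarith
          have h6 := mul_le_mul_of_nonneg_left h5 hτ.le
          simp only [shaftForm_cons, shaftForm_nil, pairForm_cons, pairForm_nil,
            shaftGram_cons e L, List.length_cons, Nat.cast_succ] at h1 h2 ⊢
          rw [abs_le] at h1 h2 ⊢
          constructor <;> nlinarith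
        · rw [List.map_cons, deflateDiagonal]
          refine Exec.mono (Exec.bind (C' := 22 + 6 * n) hx ?_) (by
            rw [List.length_cons, Nat.succ_mul (List.length _)])
          simp only [List.map_cons]
          refine Exec.mono (Exec.bind (exec_minus _ _)
            (Exec.bind (C' := 20 + 6 * n) (exec_lessThan _ _) ?_)) (by omega)
          have h1 : (decide (τ < (f.transform A).d - (e.transform A).d)) = false :=
            decide_eq_false hfar
          rw [h1]
          simp only [Bool.false_eq_true, if_false]
          refine Exec.bind (C' := 0) (exec_rotate (by exact he0)) ?_
          rw [rotated_transform]
          exact Exec.pure _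

end GuEisenstat

/-! ## Arrowhead matrices with prescribed eigenvalues -/

namespace GuEisenstat

open Matrix Polynomial

/-! ### Loewner's formula for an arrowhead matrix with given poles and eigenvalues -/

section Loewner

variable {m : ℕ}

/-- The square of the shaft entry `i` of the arrowhead matrix with poles `d` and eigenvalues `e`. -/
noncomputable def loewnerWeight (d : Fin m → ℝ) (e : Fin (m + 1) → ℝ) (i : Fin m) : ℝ :=
  (d i - e 0) * (e i.succ - d i) *
    ∏ j ∈ Finset.univ.erase i, (e j.succ - d i) / (d j - d i)

/-- The weight is minus the residue at `d i` of `∏ (x - e j) / ∏ (x - d j)`. This form without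
quotients is the one used in all interpolation arguments below. -/
theorem loewnerWeight_mul {d : Fin m → ℝ} (hd : Function.Injective d) (e : Fin (m + 1) → ℝ)
    (i : Fin m) : loewnerWeight d e i * ∏ l ∈ Finset.univ.erase i, (d i - d l) =
      -∏ j, (d i - e j) := by
  have h1 : (∏ j ∈ Finset.univ.erase i, (e j.succ - d i) / (d j - d i)) *
      ∏ l ∈ Finset.univ.erase i, (d i - d l) = ∏ j ∈ Finset.univ.erase i, (d i - e j.succ) := by
    rw [← Finset.prod_mul_distrib]
    refine Finset.prod_congr rfl fun j hj => ?_
    have : d j - d i ≠ 0 := sub_ne_zero.2 (hd.ne (Finset.ne_of_mem_erase hj))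
    field_simp
    ring
  rw [loewnerWeight, mul_assoc, h1, Fin.prod_univ_succ,
    ← Finset.mul_prod_erase Finset.univ (fun j : Fin m => d i - e j.succ) (Finset.mem_univ i)]
  ring

theorem eval_weighted_prod_erase (d w : Fin m → ℝ) (i : Fin m) :
    (∑ j, C (w j) * ∏ l ∈ Finset.univ.erase j, (X - C (d l))).eval (d i) =
      w i * ∏ l ∈ Finset.univ.erase i, (d i - d l) := by
  rw [eval_finsetSum, Finset.sum_eq_single i]
  · simp [eval_prod]
  · intro j _ hj
    rw [eval_mul, eval_prod, Finset.prod_eq_zero (i := i)]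
    · simp
    · simp [hj.symm]
    · simp
  · simp

theorem degree_weighted_prod_erase_lt (d w : Fin m → ℝ) :
    (∑ j, C (w j) * ∏ l ∈ Finset.univ.erase j, (X - C (d l))).degree < ((m : ℕ) : WithBot ℕ) := by
  refine (degree_sum_le _ _).trans_lt ((Finset.sup_lt_iff (WithBot.bot_lt_coe m)).2 fun j _ => ?_)
  rw [← smul_eq_C_mul]
  refine (degree_smul_le _ _).trans_lt ?_
  rw [degree_prod]
  simp only [degree_X_sub_C, Finset.sum_const, nsmul_eq_mul, mul_one,
    Finset.card_erase_of_mem (Finset.mem_univ j), Finset.card_univ, Fintype.card_fin]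
  have h : m - 1 < m := by have := j.2; omega
  exact WithBot.coe_lt_coe.2 h

/-- Both polynomials are monic of degree `m + 1`, and the constant `∑ e - ∑ d` (the trace condition
for the head) makes the next coefficients agree too. The difference is then determined by its values
at the `m` poles. -/
theorem degree_prod_sub_lt (d : Fin m → ℝ) (e : Fin (m + 1) → ℝ) :
    (∏ j, (X - C (e j)) - (X - C (∑ j, e j - ∑ j, d j)) * ∏ j, (X - C (d j))).degree < ((m : ℕ) : WithBot ℕ) := by
  have hm1 : (∏ j, (X - C (e j))).Monic := monic_prod_X_sub_C _ _
  have hm2 : (∏ j, (X - C (d j))).Monic := monic_prod_X_sub_C _ _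
  have hm3 : ((X - C (∑ j, e j - ∑ j, d j)) * ∏ j, (X - C (d j))).Monic :=
    (monic_X_sub_C _).mul hm2
  have hd1 : (∏ j, (X - C (e j))).natDegree = m + 1 := by simp
  have hd2 : (∏ j, (X - C (d j))).natDegree = m := by simp
  have hd3 : ((X - C (∑ j, e j - ∑ j, d j)) * ∏ j, (X - C (d j))).natDegree = m + 1 := by
    rw [(monic_X_sub_C _).natDegree_mul hm2, natDegree_X_sub_C, hd2, add_comm]
  have hn1 : (∏ j, (X - C (e j))).coeff m = -∑ j, e j := by
    have h := prod_X_sub_C_nextCoeff (s := Finset.univ) e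
    rwa [nextCoeff_of_natDegree_pos (by omega), hd1, Nat.add_sub_cancel] at h
  have hn3 : ((X - C (∑ j, e j - ∑ j, d j)) * ∏ j, (X - C (d j))).coeff m = -∑ j, e j := by
    have h := (monic_X_sub_C (∑ j, e j - ∑ j, d j)).nextCoeff_mul hm2
    rw [prod_X_sub_C_nextCoeff (s := Finset.univ) d, nextCoeff_X_sub_C,
      nextCoeff_of_natDegree_pos (by omega), hd3, Nat.add_sub_cancel] at h
    rw [h]; ring
  rw [degree_lt_iff_coeff_zero]
  intro k hk
  rcases hk.eq_or_lt with rfl | hk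
  · rw [coeff_sub, hn1, hn3, sub_self]
  · rcases (Nat.succ_le_of_lt hk).eq_or_lt with rfl | hk
    · have h1 := hm1.coeff_natDegree
      have h3 := hm3.coeff_natDegree
      rw [hd1] at h1
      rw [hd3] at h3
      rw [coeff_sub, Nat.succ_eq_add_one, h1, h3, sub_self]
    · rw [coeff_sub, coeff_eq_zero_of_natDegree_lt (by omega),
        coeff_eq_zero_of_natDegree_lt (by omega), sub_self]

/-- Partial fraction decomposition of `∏ (x - e j) / ∏ (x - d j)`. -/
theorem prod_sub_eq_loewner {d : Fin m → ℝ} (hd : Function.Injective d) (e : Fin (m + 1) → ℝ)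
    (x : ℝ) : ∏ j, (x - e j) = (x - (∑ j, e j - ∑ j, d j)) * ∏ j, (x - d j) -
      ∑ j, loewnerWeight d e j * ∏ l ∈ Finset.univ.erase j, (x - d l) := by
  set w := loewnerWeight d e
  have h : ∏ j, (X - C (e j)) - (X - C (∑ j, e j - ∑ j, d j)) * ∏ j, (X - C (d j)) =
      -∑ j, C (w j) * ∏ l ∈ Finset.univ.erase j, (X - C (d l)) := by
    have hcard : ((Finset.univ.image d).card : WithBot ℕ) = m := by
      rw [Finset.card_image_of_injective _ hd]; simp
    refine eq_of_degree_sub_lt_of_eval_finset_eq (Finset.univ.image d) ?_ ?_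
    · rw [hcard, sub_neg_eq_add]
      exact (degree_add_le _ _).trans_lt
        (max_lt (degree_prod_sub_lt d e) (degree_weighted_prod_erase_lt d w))
    · simp only [Finset.mem_image, Finset.mem_univ, true_and, forall_exists_index,
        forall_apply_eq_imp_iff]
      intro i
      rw [eval_neg, eval_weighted_prod_erase, loewnerWeight_mul hd, neg_neg, eval_sub, eval_mul,
        eval_prod, eval_prod, Finset.prod_eq_zero (i := i) (Finset.mem_univ _) (by simp), mul_zero,
        sub_zero]
      simp
  have h2 := congrArg (eval x) h
  simp only [eval_sub, eval_mul, eval_prod, eval_neg, eval_finsetSum, eval_X, eval_C] at h2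
  linarith

/-- A secular function with simple roots `e` determines the squares of the shaft and the head. -/
theorem eq_loewner_of_roots {α : ℝ} {d w : Fin m → ℝ} {e : Fin (m + 1) → ℝ}
    (hd : Function.Injective d) (he : Function.Injective e) (hed : ∀ i j, e i ≠ d j)
    (hroot : ∀ i, e i - α = ∑ j, w j / (e i - d j)) :
    (∀ i, w i = loewnerWeight d e i) ∧ α = ∑ j, e j - ∑ j, d j := by
  have hne : ∀ i, ∏ j, (e i - d j) ≠ 0 := fun i =>
    Finset.prod_ne_zero_iff.2 fun j _ => sub_ne_zero.2 (hed i j)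
  have herase : ∀ i j, ∏ l ∈ Finset.univ.erase j, (e i - d l) =
      (∏ l, (e i - d l)) / (e i - d j) := fun i j => by
    rw [eq_div_iff (sub_ne_zero.2 (hed i j)), mul_comm,
      Finset.mul_prod_erase _ (fun l => e i - d l) (Finset.mem_univ j)]
  -- The right side is the secular function multiplied by all its denominators. It vanishes at the
  -- `m + 1` distinct roots and its leading term cancels that of the left side, so the two agree;
  -- evaluation at a pole then isolates one weight.
  have h : ∏ j, (X - C (e j)) = (X - C α) * ∏ j, (X - C (d j)) -
      ∑ j, C (w j) * ∏ l ∈ Finset.univ.erase j, (X - C (d l)) := by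
    have hcard : ((Finset.univ.image e).card : WithBot ℕ) = (m + 1 : ℕ) := by
      rw [Finset.card_image_of_injective _ he]; simp
    refine eq_of_degree_sub_lt_of_eval_finset_eq (Finset.univ.image e) ?_ ?_
    · rw [hcard]
      have h1 := degree_prod_sub_lt d e
      have h2 := degree_weighted_prod_erase_lt d w
      have h3 : (C (∑ j, e j - ∑ j, d j - α) * ∏ j, (X - C (d j))).degree ≤ ((m : ℕ) : WithBot ℕ) := by
        rw [← smul_eq_C_mul]
        refine (degree_smul_le _ _).trans ?_
        rw [degree_prod]
        simp
      have hm : (m : WithBot ℕ) < ((m + 1 : ℕ) : WithBot ℕ) := by exact_mod_cast Nat.lt_succ_self m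
      have h4 : ∏ j, (X - C (e j)) - ((X - C α) * ∏ j, (X - C (d j)) -
          ∑ j, C (w j) * ∏ l ∈ Finset.univ.erase j, (X - C (d l))) =
          (∏ j, (X - C (e j)) - (X - C (∑ j, e j - ∑ j, d j)) * ∏ j, (X - C (d j))) +
          (∑ j, C (w j) * ∏ l ∈ Finset.univ.erase j, (X - C (d l)) -
            C (∑ j, e j - ∑ j, d j - α) * ∏ j, (X - C (d j))) := by
        rw [C_sub (a := ∑ j, e j - ∑ j, d j) (b := α)]
        ring
      rw [h4]
      refine (degree_add_le _ _).trans_lt (max_lt (h1.trans hm) ?_)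
      exact (degree_sub_le _ _).trans_lt (max_lt (h2.trans hm) (h3.trans_lt hm))
    · simp only [Finset.mem_image, Finset.mem_univ, true_and, forall_exists_index,
        forall_apply_eq_imp_iff]
      intro i
      simp only [eval_sub, eval_mul, eval_prod, eval_finsetSum, eval_X, eval_C, herase]
      rw [Finset.prod_eq_zero (Finset.mem_univ i) (sub_self _), hroot i, Finset.sum_mul,
        ← Finset.sum_sub_distrib, eq_comm]
      exact Finset.sum_eq_zero fun j _ => by ring
  have hw : ∀ i, w i = loewnerWeight d e i := by
    intro i
    have h2 := congrArg (eval (d i)) h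
    rw [eval_sub, eval_weighted_prod_erase, eval_mul, eval_prod, eval_prod,
      Finset.prod_eq_zero (i := i) (Finset.mem_univ i) (by simp : eval (d i) (X - C (d i)) = 0),
      mul_zero, zero_sub, ← neg_eq_iff_eq_neg] at h2
    have h3 := loewnerWeight_mul hd e i
    simp only [eval_sub, eval_X, eval_C] at h2
    rw [h2] at h3
    refine (mul_right_cancel₀ ?_ h3).symm
    exact Finset.prod_ne_zero_iff.2 fun j hj =>
      sub_ne_zero.2 (hd.ne (Finset.ne_of_mem_erase hj).symm)
  refine ⟨hw, ?_⟩
  have h2 := congrArg (eval (e 0)) h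
  have h3 := prod_sub_eq_loewner hd e (e 0)
  simp only [eval_sub, eval_mul, eval_prod, eval_finsetSum, eval_X, eval_C, hw] at h2
  rw [h2, sub_left_inj] at h3
  have h4 := mul_right_cancel₀ (hne 0) h3
  linarith

/-- Evaluation of the partial fractions at `e i`. No closeness to true eigenvalues is assumed: any
numbers off the poles solve the secular equation with the Loewner weights, which is why computed
eigenvalues can be treated as exact ones. -/
theorem secular_loewner {d : Fin m → ℝ} (hd : Function.Injective d) {e : Fin (m + 1) → ℝ}
    (hed : ∀ i j, e i ≠ d j) (i : Fin (m + 1)) :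
    e i - (∑ j, e j - ∑ j, d j) = ∑ j, loewnerWeight d e j / (e i - d j) := by
  have hne : ∏ j, (e i - d j) ≠ 0 :=
    Finset.prod_ne_zero_iff.2 fun j _ => sub_ne_zero.2 (hed i j)
  have h := prod_sub_eq_loewner hd e (e i)
  rw [Finset.prod_eq_zero (Finset.mem_univ i) (sub_self _), eq_comm, sub_eq_zero] at h
  rw [← mul_left_inj' hne, h, Finset.sum_mul]
  refine Finset.sum_congr rfl fun j _ => ?_
  have := sub_ne_zero.2 (hed i j)
  rw [← Finset.mul_prod_erase _ _ (Finset.mem_univ j)]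
  field_simp

/-- Interlacing makes the squares of the shaft positive. -/
theorem loewnerWeight_pos {d : Fin m → ℝ} (hd : StrictMono d) {e : Fin (m + 1) → ℝ}
    (hlt : ∀ (i : Fin (m + 1)) (j : Fin m), j.val < i.val → d j < e i)
    (hgt : ∀ (i : Fin (m + 1)) (j : Fin m), i.val ≤ j.val → e i < d j) (i : Fin m) :
    0 < loewnerWeight d e i := by
  refine mul_pos (mul_pos (sub_pos.2 (hgt 0 i (Nat.zero_le _)))
    (sub_pos.2 (hlt _ i (by simp)))) (Finset.prod_pos fun j hj => ?_)
  rcases lt_or_gt_of_ne (Finset.ne_of_mem_erase hj) with h | h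
  · exact div_pos_of_neg_of_neg (sub_neg.2 (hgt _ _ (by simpa using h))) (sub_neg.2 (hd h))
  · refine div_pos (sub_pos.2 (hlt _ _ ?_)) (sub_pos.2 (hd h))
    have : i.val < j.val := h
    simp; omega

/-- The products of pole differences cancel in the ratio. The relative change of a weight depends
only on the errors of the eigenvalues relative to their distances from one pole. -/
theorem loewnerWeight_ratio {d : Fin m → ℝ} (hd : Function.Injective d) {e f : Fin (m + 1) → ℝ}
    (hfd : ∀ i j, f i ≠ d j) (i : Fin m) :
    loewnerWeight d e i = loewnerWeight d f i * ∏ j, (1 + (f j - e j) / (d i - f j)) := by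
  have h1 := loewnerWeight_mul hd e i
  have h2 := loewnerWeight_mul hd f i
  have h3 : ∏ j, (d i - e j) = (∏ j, (d i - f j)) * ∏ j, (1 + (f j - e j) / (d i - f j)) := by
    rw [← Finset.prod_mul_distrib]
    refine Finset.prod_congr rfl fun j _ => ?_
    have := sub_ne_zero.2 (hfd j i).symm
    field_simp
    ring
  refine mul_right_cancel₀ (b := ∏ l ∈ Finset.univ.erase i, (d i - d l)) ?_ ?_
  · exact Finset.prod_ne_zero_iff.2 fun j hj =>
      sub_ne_zero.2 (hd.ne (Finset.ne_of_mem_erase hj).symm)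
  · rw [h1, mul_right_comm, h2, h3]
    ring

end Loewner

/-! ### Orthonormal eigenvectors from the secular equation -/

section Diagonalization

variable {m : ℕ}

/-- The norm of the eigenvector of an arrowhead matrix for the eigenvalue `x`. -/
noncomputable def arrowNorm (z d : Fin m → ℝ) (x : ℝ) : ℝ :=
  √(1 + ∑ j, z j ^ 2 / (x - d j) ^ 2)

theorem one_le_arrowNorm (z d : Fin m → ℝ) (x : ℝ) : 1 ≤ arrowNorm z d x := by
  rw [arrowNorm, Real.one_le_sqrt]
  have : 0 ≤ ∑ j, z j ^ 2 / (x - d j) ^ 2 := Finset.sum_nonneg fun j _ => by positivity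
  linarith

/-- The coordinates, with respect to the eigenvectors of the arrowhead matrix with eigenvalues `e`,
of the vector with coordinates `y₀`, `y`. -/
noncomputable def arrowCoord (z d : Fin m → ℝ) (x y₀ : ℝ) (y : Fin m → ℝ) : ℝ :=
  (-y₀ + ∑ j, z j / (d j - x) * y j) / arrowNorm z d x

/-- The vector with entries `-1` and `z j / (d j - e i)`, divided by its norm, is an eigenvector for
`e i` by the secular equation. Two of them are orthogonal because the difference of their secular
equations, divided by `e i - e k`, is their inner product up to scaling. The two conclusions express
that the matrix of these vectors is orthogonal and diagonalizes the arrowhead matrix. -/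
theorem arrow_diagonalization {a : ℝ} {z d : Fin m → ℝ} {e : Fin (m + 1) → ℝ}
    (he : Function.Injective e) (hed : ∀ i j, e i ≠ d j)
    (hroot : ∀ i, e i - a = ∑ j, z j ^ 2 / (e i - d j)) (y₀ : ℝ) (y : Fin m → ℝ) :
    ∑ i, arrowCoord z d (e i) y₀ y ^ 2 = y₀ ^ 2 + ∑ j, y j ^ 2 ∧
    ∑ i, e i * arrowCoord z d (e i) y₀ y ^ 2 =
      a * y₀ ^ 2 + ∑ j, (d j * y j ^ 2 + 2 * z j * y₀ * y j) := by
  set ν : Fin (m + 1) → ℝ := fun i => arrowNorm z d (e i) with hν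
  have hν0 : ∀ i, ν i ≠ 0 := fun i => (zero_lt_one.trans_le (one_le_arrowNorm z d (e i))).ne'
  have hde : ∀ i j, d j - e i ≠ 0 := fun i j => sub_ne_zero.2 (hed i j).symm
  have hde' : ∀ i j, e i - d j ≠ 0 := fun i j => sub_ne_zero.2 (hed i j)
  let V : Matrix (Fin (m + 1)) (Fin (m + 1)) ℝ := Matrix.of fun i =>
    Fin.cons (-1 / ν i) fun j => z j / (d j - e i) / ν i
  have hV0 : ∀ i, V i 0 = -1 / ν i := fun i => rfl
  have hVs : ∀ i j, V i (Fin.succ j) = z j / (d j - e i) / ν i := fun i j => rfl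
  have hVV : V * Vᵀ = 1 := by
    ext i k
    rw [mul_apply, Fin.sum_univ_succ]
    simp only [transpose_apply, hV0, hVs]
    by_cases hik : i = k
    · subst hik
      have h1 : ν i ^ 2 = 1 + ∑ j, z j ^ 2 / (e i - d j) ^ 2 := by
        refine Real.sq_sqrt ?_
        have : 0 ≤ ∑ j, z j ^ 2 / (e i - d j) ^ 2 := Finset.sum_nonneg fun j _ => by positivity
        linarith
      have h2 : ∑ j, z j / (d j - e i) / ν i * (z j / (d j - e i) / ν i) =
          (∑ j, z j ^ 2 / (e i - d j) ^ 2) / ν i ^ 2 := by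
        rw [Finset.sum_div]
        refine Finset.sum_congr rfl fun j _ => ?_
        have h3 : (e i - d j) ^ 2 = (d j - e i) ^ 2 := by ring
        have := hde i j
        have := hν0 i
        rw [h3]; field_simp
      rw [h2, one_apply_eq]
      have := hν0 i
      have h4 : -1 / ν i * (-1 / ν i) = 1 / ν i ^ 2 := by field_simp
      rw [h4, ← add_div, ← h1, div_self (pow_ne_zero 2 this)]
    · rw [one_apply_ne hik]
      have hne : e i - e k ≠ 0 := sub_ne_zero.2 (he.ne hik)
      -- Partial fractions in `d j`; by the secular equations the quotient of differences becomes
      -- `-1`, which cancels the product of the two head entries.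
      have h2 : ∑ j, z j / (d j - e i) / ν i * (z j / (d j - e k) / ν k) =
          (∑ j, z j ^ 2 / (e k - d j) - ∑ j, z j ^ 2 / (e i - d j)) / (e i - e k) /
            (ν i * ν k) := by
        rw [← Finset.sum_sub_distrib, Finset.sum_div, Finset.sum_div]
        refine Finset.sum_congr rfl fun j _ => ?_
        have := hde i j
        have := hde k j
        have := hde' i j
        have := hde' k j
        have := hν0 i
        have := hν0 k
        field_simp
        ring
      rw [h2, ← hroot, ← hroot]
      have := hν0 i
      have := hν0 k
      field_simp
      ring
  have hVV' : Vᵀ * V = 1 := mul_eq_one_comm.1 hVV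
  let H : Matrix (Fin (m + 1)) (Fin (m + 1)) ℝ := Matrix.of
    (Fin.cons (Fin.cons a z) fun j => Fin.cons (z j) (Pi.single j (d j)))
  have hH : Vᵀ * diagonal e * V = H := by
    have h1 : H * Vᵀ = Vᵀ * diagonal e := by
      ext k i
      rw [mul_apply, mul_diagonal, transpose_apply, Fin.sum_univ_succ]
      simp only [transpose_apply, hV0, hVs]
      refine Fin.cases ?_ (fun k => ?_) k
      · have h3 : ∑ j, H 0 (Fin.succ j) * (z j / (d j - e i) / ν i) = -(e i - a) / ν i := by
          rw [hroot i, ← Finset.sum_neg_distrib, Finset.sum_div]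
          refine Finset.sum_congr rfl fun j _ => ?_
          have h4 : H 0 (Fin.succ j) = z j := rfl
          have := hde i j
          have := hde' i j
          have := hν0 i
          rw [h4]; field_simp; ring
        have h4 : H 0 0 = a := rfl
        rw [h3, h4, hV0]
        ring
      · have h3 : ∑ j, H k.succ (Fin.succ j) * (z j / (d j - e i) / ν i) =
            d k * (z k / (d k - e i) / ν i) := by
          have h4 : ∀ j, H k.succ (Fin.succ j) = (Pi.single k (d k) : Fin m → ℝ) j := fun j => rfl
          rw [Finset.sum_eq_single k]
          · rw [h4, Pi.single_eq_same]
          · intro j _ hj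
            rw [h4, Pi.single_eq_of_ne hj, zero_mul]
          · simp
        have h4 : H k.succ 0 = z k := rfl
        have := hde i k
        have := hν0 i
        rw [h3, h4, hVs]
        field_simp
        ring
    rw [← h1, Matrix.mul_assoc, hVV', Matrix.mul_one]
  let Y : Fin (m + 1) → ℝ := Fin.cons y₀ y
  have hc : ∀ i, arrowCoord z d (e i) y₀ y = (V *ᵥ Y) i := by
    intro i
    rw [mulVec, dotProduct, Fin.sum_univ_succ]
    simp only [hV0, hVs, Y, Fin.cons_zero, Fin.cons_succ, arrowCoord]
    rw [add_div, Finset.sum_div]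
    have h1 : arrowNorm z d (e i) = ν i := rfl
    rw [h1]
    congr 1
    · ring
    · exact Finset.sum_congr rfl fun j _ => by ring
  constructor
  · have h1 : (V *ᵥ Y) ⬝ᵥ (V *ᵥ Y) = Y ⬝ᵥ Y := by
      rw [dotProduct_mulVec, vecMul_mulVec, ← dotProduct_mulVec, hVV', one_mulVec]
    have h2 : Y ⬝ᵥ Y = y₀ ^ 2 + ∑ j, y j ^ 2 := by
      rw [dotProduct, Fin.sum_univ_succ]
      simp [Y, sq]
    rw [← h2, ← h1]
    simp only [hc, dotProduct, sq]
  · have h1 : (V *ᵥ Y) ⬝ᵥ (diagonal e *ᵥ (V *ᵥ Y)) = Y ⬝ᵥ (H *ᵥ Y) := by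
      rw [← hH, ← mulVec_mulVec, ← mulVec_mulVec, dotProduct_mulVec Y, vecMul_transpose]
    have h2 : Y ⬝ᵥ (H *ᵥ Y) = a * y₀ ^ 2 + ∑ j, (d j * y j ^ 2 + 2 * z j * y₀ * y j) := by
      have h3 : (H *ᵥ Y) 0 = a * y₀ + ∑ j, z j * y j := by
        rw [mulVec, dotProduct, Fin.sum_univ_succ]; rfl
      have h4 : ∀ k : Fin m, (H *ᵥ Y) k.succ = z k * y₀ + d k * y k := by
        intro k
        rw [mulVec, dotProduct, Fin.sum_univ_succ]
        have h5 : ∀ j : Fin m, H k.succ (Fin.succ j) = (Pi.single k (d k) : Fin m → ℝ) j :=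
          fun j => rfl
        have h6 : H k.succ 0 = z k := rfl
        rw [Finset.sum_eq_single k]
        · rw [h5, Pi.single_eq_same, h6]; rfl
        · intro j _ hj
          rw [h5, Pi.single_eq_of_ne hj, zero_mul]
        · simp
      rw [dotProduct, Fin.sum_univ_succ, h3]
      simp only [h4, Y, Fin.cons_zero, Fin.cons_succ]
      rw [mul_add, Finset.mul_sum, add_assoc, ← Finset.sum_add_distrib]
      congr 1
      · ring
      · exact Finset.sum_congr rfl fun j _ => by ring
    rw [← h2, ← h1]
    simp only [hc, dotProduct, mulVec_diagonal]
    exact Finset.sum_congr rfl fun i _ => by ring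

end Diagonalization

end GuEisenstat

/-! ## The eigenvalues of a deflated arrowhead matrix -/

namespace GuEisenstat

variable {m : ℕ}

/-- The secular function of an arrowhead matrix. -/
noncomputable def secularFn (α : ℝ) (z d : Fin m → ℝ) (x : ℝ) : ℝ :=
  x - α - ∑ j, z j ^ 2 / (x - d j)

/-- The point `x` is between the poles `i - 1` and `i`, at distance at least `γ` from all poles. -/
structure Between (d : Fin m → ℝ) (γ : ℝ) (i : Fin (m + 1)) (x : ℝ) : Prop where
  abs_le_two : |x| ≤ 2
  above : ∀ j : Fin m, j.val < i.val → γ ≤ x - d j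
  below : ∀ j : Fin m, i.val ≤ j.val → γ ≤ d j - x

theorem Between.le_abs {d : Fin m → ℝ} {γ x : ℝ} {i : Fin (m + 1)} (h : Between d γ i x)
    (j : Fin m) : γ ≤ |x - d j| := by
  rcases lt_or_ge j.val i.val with hj | hj
  · exact (h.above j hj).trans (le_abs_self _)
  · rw [abs_sub_comm]
    exact (h.below j hj).trans (le_abs_self _)

theorem Between.ne {d : Fin m → ℝ} {γ x : ℝ} {i : Fin (m + 1)} (h : Between d γ i x) (hγ : 0 < γ)
    (j : Fin m) : x ≠ d j :=
  sub_ne_zero.1 (abs_pos.1 (hγ.trans_le (h.le_abs j)))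

theorem Between.mono {d : Fin m → ℝ} {γ x y t : ℝ} {i : Fin (m + 1)} (hx : Between d γ i x)
    (hy : Between d γ i y) (hxt : x ≤ t) (hty : t ≤ y) : Between d γ i t := by
  refine ⟨?_, fun j hj => ?_, fun j hj => ?_⟩
  · have h1 := abs_le.1 hx.abs_le_two
    have h2 := abs_le.1 hy.abs_le_two
    rw [abs_le]; constructor <;> linarith
  · linarith [hx.above j hj]
  · linarith [hy.below j hj]

/-- The derivative is `1 + ∑ z j ^ 2 / (x - d j) ^ 2`, and `x - d j`, `y - d j` have the same sign
in an interval without poles. A bound on a function value is therefore a bound on the distance to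
the root. -/
theorem secularFn_expansive (α : ℝ) (z : Fin m → ℝ) {d : Fin m → ℝ} {γ x y : ℝ}
    {i : Fin (m + 1)} (hγ : 0 < γ) (hx : Between d γ i x) (hy : Between d γ i y) (hxy : x ≤ y) :
    y - x ≤ secularFn α z d y - secularFn α z d x := by
  have h : ∑ j, z j ^ 2 / (y - d j) ≤ ∑ j, z j ^ 2 / (x - d j) := by
    refine Finset.sum_le_sum fun j _ => ?_
    have hx0 := sub_ne_zero.2 (hx.ne hγ j)
    have hy0 := sub_ne_zero.2 (hy.ne hγ j)
    have h1 : z j ^ 2 / (x - d j) - z j ^ 2 / (y - d j) =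
        z j ^ 2 * (y - x) / ((x - d j) * (y - d j)) := by
      field_simp; ring
    have h2 : 0 < (x - d j) * (y - d j) := by
      rcases lt_or_ge j.val i.val with hj | hj
      · exact mul_pos (hγ.trans_le (hx.above j hj)) (hγ.trans_le (hy.above j hj))
      · exact mul_pos_of_neg_of_neg (by linarith [hx.below j hj]) (by linarith [hy.below j hj])
    have h3 : 0 ≤ z j ^ 2 * (y - x) / ((x - d j) * (y - d j)) := by
      have := sub_nonneg.2 hxy
      positivity
    linarith
  simp only [secularFn]
  linarith

/-- The arrowhead matrix with head `α`, shaft `z` and poles `d` is deflated and has norm at most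
`3 / 2`. -/
structure IsDeflated (N : ℕ) (η α : ℝ) (z d : Fin m → ℝ) : Prop where
  size : m + 1 ≤ N
  eta_pos : 0 < η
  eta_le : 128 * N * η ≤ 1
  sep : ∀ i j, i < j → η ^ 3 < d j - d i
  le_shaft : ∀ j, η ^ 3 ≤ |z j|
  form_le : ∀ (y₀ : ℝ) (y : Fin m → ℝ),
    |α * y₀ ^ 2 + ∑ j, (d j * y j ^ 2 + 2 * z j * y₀ * y j)| ≤ 3 / 2 * (y₀ ^ 2 + ∑ j, y j ^ 2)

/-- The lower end of the interval for eigenvalue `i`. -/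
noncomputable def lowerEnd (γ : ℝ) (d : Fin m → ℝ) (i : Fin (m + 1)) : ℝ :=
  if h : 0 < i.val then d ⟨i.val - 1, by omega⟩ + γ else -2

/-- The upper end of the interval for eigenvalue `i`. -/
noncomputable def upperEnd (γ : ℝ) (d : Fin m → ℝ) (i : Fin (m + 1)) : ℝ :=
  if h : i.val < m then d ⟨i.val, h⟩ - γ else 2

namespace IsDeflated

variable {N : ℕ} {η α : ℝ} {z d : Fin m → ℝ} (H : IsDeflated N η α z d)
include H

theorem one_le_size : (1 : ℝ) ≤ N := by
  have := H.size
  exact_mod_cast (by omega : 1 ≤ N)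

theorem eta_small : η ≤ 1 / 128 := by
  have h1 := H.one_le_size
  have h2 := H.eta_le
  have h3 := H.eta_pos
  nlinarith

theorem abs_head_le : |α| ≤ 3 / 2 := by
  simpa using H.form_le 1 0

theorem abs_pole_le (j : Fin m) : |d j| ≤ 3 / 2 := by
  have h := H.form_le 0 (Pi.single j 1)
  simpa [Pi.single_apply, ite_pow] using h

/-- The form at `(1, ± e_j)` is `α + d j ± 2 * z j`, bounded by `3`; the difference of the two
eliminates the head and the pole. -/
theorem abs_shaft_le (j : Fin m) : |z j| ≤ 3 / 2 := by
  have h1 := abs_le.1 (H.form_le 1 (Pi.single j 1))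
  have h2 := abs_le.1 (H.form_le 1 (Pi.single j (-1)))
  simp [Pi.single_apply, ite_pow, Finset.sum_add_distrib] at h1 h2
  rw [abs_le]
  constructor <;> linarith

theorem strictMono : StrictMono d := fun i j hij => by
  have := H.sep i j hij
  have := pow_pos H.eta_pos 3
  linarith

/-- With the test vector `v = (1, z j / (x - d j))` the form equals `x * ‖v‖ ^ 2` minus the secular
function at `x`. At `x = 2` the bound `3 / 2` on the form forces a positive secular function, and at
`x = -2`, in the next lemma, a negative one. -/
theorem secularFn_two_pos : 0 < secularFn α z d 2 := by
  have hd : ∀ j, 0 < 2 - d j := fun j => by linarith [(abs_le.1 (H.abs_pole_le j)).2]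
  have h := (abs_le.1 (H.form_le 1 fun j => z j / (2 - d j))).2
  have h1 : ∀ j, d j * (z j / (2 - d j)) ^ 2 + 2 * z j * 1 * (z j / (2 - d j)) =
      z j ^ 2 / (2 - d j) + 2 * (z j / (2 - d j)) ^ 2 := fun j => by
    have := (hd j).ne'
    field_simp; ring
  simp only [h1, Finset.sum_add_distrib, ← Finset.mul_sum] at h
  have h2 : 0 ≤ ∑ j, (z j / (2 - d j)) ^ 2 := Finset.sum_nonneg fun j _ => sq_nonneg _
  simp only [secularFn]
  linarith

theorem secularFn_neg_two_neg : secularFn α z d (-2) < 0 := by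
  have hd : ∀ j, -2 - d j < 0 := fun j => by linarith [(abs_le.1 (H.abs_pole_le j)).1]
  have h := (abs_le.1 (H.form_le 1 fun j => z j / (-2 - d j))).1
  have h1 : ∀ j, d j * (z j / (-2 - d j)) ^ 2 + 2 * z j * 1 * (z j / (-2 - d j)) =
      z j ^ 2 / (-2 - d j) - 2 * (z j / (-2 - d j)) ^ 2 := fun j => by
    have := (hd j).ne
    field_simp; ring
  simp only [h1, Finset.sum_sub_distrib, ← Finset.mul_sum] at h
  have h2 : 0 ≤ ∑ j, (z j / (-2 - d j)) ^ 2 := Finset.sum_nonneg fun j _ => sq_nonneg _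
  simp only [secularFn]
  linarith

theorem gap_le : η ^ 10 ≤ η ^ 3 / 4 := by
  have h1 := H.eta_pos
  have h2 := H.eta_small
  have h3 : η ^ 7 ≤ (1 / 128) ^ 7 := by gcongr
  have h4 : 0 < η ^ 3 := by positivity
  nlinarith [h4, h3]

/-- Near a pole the secular function is dominated by this pole. -/
theorem secularFn_near_pole {x : ℝ} (hx : |x| ≤ 2) (k : Fin m) (hk : |x - d k| = η ^ 10) :
    |secularFn α z d x + z k ^ 2 / (x - d k)| < z k ^ 2 / η ^ 10 := by
  have hη := H.eta_pos
  have h1 : ∀ j ∈ Finset.univ.erase k, |z j ^ 2 / (x - d j)| ≤ 9 / 2 / η ^ 3 := by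
    intro j hj
    have h2 : η ^ 3 / 2 ≤ |x - d j| := by
      have h3 : η ^ 3 ≤ |d k - d j| := by
        rcases lt_or_gt_of_ne (Finset.ne_of_mem_erase hj) with h | h
        · exact (H.sep _ _ h).le.trans (le_abs_self _)
        · rw [abs_sub_comm]
          exact (H.sep _ _ h).le.trans (le_abs_self _)
      have h4 : |d k - d j| ≤ |x - d k| + |x - d j| := by
        rw [abs_sub_comm x (d k)]
        have := abs_add_le (d k - x) (x - d j)
        rwa [sub_add_sub_cancel] at this
      have := H.gap_le
      have : 0 < η ^ 3 := by positivity
      linarith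
    rw [abs_div, abs_of_nonneg (sq_nonneg (z j)), ← sq_abs]
    have h5 := H.abs_shaft_le j
    calc |z j| ^ 2 / |x - d j| ≤ (3 / 2) ^ 2 / (η ^ 3 / 2) := by gcongr
      _ = 9 / 2 / η ^ 3 := by field_simp; norm_num
  have h2 : |∑ j ∈ Finset.univ.erase k, z j ^ 2 / (x - d j)| ≤ N * (9 / 2 / η ^ 3) := by
    refine (Finset.abs_sum_le_sum_abs _ _).trans ((Finset.sum_le_sum h1).trans ?_)
    rw [Finset.sum_const, nsmul_eq_mul]
    have h3 : (Finset.univ.erase k).card ≤ N := by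
      have := H.size
      have h4 := Finset.card_erase_le (s := Finset.univ) (a := k)
      simp only [Finset.card_univ, Fintype.card_fin] at h4
      omega
    gcongr
  have h3 : secularFn α z d x + z k ^ 2 / (x - d k) =
      x - α - ∑ j ∈ Finset.univ.erase k, z j ^ 2 / (x - d j) := by
    rw [secularFn, ← Finset.add_sum_erase _ _ (Finset.mem_univ k)]
    ring
  -- The pole at distance `η ^ 10` contributes at least `η ^ 6 / η ^ 10`. The fewer than `N` others
  -- are at distance at least `η ^ 3 / 2` and contribute only of order `N / η ^ 3`, which `128 * N *
  -- η ≤ 1` makes smaller.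
  have h4 : 1 / η ^ 4 ≤ z k ^ 2 / η ^ 10 := by
    rw [div_le_div_iff₀ (by positivity) (by positivity)]
    have h5 : (η ^ 3) ^ 2 ≤ z k ^ 2 := by
      rw [← sq_abs (z k)]
      have := H.le_shaft k
      gcongr
    have h6 := mul_le_mul_of_nonneg_right h5 (by positivity : 0 ≤ η ^ 4)
    linarith [h6, (by ring : (η ^ 3) ^ 2 * η ^ 4 = 1 * η ^ 10)]
  refine lt_of_lt_of_le ?_ h4
  rw [h3]
  have h5 : |x - α - ∑ j ∈ Finset.univ.erase k, z j ^ 2 / (x - d j)| ≤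
      2 + 3 / 2 + N * (9 / 2 / η ^ 3) := by
    refine (abs_sub _ _).trans (add_le_add ((abs_sub _ _).trans (add_le_add hx H.abs_head_le)) h2)
  refine h5.trans_lt ?_
  rw [lt_div_iff₀ (by positivity)]
  have h6 : (2 + 3 / 2 + N * (9 / 2 / η ^ 3)) * η ^ 4 = 7 / 2 * η ^ 4 + 9 / 2 * (N * η) := by
    field_simp; ring
  rw [h6]
  have h7 : η ^ 4 ≤ (1 / 128) ^ 4 := by
    have := H.eta_small
    gcongr
  have := H.eta_le
  norm_num at h7
  linarith

theorem between_of_mem {i : Fin (m + 1)} {x : ℝ} (h1 : lowerEnd (η ^ 10) d i ≤ x)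
    (h2 : x ≤ upperEnd (η ^ 10) d i) : Between d (η ^ 10) i x := by
  have hη := H.eta_pos
  have hη' := H.eta_small
  have hγ : η ^ 10 ≤ 1 / 4 := by
    have h3 := H.gap_le
    have h4 : η ^ 3 ≤ (1 / 128) ^ 3 := by gcongr
    norm_num at h4
    linarith
  have hγ0 : 0 < η ^ 10 := by positivity
  refine ⟨?_, fun j hj => ?_, fun j hj => ?_⟩
  · rw [abs_le]
    constructor
    · refine le_trans ?_ h1
      unfold lowerEnd
      split_ifs with h
      · linarith [(abs_le.1 (H.abs_pole_le ⟨i.val - 1, by omega⟩)).1]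
      · exact le_rfl
    · refine h2.trans ?_
      unfold upperEnd
      split_ifs with h
      · linarith [(abs_le.1 (H.abs_pole_le ⟨i.val, h⟩)).2]
      · exact le_rfl
  · rw [lowerEnd, dif_pos (by omega)] at h1
    have h3 : d j ≤ d ⟨i.val - 1, by omega⟩ := H.strictMono.monotone (by
      rw [Fin.le_def]; simp only; omega)
    linarith
  · have := j.2
    rw [upperEnd, dif_pos (by omega)] at h2
    have h3 : d ⟨i.val, by omega⟩ ≤ d j := H.strictMono.monotone (by
      rw [Fin.le_def]; exact hj)
    linarith

theorem lowerEnd_lt_upperEnd (i : Fin (m + 1)) :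
    lowerEnd (η ^ 10) d i < upperEnd (η ^ 10) d i := by
  have hη := H.eta_pos
  have hη' := H.eta_small
  have h3 := H.gap_le
  have h4 : η ^ 3 ≤ (1 / 128) ^ 3 := by gcongr
  have h5 : 0 < η ^ 3 := by positivity
  norm_num at h4
  unfold lowerEnd upperEnd
  split_ifs with h1 h2 h2
  · have := H.sep ⟨i.val - 1, by omega⟩ ⟨i.val, h2⟩ (by rw [Fin.lt_def]; simp only; omega)
    linarith
  · linarith [(abs_le.1 (H.abs_pole_le ⟨i.val - 1, by omega⟩)).2]
  · linarith [(abs_le.1 (H.abs_pole_le ⟨i.val, h2⟩)).1]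
  · norm_num

theorem between_lowerEnd (i : Fin (m + 1)) : Between d (η ^ 10) i (lowerEnd (η ^ 10) d i) :=
  H.between_of_mem le_rfl (H.lowerEnd_lt_upperEnd i).le

theorem between_upperEnd (i : Fin (m + 1)) : Between d (η ^ 10) i (upperEnd (η ^ 10) d i) :=
  H.between_of_mem (H.lowerEnd_lt_upperEnd i).le le_rfl

theorem secularFn_lowerEnd_neg (i : Fin (m + 1)) :
    secularFn α z d (lowerEnd (η ^ 10) d i) < 0 := by
  have hb := H.between_lowerEnd i
  have hγ : 0 < η ^ 10 := pow_pos H.eta_pos _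
  by_cases h : 0 < i.val
  · have hk : lowerEnd (η ^ 10) d i - d ⟨i.val - 1, by omega⟩ = η ^ 10 := by
      rw [lowerEnd, dif_pos h]; ring
    have h1 := H.secularFn_near_pole hb.abs_le_two ⟨i.val - 1, by omega⟩ (by
      rw [hk, abs_of_pos hγ])
    rw [hk] at h1
    linarith [(abs_lt.1 h1).2]
  · rw [lowerEnd, dif_neg h]
    exact H.secularFn_neg_two_neg

theorem secularFn_upperEnd_pos (i : Fin (m + 1)) :
    0 < secularFn α z d (upperEnd (η ^ 10) d i) := by
  have hb := H.between_upperEnd i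
  have hγ : 0 < η ^ 10 := pow_pos H.eta_pos _
  by_cases h : i.val < m
  · have hk : upperEnd (η ^ 10) d i - d ⟨i.val, h⟩ = -η ^ 10 := by
      rw [upperEnd, dif_pos h]; ring
    have h1 := H.secularFn_near_pole hb.abs_le_two ⟨i.val, h⟩ (by
      rw [hk, abs_neg, abs_of_pos hγ])
    rw [hk, div_neg] at h1
    linarith [(abs_lt.1 h1).1]
  · rw [upperEnd, dif_neg h]
    exact H.secularFn_two_pos

theorem exists_root (i : Fin (m + 1)) : ∃ x, lowerEnd (η ^ 10) d i ≤ x ∧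
    x ≤ upperEnd (η ^ 10) d i ∧ secularFn α z d x = 0 := by
  have hγ : 0 < η ^ 10 := pow_pos H.eta_pos _
  have hc : ContinuousOn (secularFn α z d)
      (Set.Icc (lowerEnd (η ^ 10) d i) (upperEnd (η ^ 10) d i)) := by
    unfold secularFn
    refine (continuousOn_id.sub continuousOn_const).sub (continuousOn_finsetSum _ fun j _ => ?_)
    refine continuousOn_const.div (continuousOn_id.sub continuousOn_const) fun x hx => ?_
    exact sub_ne_zero.2 ((H.between_of_mem hx.1 hx.2).ne hγ j)
  obtain ⟨x, hx, h⟩ := intermediate_value_Icc (H.lowerEnd_lt_upperEnd i).le hc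
    ⟨(H.secularFn_lowerEnd_neg i).le, (H.secularFn_upperEnd_pos i).le⟩
  exact ⟨x, hx.1, hx.2, h⟩

theorem injective_of_between {e : Fin (m + 1) → ℝ} (he : ∀ i, Between d (η ^ 10) i (e i)) :
    Function.Injective e := by
  have hγ : 0 < η ^ 10 := pow_pos H.eta_pos _
  refine StrictMono.injective fun i j hij => ?_
  have hij' : i.val < j.val := hij
  have hk : i.val < m := by omega
  linarith [(he i).below ⟨i.val, hk⟩ le_rfl, (he j).above ⟨i.val, hk⟩ hij']

/-- The shaft reconstructed from approximate eigenvalues is close to the original one. -/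
theorem loewner_close {r e : Fin (m + 1) → ℝ} (hr : ∀ i, Between d (η ^ 10) i (r i))
    (hr0 : ∀ i, secularFn α z d (r i) = 0) (he : ∀ i, Between d (η ^ 10) i (e i))
    (her : ∀ i, |e i - r i| ≤ η ^ 16) :
    (∀ i, 0 < loewnerWeight d e i ∧ |√(loewnerWeight d e i) - (|z i|)| ≤ 2 * η ^ 5) ∧
      |∑ j, e j - ∑ j, d j - α| ≤ η ^ 15 := by
  have hη := H.eta_pos
  have hη' := H.eta_small
  have hγ : 0 < η ^ 10 := pow_pos H.eta_pos _
  have hrd : ∀ i j, r i ≠ d j := fun i j => (hr i).ne hγ j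
  obtain ⟨hw, hα⟩ := eq_loewner_of_roots (w := fun j => z j ^ 2) H.strictMono.injective
    (H.injective_of_between hr) hrd fun i => by
      have := hr0 i
      simp only [secularFn] at this
      linarith
  have hmN : ((m + 1 : ℕ) : ℝ) ≤ N := by exact_mod_cast H.size
  have hNη := H.eta_le
  constructor
  · intro i
    have hpos : 0 < loewnerWeight d e i := loewnerWeight_pos H.strictMono
      (fun i j h => by linarith [(he i).above j h]) (fun i j h => by linarith [(he i).below j h]) i
    refine ⟨hpos, ?_⟩
    set ρ := ∏ j, (1 + (r j - e j) / (d i - r j)) with hρ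
    have hratio : loewnerWeight d e i = z i ^ 2 * ρ := by
      rw [loewnerWeight_ratio H.strictMono.injective hrd, ← hw]
    -- Accuracy `η ^ 16` against distance `η ^ 10` from the poles; the number of factors then costs
    -- less than one further power of `η`.
    have hθ : ∀ j, ‖(r j - e j) / (d i - r j)‖ ≤ η ^ 6 := by
      intro j
      rw [Real.norm_eq_abs, abs_div, abs_sub_comm, abs_sub_comm (d i)]
      have h1 := her j
      have h2 := (hr j).le_abs i
      calc |e j - r j| / |r j - d i| ≤ η ^ 16 / η ^ 10 := by gcongr
        _ = η ^ 6 := by field_simp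
    have hs : ∑ j, ‖(r j - e j) / (d i - r j)‖ ≤ η ^ 5 / 128 := by
      refine (Finset.sum_le_sum fun j _ => hθ j).trans ?_
      rw [Finset.sum_const, Finset.card_univ, Fintype.card_fin, nsmul_eq_mul]
      have h5 : 0 < η ^ 5 := by positivity
      have h6 : ((m + 1 : ℕ) : ℝ) * η ≤ 1 / 128 := by
        have := mul_le_mul_of_nonneg_right hmN hη.le
        linarith
      calc ((m + 1 : ℕ) : ℝ) * η ^ 6 = (((m + 1 : ℕ) : ℝ) * η) * η ^ 5 := by ring
        _ ≤ 1 / 128 * η ^ 5 := by gcongr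
        _ = _ := by ring
    have hρ1 : |ρ - 1| ≤ η ^ 5 := by
      have h1 := Finset.univ.norm_prod_one_add_sub_one_le
        fun j => (r j - e j) / (d i - r j)
      rw [← hρ, Real.norm_eq_abs] at h1
      have h2 : η ^ 5 ≤ 1 := pow_le_one₀ hη.le (by linarith)
      have h5 : 0 < η ^ 5 := by positivity
      have h3 := Real.exp_le_exp.2 hs
      have h4 := Real.abs_exp_sub_one_le (x := η ^ 5 / 128) (by rw [abs_of_pos] <;> linarith)
      rw [abs_of_pos (by positivity : 0 < η ^ 5 / 128)] at h4
      have := (abs_le.1 h4).2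
      linarith
    have hz : 0 < |z i| := (pow_pos hη 3).trans_le (H.le_shaft i)
    have hzb := H.abs_shaft_le i
    have hsq : √(loewnerWeight d e i) ^ 2 = |z i| ^ 2 * ρ := by
      rw [Real.sq_sqrt hpos.le, hratio, sq_abs]
    have hsn := Real.sqrt_nonneg (loewnerWeight d e i)
    set t := √(loewnerWeight d e i)
    set b := |z i|
    -- Difference of squares. Cancelling one factor `b` afterwards turns the relative error of the
    -- square into a relative error of `t`, so that a small shaft entry does no harm.
    have h1 : |t - b| * (t + b) = b ^ 2 * |ρ - 1| := by
      rw [← abs_of_pos (by positivity : 0 < t + b), ← abs_mul,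
        ← abs_of_nonneg (by positivity : 0 ≤ b ^ 2), ← abs_mul]
      congr 1
      linear_combination hsq
    have h2 : |t - b| * b ≤ (2 * η ^ 5) * b := by
      calc |t - b| * b ≤ |t - b| * (t + b) := by
            gcongr; linarith
        _ = b * b * |ρ - 1| := by rw [h1]; ring
        _ ≤ b * 2 * η ^ 5 := by gcongr; linarith
        _ = _ := by ring
    exact le_of_mul_le_mul_right h2 hz
  · rw [hα, sub_sub_sub_cancel_right, ← Finset.sum_sub_distrib]
    refine (Finset.abs_sum_le_sum_abs _ _).trans ((Finset.sum_le_sum fun j _ => her j).trans ?_)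
    rw [Finset.sum_const, Finset.card_univ, Fintype.card_fin, nsmul_eq_mul]
    have h6 : ((m + 1 : ℕ) : ℝ) * η ≤ 1 := by
      have := mul_le_mul_of_nonneg_right hmN hη.le
      linarith
    calc ((m + 1 : ℕ) : ℝ) * η ^ 16 = (((m + 1 : ℕ) : ℝ) * η) * η ^ 15 := by ring
      _ ≤ 1 * η ^ 15 := by gcongr
      _ = _ := one_mul _

end IsDeflated

end GuEisenstat

/-! ## Bisection and eigenvectors -/

namespace RAM

variable {ξ : ℝ} {F : ApproxFMM ξ} {α : Type}

theorem FuelExec.of_succ {p : ℕ → RAM ℝ α} {v : α} {C : ℕ}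
    (h : FuelExec F (fun n => p (n + 1)) v C) : FuelExec F p v C := by
  obtain ⟨c, hc, f₀, h⟩ := h
  refine ⟨c, hc, f₀ + 1, fun n hn => ?_⟩
  have := h (n - 1) (by omega)
  simp only at this
  rwa [Nat.sub_add_cancel (by omega)] at this

end RAM

namespace GuEisenstat

open RAM

variable {ξ : ℝ} {F : ApproxFMM ξ} {m : ℕ}

/-- On at most `N` sources the FMM with accuracy `η ^ 17` spends at most `X` operations per
source. -/
def FMMBudget (F : ApproxFMM ξ) (η : ℝ) (N X : ℕ) : Prop :=
  ∀ (k : FMMKernel) (m : ℕ) (x c y : Fin (m + 1) → ℝ), m + 1 ≤ N →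
    FMMAdmissible (η ^ 17) 8 1 1 (m + 1) (m + 1) x c y →
      F.ops k (η ^ 17) 8 1 1 (m + 1) (m + 1) x c y ≤ (m + 1) * X

/-- Checks admissibility. With `a = p = 1` the required separation is at most `η ^ 17`, far below
the distance `η ^ 10` of the evaluation points from the poles. The extra source at `3` is at
distance at least `1` from points in `[-2, 2]`, and its weight `0` leaves the sum unchanged. -/
theorem exec_callFMM {η : ℝ} {N X : ℕ} (hF : FMMBudget F η N X) (hm : m + 1 ≤ N) (hη : 0 < η)
    (hη' : η ≤ 1 / 128) (k : FMMKernel) {x : Fin (m + 1) → ℝ} {w d : Fin m → ℝ}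
    (hx : ∀ i, |x i| ≤ 2) (hw : ∀ j, |w j| < 8) (hd : ∀ j, |d j| ≤ 3 / 2)
    (hxd : ∀ i j, η ^ 10 ≤ |x i - d j|) :
    ∃ v, (∀ i, |v i - ∑ j, w j * k.fn (x i - d j)| ≤ η ^ 17) ∧
      Exec F (callFMM (powTolerances η) k x w d) v (4 + (m + 1) * X) := by
  have h17 : η ^ 17 ≤ η ^ 10 := pow_le_pow_of_le_one hη.le (by linarith) (by norm_num)
  have h17' : η ^ 17 ≤ (1 / 128) ^ 17 := by gcongr
  have h170 : 0 < η ^ 17 := by positivity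
  norm_num at h17'
  have hadm : FMMAdmissible (η ^ 17) 8 1 1 (m + 1) (m + 1) x (Fin.cons 0 w : Fin (m + 1) → ℝ)
      (Fin.cons 3 d : Fin (m + 1) → ℝ) := by
    have hle : (1 : ℝ) * (η ^ 17 / ((m + 1 : ℕ) : ℝ)) ^ 1 ≤ η ^ 17 := by
      rw [pow_one, one_mul]
      exact div_le_self h170.le (by push_cast; linarith [(Nat.cast_nonneg m : (0 : ℝ) ≤ m)])
    refine ⟨Nat.succ_pos _, h170, by linarith, one_pos, le_rfl,
      fun i => (hx i).trans_lt (by norm_num), fun j => ?_, fun j => ?_, fun i j => ?_⟩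
    · refine Fin.cases ?_ (fun j => ?_) j
      · norm_num [Fin.cons_zero]
      · rw [Fin.cons_succ]; exact hw j
    · refine Fin.cases ?_ (fun j => ?_) j
      · norm_num [Fin.cons_zero]
      · rw [Fin.cons_succ]; exact (hd j).trans_lt (by norm_num)
    · refine hle.trans ?_
      refine Fin.cases ?_ (fun j => ?_) j
      · rw [Fin.cons_zero, abs_sub_comm]
        refine le_trans ?_ (le_abs_self _)
        linarith [(abs_le.1 (hx i)).2]
      · rw [Fin.cons_succ]; exact h17.trans (hxd i j)
  refine ⟨F.eval k (η ^ 17) 8 1 1 (m + 1) (m + 1) x (Fin.cons 0 w : Fin (m + 1) → ℝ)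
    (Fin.cons 3 d : Fin (m + 1) → ℝ), fun i => ?_, ?_⟩
  · have h := F.accurate k _ _ _ _ _ _ _ _ _ hadm i
    rw [Fin.sum_univ_succ] at h
    simpa only [Fin.cons_zero, Fin.cons_succ, zero_mul, zero_add] using h
  · have h3 := exec_lit (F := F) 3
    have h8 := exec_lit (F := F) 8
    rw [Nat.cast_ofNat] at h3 h8
    unfold callFMM
    refine Exec.mono (Exec.bind exec_lit_zero (Exec.bind exec_lit_one (Exec.bind h3
      (Exec.bind (C' := (m + 1) * X) h8 ?_)))) (by omega)
    exact ⟨_, (hF k m x _ _ hm hadm), by simp [run, powTolerances]⟩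

theorem exec_secular {η α : ℝ} {N X : ℕ} {z d : Fin m → ℝ} (hF : FMMBudget F η N X)
    (H : IsDeflated N η α z d) {x : Fin (m + 1) → ℝ} (hx : ∀ i, Between d (η ^ 10) i (x i)) :
    ∃ v, (∀ i, |v i - secularFn α z d (x i)| ≤ η ^ 17) ∧
      Exec F (secular (powTolerances η) α z d x) v ((m + 1) * (X + 7)) := by
  obtain ⟨v, hv, he⟩ := exec_callFMM hF H.size H.eta_pos H.eta_small .inv (x := x)
    (w := fun j => z j * z j) (d := d) (fun i => (hx i).abs_le_two)
    (fun j => by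
      rw [abs_mul]
      have h1 := H.abs_shaft_le j
      have h2 := abs_nonneg (z j)
      nlinarith) H.abs_pole_le (fun i j => (hx i).le_abs j)
  refine ⟨fun i => x i - α - v i, fun i => ?_, ?_⟩
  · have h1 : ∑ j, z j * z j * FMMKernel.inv.fn (x i - d j) = ∑ j, z j ^ 2 / (x i - d j) :=
      Finset.sum_congr rfl fun j _ => by rw [FMMKernel.fn]; ring
    have h2 := hv i
    rw [h1, abs_sub_comm] at h2
    rw [secularFn, sub_sub_sub_cancel_left]
    exact h2
  · unfold secular
    refine Exec.mono (Exec.bind (exec_tabulate fun j => exec_times _ _) (Exec.bind he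
      (exec_tabulate fun i => Exec.bind (exec_minus _ _) (exec_minus _ _)))) ?_
    nlinarith

theorem exec_initialInterval (η : ℝ) (d : Fin m → ℝ) (i : Fin (m + 1)) :
    Exec F (initialInterval (powTolerances η) d i)
      (lowerEnd (η ^ 10) d i, upperEnd (η ^ 10) d i) 4 := by
  have h2 := exec_lit (F := F) 2
  rw [Nat.cast_ofNat] at h2
  unfold initialInterval
  refine Exec.bind (C' := 3) h2 ?_
  have hhi : ∀ lo : ℝ, Exec F (if h : i.val < m then
      minus (d ⟨i.val, h⟩) (powTolerances η).gap >>= fun hi => pure (lo, hi)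
      else pure 2 >>= fun hi => pure (lo, hi)) (lo, upperEnd (η ^ 10) d i) 1 := by
    intro lo
    unfold upperEnd
    split_ifs
    · exact Exec.bind (C' := 0) (exec_minus _ _) (Exec.pure _)
    · exact Exec.bind (C' := 1) (Exec.pure _) ((Exec.pure _).mono (by norm_num))
  by_cases h : 0 < i.val
  · simp only [lowerEnd, dif_pos h]
    exact Exec.mono (Exec.bind (exec_plus _ _) (hhi _)) (by norm_num)
  · simp only [lowerEnd, dif_neg h]
    exact Exec.mono (Exec.bind (exec_negate _) (hhi _)) (by norm_num)

/-- The invariant allows two states of an interval: it contains the root, or it has collapsed to a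
point within `η ^ 16` of the root. The exponent `t` bounds the number of halvings still needed. An
approximate value beyond `± η ^ 17` has the sign of the exact one, so the correct half is kept; a
smaller value means that the midpoint is already close enough. -/
theorem fuelExec_bisect {η α : ℝ} {N X : ℕ} {z d : Fin m → ℝ} (hF : FMMBudget F η N X)
    (H : IsDeflated N η α z d) {r : Fin (m + 1) → ℝ} (hr : ∀ i, Between d (η ^ 10) i (r i))
    (hr0 : ∀ i, secularFn α z d (r i) = 0) (t : ℕ) (I : Fin (m + 1) → ℝ × ℝ)
    (hI : ∀ i, Between d (η ^ 10) i (I i).1 ∧ Between d (η ^ 10) i (I i).2 ∧ (I i).1 ≤ (I i).2 ∧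
      (I i).2 - (I i).1 ≤ η ^ 16 * 2 ^ t ∧
      ((I i).1 ≤ r i ∧ r i ≤ (I i).2 ∨ (I i).1 = (I i).2 ∧ |(I i).1 - r i| ≤ η ^ 16)) :
    ∃ e, (∀ i, Between d (η ^ 10) i (e i) ∧ |e i - r i| ≤ η ^ 16) ∧
      FuelExec F (fun fuel => bisect (powTolerances η) α z d fuel I) e
        ((t + 1) * ((m + 1) * (X + 17))) := by
  have hη := H.eta_pos
  have hη' := H.eta_small
  have hγ : 0 < η ^ 10 := pow_pos hη _
  have h2 := exec_lit (F := F) 2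
  rw [Nat.cast_ofNat] at h2
  induction t generalizing I with
  | zero => ?_
  | succ t ih => ?_
  all_goals
    set mid : Fin (m + 1) → ℝ := fun i => ((I i).1 + (I i).2) / 2 with hmid
    have hmb : ∀ i, Between d (η ^ 10) i (mid i) := fun i => by
      obtain ⟨h3, h4, h5, -⟩ := hI i
      exact h3.mono h4 (by simp only [hmid]; linarith) (by simp only [hmid]; linarith)
    have hwide := exec_tabulate (F := F) (C := 2) (f := fun i => do
        let w ← minus (I i).2 (I i).1
        lessThan (powTolerances η).epsEig w) (v := fun i => decide (η ^ 16 < (I i).2 - (I i).1))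
      fun i => Exec.bind (C' := 1) (exec_minus _ _) (exec_lessThan _ _)
    have hmidx := exec_tabulate (F := F) (C := 2) (f := fun i => do
        let t ← plus (I i).1 (I i).2
        divide t 2) (v := mid)
      fun i => Exec.bind (C' := 1) (exec_plus _ _) (exec_divide _ (by norm_num))
    have hdone : (¬∃ i, η ^ 16 < (I i).2 - (I i).1) → ∀ i, |mid i - r i| ≤ η ^ 16 := by
      intro h i
      push Not at h
      obtain ⟨-, -, h3, -, h4⟩ := hI i
      have h5 := h i
      simp only [hmid]
      rcases h4 with h4 | ⟨h4, h6⟩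
      · rw [abs_le]; constructor <;> linarith
      · rw [← h4, add_self_div_two]; exact h6
  · have hnw : ¬∃ i, η ^ 16 < (I i).2 - (I i).1 := by
      rintro ⟨i, hi⟩
      have := (hI i).2.2.2.1
      rw [pow_zero, mul_one] at this
      linarith
    refine ⟨mid, fun i => ⟨hmb i, hdone hnw i⟩, FuelExec.of_succ ?_⟩
    simp only [bisect]
    refine FuelExec.mono (Exec.bindFuel h2 (Exec.bindFuel hwide (Exec.bindFuel (C' := 0) hmidx ?_)))
      ?_
    · simp only [decide_eq_true_eq]
      simp only [if_neg hnw]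
      exact (Exec.pure _).fuelExec
    · nlinarith
  · by_cases hw : ∃ i, η ^ 16 < (I i).2 - (I i).1
    · obtain ⟨v, hv, hvx⟩ := exec_secular hF H hmb
      set I' : Fin (m + 1) → ℝ × ℝ := fun i =>
        if η ^ 17 < v i then ((I i).1, mid i)
        else if v i < -η ^ 17 then (mid i, (I i).2) else (mid i, mid i) with hI'
      have hI'x := exec_tabulate (F := F) (C := 2) (f := fun i => do
          let isPos ← lessThan (powTolerances η).epsFMM (v i)
          if isPos then pure ((I i).1, mid i)
          else do
            let isNeg ← lessThan (v i) (-η ^ 17)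
            if isNeg then pure (mid i, (I i).2) else pure (mid i, mid i)) (v := I') fun i => by
        refine Exec.bind (C' := 1) (exec_lessThan _ _) ?_
        simp only [decide_eq_true_eq]
        by_cases h3 : (powTolerances η).epsFMM < v i
        · have h4 : η ^ 17 < v i := h3
          simp only [hI', if_pos h3, if_pos h4]
          exact (Exec.pure _).mono (by norm_num)
        · have h4 : ¬η ^ 17 < v i := h3
          simp only [hI', if_neg h3, if_neg h4]
          refine Exec.bind (C' := 0) (exec_lessThan _ _) ?_
          simp only [decide_eq_true_eq]
          split_ifs
          · exact Exec.pure _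
          · exact Exec.pure _
      obtain ⟨e, he, hex⟩ := ih I' fun i => by
        obtain ⟨h3, h4, h5, h6, h7⟩ := hI i
        have hlm : (I i).1 ≤ mid i := by simp only [hmid]; linarith
        have hmh : mid i ≤ (I i).2 := by simp only [hmid]; linarith
        have hw1 : mid i - (I i).1 ≤ η ^ 16 * 2 ^ t := by
          rw [pow_succ (2 : ℝ)] at h6; simp only [hmid]; linarith
        have hw2 : (I i).2 - mid i ≤ η ^ 16 * 2 ^ t := by
          rw [pow_succ (2 : ℝ)] at h6; simp only [hmid]; linarith
        have hvi := abs_le.1 (hv i)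
        simp only [hI']
        split_ifs with h8 h9
        · refine ⟨h3, hmb i, hlm, hw1, ?_⟩
          rcases h7 with h7 | ⟨h7, h10⟩
          · refine .inl ⟨h7.1, le_of_not_gt fun h => ?_⟩
            -- A root to the right of the midpoint would force a nonpositive secular value there,
            -- but the FMM value certifies a positive one.
            have := secularFn_expansive α z hγ (hmb i) (hr i) h.le
            rw [hr0 i] at this
            linarith
          -- Other intervals may still be wide when this one has collapsed; then its midpoint equals
          -- both ends and any further update leaves it in place.
          · exact .inr ⟨le_antisymm hlm (by rw [h7]; exact hmh), h10⟩
        · refine ⟨hmb i, h4, hmh, hw2, ?_⟩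
          rcases h7 with h7 | ⟨h7, h10⟩
          · refine .inl ⟨le_of_not_gt fun h => ?_, h7.2⟩
            have := secularFn_expansive α z hγ (hr i) (hmb i) h.le
            rw [hr0 i] at this
            linarith
          · have h11 : mid i = (I i).1 := le_antisymm (by rw [h7]; exact hmh) hlm
            exact .inr ⟨by simp only [h11, ← h7], by simp only [h11]; exact h10⟩
        · refine ⟨hmb i, hmb i, le_rfl, by rw [sub_self]; positivity, .inr ⟨rfl, ?_⟩⟩
          -- An uncertain sign means that the exact value is at most `2 * η ^ 17`: the threshold
          -- plus the FMM error.
          have h17 : 2 * η ^ 17 ≤ η ^ 16 := by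
            have : 0 < η ^ 16 := by positivity
            rw [pow_succ]
            nlinarith
          rw [abs_le]
          rcases le_total (mid i) (r i) with h | h
          · have := secularFn_expansive α z hγ (hmb i) (hr i) h
            rw [hr0 i] at this
            constructor <;> linarith
          · have := secularFn_expansive α z hγ (hr i) (hmb i) h
            rw [hr0 i] at this
            constructor <;> linarith
      refine ⟨e, he, FuelExec.of_succ ?_⟩
      simp only [bisect]
      refine FuelExec.mono (Exec.bindFuel h2 (Exec.bindFuel hwide (Exec.bindFuel
        (C' := (m + 1) * (X + 7) + (2 + ((m + 1) * 2 + (t + 1) * ((m + 1) * (X + 17)))))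
          hmidx ?_))) ?_
      · simp only [decide_eq_true_eq, if_pos hw]
        exact Exec.bindFuel hvx (Exec.bindFuel (exec_negate _) (Exec.bindFuel hI'x hex))
      · nlinarith
    · refine ⟨mid, fun i => ⟨hmb i, hdone hw i⟩, FuelExec.of_succ ?_⟩
      simp only [bisect]
      refine FuelExec.mono (Exec.bindFuel h2 (Exec.bindFuel hwide
        (Exec.bindFuel (C' := 0) hmidx ?_))) ?_
      · simp only [decide_eq_true_eq, if_neg hw]
        exact (Exec.pure _).fuelExec
      · have : 1 * ((m + 1) * 17) ≤ (t + 1 + 1) * ((m + 1) * (X + 17)) := by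
          gcongr <;> omega
        omega

/-! ### Reconstruction of the shaft -/

theorem foldl_mul_skip (i : Fin m) (g : Fin m → ℝ) (b : ℝ) :
    (List.finRange m).foldl (fun acc j => if j = i then acc else acc * g j) b =
      b * ∏ j ∈ Finset.univ.erase i, g j := by
  have h : ∀ (l : List (Fin m)) (b : ℝ),
      l.foldl (fun acc j => if j = i then acc else acc * g j) b =
        b * (l.map fun j => if j = i then 1 else g j).prod := by
    intro l
    induction l with
    | nil => simp
    | cons a l ih =>
      intro b
      rw [List.foldl_cons, ih, List.map_cons, List.prod_cons]
      split_ifs <;> ring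
  rw [h, ← Fin.prod_univ_def, ← Finset.mul_prod_erase _ _ (Finset.mem_univ i), if_pos rfl, one_mul]
  congr 1
  exact Finset.prod_congr rfl fun j hj => if_neg (Finset.ne_of_mem_erase hj)

/-- The shaft with the signs of `z` and the poles `d` that gives the eigenvalues `e`. -/
noncomputable def loewnerShaft (z d : Fin m → ℝ) (e : Fin (m + 1) → ℝ) (i : Fin m) : ℝ :=
  if z i < 0 then -√(loewnerWeight d e i) else √(loewnerWeight d e i)

/-- Positivity of the weight, which follows from interlacing, keeps the square root legal. The
product is formed directly, without the FMM: linear cost for each of the `m` entries is within the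
quadratic budget. -/
theorem exec_shaftFromEigenvalues (z : Fin m → ℝ) {d : Fin m → ℝ} (hd : Function.Injective d)
    {e : Fin (m + 1) → ℝ} (i : Fin m) (hw : 0 < loewnerWeight d e i) :
    Exec F (shaftFromEigenvalues z d e i) (loewnerShaft z d e i) (8 + 4 * m) := by
  have hfold := exec_foldList (F := F) (C := 4) (l := List.finRange m)
    (f := fun acc j => if j = i then pure acc
      else do
        let num ← minus (e j.succ) (d i)
        let den ← minus (d j) (d i)
        let q ← divide num den
        times acc q)
    (g := fun acc j => if j = i then acc else acc * ((e j.succ - d i) / (d j - d i)))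
    (fun b j _ => by
      split_ifs with h
      · exact (Exec.pure _).mono (by norm_num)
      · exact Exec.bind (C' := 3) (exec_minus _ _) (Exec.bind (C' := 2) (exec_minus _ _)
          (Exec.bind (C' := 1) (exec_divide _ (sub_ne_zero.2 (hd.ne h))) (exec_times _ _))))
    ((d i - e 0) * (e i.succ - d i))
  rw [foldl_mul_skip i (fun j => (e j.succ - d i) / (d j - d i)), List.length_finRange] at hfold
  change Exec F _ (loewnerWeight d e i) _ at hfold
  unfold shaftFromEigenvalues
  refine Exec.mono (Exec.bind exec_lit_zero (Exec.bind (exec_minus _ _) (Exec.bind (exec_minus _ _)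
    (Exec.bind (exec_times _ _) (Exec.bind hfold (Exec.bind (exec_root hw.le)
      (Exec.bind (C' := 2) (exec_lessThan _ _) ?_))))))) (by omega)
  simp only [decide_eq_true_eq, loewnerShaft]
  split_ifs
  · exact exec_negate _
  · exact (Exec.pure _).mono (by norm_num)

theorem loewnerShaft_sq {z d : Fin m → ℝ} {e : Fin (m + 1) → ℝ} {i : Fin m}
    (hw : 0 < loewnerWeight d e i) : loewnerShaft z d e i ^ 2 = loewnerWeight d e i := by
  unfold loewnerShaft
  split_ifs
  · rw [neg_sq, Real.sq_sqrt hw.le]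
  · rw [Real.sq_sqrt hw.le]

theorem abs_loewnerShaft_sub (z d : Fin m → ℝ) (e : Fin (m + 1) → ℝ) (i : Fin m) :
    |loewnerShaft z d e i - z i| = |√(loewnerWeight d e i) - (|z i|)| := by
  unfold loewnerShaft
  split_ifs with h
  · rw [abs_of_neg h, ← abs_neg]
    congr 1; ring
  · rw [abs_of_nonneg (not_lt.1 h)]

end GuEisenstat

/-! ## Diagonalization of an arrowhead matrix -/

namespace GuEisenstat

open RAM Matrix

variable {ξ : ℝ} {F : ApproxFMM ξ} {n : ℕ}

theorem shaftGram_ofFn {m : ℕ} (g : Fin m → ShaftEntry ℝ n) (x : Fin n → ℝ) :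
    shaftGram (List.ofFn g) x = ∑ j, ((g j).row ⬝ᵥ x) ^ 2 := by
  rw [shaftGram, List.map_ofFn, List.sum_ofFn]; rfl

theorem shaftForm_ofFn {m : ℕ} (h : Fin n → ℝ) (g : Fin m → ShaftEntry ℝ n) (x : Fin n → ℝ) :
    shaftForm h (List.ofFn g) x =
      ∑ j, ((g j).d * ((g j).row ⬝ᵥ x) ^ 2 + 2 * (g j).z * (h ⬝ᵥ x) * ((g j).row ⬝ᵥ x)) := by
  rw [shaftForm, List.map_ofFn, List.sum_ofFn]; rfl

theorem pairGram_ofFn {m : ℕ} (g : Fin m → EigenPair ℝ n) (x : Fin n → ℝ) :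
    pairGram (List.ofFn g) x = ∑ j, ((g j).vec ⬝ᵥ x) ^ 2 := by
  rw [pairGram, List.map_ofFn, List.sum_ofFn]; rfl

theorem pairForm_ofFn {m : ℕ} (g : Fin m → EigenPair ℝ n) (x : Fin n → ℝ) :
    pairForm (List.ofFn g) x = ∑ j, (g j).val * ((g j).vec ⬝ᵥ x) ^ 2 := by
  rw [pairForm, List.map_ofFn, List.sum_ofFn]; rfl

/-- Perturbation of a quotient whose denominator is a norm. -/
theorem abs_div_sqrt_sub_le {p p' s s' δ : ℝ} (hδ : δ ≤ 1 / 2) (hs : 1 ≤ s)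
    (hp : |p' - p| ≤ δ) (hs' : |s' - s| ≤ δ) (hq : |p / √s| ≤ 2) :
    |p' / √s' - p / √s| ≤ 6 * δ := by
  have h1 := abs_le.1 hs'
  have hs'0 : 1 / 4 ≤ s' := by linarith
  have hr' : 1 / 2 ≤ √s' := by
    apply Real.le_sqrt_of_sq_le; linarith
  have hr : 1 ≤ √s := Real.one_le_sqrt.2 hs
  have hsub : |√s - √s'| ≤ δ := by
    have h2 : |√s - √s'| * (√s + √s') = |s' - s| := by
      rw [← abs_of_pos (by positivity : 0 < √s + √s'), ← abs_mul, abs_sub_comm s' s]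
      congr 1
      have h3 := Real.mul_self_sqrt (by linarith : 0 ≤ s)
      have h4 := Real.mul_self_sqrt (by linarith : 0 ≤ s')
      linear_combination h3 - h4
    have h3 := abs_nonneg (√s - √s')
    nlinarith
  have h5 : p' / √s' - p / √s = (p' - p) / √s' + p / √s * ((√s - √s') / √s') := by
    have : √s' ≠ 0 := by positivity
    have : √s ≠ 0 := by positivity
    field_simp; ring
  rw [h5]
  have hδ0 : 0 ≤ δ := (abs_nonneg _).trans hp
  have h6 : |(p' - p) / √s'| ≤ 2 * δ := by
    rw [abs_div, abs_of_pos (by positivity : 0 < √s'), div_le_iff₀ (by positivity)]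
    nlinarith
  have h7 : |(√s - √s') / √s'| ≤ 2 * δ := by
    rw [abs_div, abs_of_pos (by positivity : 0 < √s'), div_le_iff₀ (by positivity)]
    nlinarith
  calc |(p' - p) / √s' + p / √s * ((√s - √s') / √s')|
      ≤ |(p' - p) / √s'| + |p / √s| * |(√s - √s') / √s'| := by
        rw [← abs_mul]; exact abs_add_le _ _
    _ ≤ 2 * δ + 2 * (2 * δ) := by gcongr
    _ = 6 * δ := by ring

/-- The arrowhead matrix with head `a` and shaft `z` has the computed values as exact eigenvalues,
and `u` is compared with its exact eigenvectors. The bound `hcol` on the columns serves twice: it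
keeps the FMM weights below `8`, and by Parseval it bounds each exact coordinate by `2`, as needed
for the perturbation of the normalization. -/
theorem fuelExec_solveDeflated {η α : ℝ} {N X t : ℕ} (hF : FMMBudget F η N X)
    (h : Fin n → ℝ) (L : List (ShaftEntry ℝ n)) (hL : L.length + 1 ≤ n)
    (H : IsDeflated N η α (fun j => (L.get j).z) fun j => (L.get j).d)
    (hcol : ∀ s, h s ^ 2 + ∑ j, (L.get j).row s ^ 2 ≤ 4) (ht : 4 ≤ η ^ 16 * 2 ^ t) :
    ∃ (e : Fin (L.length + 1) → ℝ) (z : Fin L.length → ℝ) (u : Fin (L.length + 1) → Fin n → ℝ)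
      (a : ℝ), (∀ i, Between (fun j => (L.get j).d) (η ^ 10) i (e i)) ∧
      (∀ j, |z j - (L.get j).z| ≤ 2 * η ^ 5) ∧ |a - α| ≤ η ^ 15 ∧
      (∀ i, e i - a = ∑ j, z j ^ 2 / (e i - (L.get j).d)) ∧
      (∀ i s, |u i s - arrowCoord z (fun j => (L.get j).d) (e i) (h s)
        fun j => (L.get j).row s| ≤ 6 * η ^ 17) ∧
      FuelExec F (fun fuel => solveDeflated fuel (powTolerances η) α h L)
        (List.ofFn fun i => ⟨e i, u i⟩) (n * n * ((t + 4) * (X + 17))) := by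
  have hη := H.eta_pos
  have hη' := H.eta_small
  have hγ : 0 < η ^ 10 := pow_pos hη _
  set m := L.length with hm
  set z : Fin m → ℝ := fun j => (L.get j).z with hz
  set d : Fin m → ℝ := fun j => (L.get j).d with hd
  have hinj := H.strictMono.injective
  choose r hr1 hr2 hr0 using H.exists_root
  have hrb : ∀ i, Between d (η ^ 10) i (r i) := fun i => H.between_of_mem (hr1 i) (hr2 i)
  obtain ⟨e, he, hex⟩ := fuelExec_bisect hF H hrb hr0 t
    (fun i => (lowerEnd (η ^ 10) d i, upperEnd (η ^ 10) d i)) fun i => by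
      have h1 := H.between_lowerEnd i
      have h2 := H.between_upperEnd i
      refine ⟨h1, h2, (H.lowerEnd_lt_upperEnd i).le, ?_, .inl ⟨hr1 i, hr2 i⟩⟩
      have h3 := (abs_le.1 h1.abs_le_two).1
      have h4 := (abs_le.1 h2.abs_le_two).2
      simp only
      linarith
  have heb := fun i => (he i).1
  obtain ⟨hw, ha⟩ := H.loewner_close hrb hr0 heb fun i => (he i).2
  set zh : Fin m → ℝ := loewnerShaft z d e with hzh
  have hzhsq : ∀ j, zh j ^ 2 = loewnerWeight d e j := fun j => loewnerShaft_sq (hw j).1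
  have hzhz : ∀ j, |zh j - z j| ≤ 2 * η ^ 5 := fun j => by
    rw [hzh, abs_loewnerShaft_sub]; exact (hw j).2
  have hed : ∀ i j, e i ≠ d j := fun i j => (heb i).ne hγ j
  have hroot := secular_loewner hinj hed
  simp only [← hzhsq] at hroot
  have h5 : η ^ 5 ≤ (1 / 128) ^ 5 := by gcongr
  norm_num at h5
  have hzh2 : ∀ j, |zh j| ≤ 2 := fun j => by
    have h1 := H.abs_shaft_le j
    have h2 := hzhz j
    have h3 := abs_sub_abs_le_abs_sub (zh j) (z j)
    linarith
  have h17 : η ^ 17 ≤ (1 / 128) ^ 17 := by gcongr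
  have h17' : η ^ 17 ≤ 1 / 2 := h17.trans (by norm_num)
  have hrow : ∀ j s, |(L.get j).row s| ≤ 2 := fun j s => by
    have h1 := hcol s
    have h2 := Finset.single_le_sum (f := fun j => (L.get j).row s ^ 2)
      (fun j _ => sq_nonneg _) (Finset.mem_univ j)
    refine abs_le_of_sq_le_sq ?_ (by norm_num)
    nlinarith [sq_nonneg (h s)]
  obtain ⟨ψ, hψ, hψx⟩ := exec_callFMM hF H.size hη hη' .invSq (x := e)
    (w := fun j => zh j * zh j) (d := d) (fun i => (heb i).abs_le_two)
    (fun j => by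
      rw [abs_mul]
      nlinarith [hzh2 j, abs_nonneg (zh j)]) H.abs_pole_le (fun i j => (heb i).le_abs j)
  have hφ := fun s => exec_callFMM hF H.size hη hη' .inv (x := e)
    (w := fun j => zh j * (L.get j).row s) (d := d) (fun i => (heb i).abs_le_two)
    (fun j => by
      rw [abs_mul]
      nlinarith [hzh2 j, abs_nonneg (zh j), hrow j s, abs_nonneg ((L.get j).row s)])
    H.abs_pole_le (fun i j => (heb i).le_abs j)
  choose φ hφ hφx using hφ
  set S : Fin (m + 1) → ℝ := fun i => 1 + ∑ j, zh j ^ 2 / (e i - d j) ^ 2 with hS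
  have hS1 : ∀ i, 1 ≤ S i := fun i => by
    have : 0 ≤ ∑ j, zh j ^ 2 / (e i - d j) ^ 2 := Finset.sum_nonneg fun j _ => by positivity
    simp only [hS]; linarith
  have hSψ : ∀ i, |(1 + ψ i) - S i| ≤ η ^ 17 := fun i => by
    have h1 : ∑ j, zh j * zh j * FMMKernel.invSq.fn (e i - d j) =
        ∑ j, zh j ^ 2 / (e i - d j) ^ 2 :=
      Finset.sum_congr rfl fun j _ => by rw [FMMKernel.fn]; ring
    have h2 := hψ i
    rw [h1] at h2
    simp only [hS]
    rwa [add_sub_add_left_eq_sub]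
  have hψ0 : ∀ i, 0 < 1 + ψ i := fun i => by
    have := (abs_le.1 (hSψ i)).1
    linarith [hS1 i]
  -- The head left as `_` is `∑ e - ∑ d`. The program never computes it; it exists only in the
  -- analysis.
  refine ⟨e, zh, fun i s => (-h s - φ s i) / √(1 + ψ i), _, heb, hzhz, ha, hroot,
    fun i s => ?_, ?_⟩
  · set p := -h s + ∑ j, zh j / (d j - e i) * (L.get j).row s with hp
    have hcoord : arrowCoord zh d (e i) (h s) (fun j => (L.get j).row s) = p / √(S i) := rfl
    rw [hcoord]
    refine abs_div_sqrt_sub_le h17' (hS1 i) ?_ (hSψ i) ?_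
    · have h1 : ∑ j, zh j * (L.get j).row s * FMMKernel.inv.fn (e i - d j) =
          -∑ j, zh j / (d j - e i) * (L.get j).row s := by
        rw [← Finset.sum_neg_distrib]
        refine Finset.sum_congr rfl fun j _ => ?_
        have h3 := sub_ne_zero.2 (hed i j)
        have h4 := sub_ne_zero.2 (hed i j).symm
        rw [FMMKernel.fn]; field_simp; ring
      have h2 := hφ s i
      rw [h1, sub_neg_eq_add] at h2
      rw [hp, ← abs_neg]
      convert h2 using 2
      ring
    · rw [← hcoord]
      refine abs_le_of_sq_le_sq ?_ (by norm_num)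
      have h1 := (arrow_diagonalization (H.injective_of_between heb) hed hroot (h s)
        fun j => (L.get j).row s).1
      have h2 := Finset.single_le_sum
        (f := fun i => arrowCoord zh d (e i) (h s) (fun j => (L.get j).row s) ^ 2)
        (fun j _ => sq_nonneg _) (Finset.mem_univ i)
      rw [h1] at h2
      linarith [hcol s]
  · unfold solveDeflated
    simp only
    refine FuelExec.mono (Exec.bindFuel (exec_tabulate fun i => exec_initialInterval _ _ i)
      (FuelExec.bind hex (Exec.fuelExec (Exec.bind
        (exec_tabulate fun i => exec_shaftFromEigenvalues z hinj i (hw i).1)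
        (Exec.bind (exec_tabulate fun j => exec_times _ _) (Exec.bind hψx (Exec.bind exec_lit_one
          (Exec.bind (C := (m + 1) * 2) (v := fun i => √(1 + ψ i)) (exec_tabulate fun i =>
              Exec.bind (C' := 1) (exec_plus _ _) (exec_root (hψ0 i).le))
            (Exec.bind (C := n * (m + (4 + (m + 1) * X) + (m + 1) * 4)) (C' := 0)
              (v := fun s i => (-h s - φ s i) / √(1 + ψ i)) (exec_tabulate fun s => ?_)
              (Exec.pure _)))))))))) ?_
    · refine Exec.mono (Exec.bind (exec_tabulate fun j => exec_times _ _) (Exec.bind (hφx s)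
        (exec_tabulate (C := 4) fun i => Exec.bind (C' := 2) (exec_negate _)
          (Exec.bind (C' := 1) (exec_minus _ _)
            (exec_divide _ (Real.sqrt_pos.2 (hψ0 i)).ne'))))) ?_
      simp only [hm]
      omega
    -- Each of the `n` columns needs one FMM call with `m + 1` sources. Together with at most `t +
    -- 1` calls in the bisection, one for the norms and the quadratic shaft reconstruction, this
    -- stays within `n * n * ((t + 4) * (X + 17))`.
    · have h1 : (m + 1) * (m + 1) ≤ n * n := Nat.mul_le_mul hL hL
      have h2 : m + 1 ≤ n * n := by nlinarith
      have h3 : n * (m + 1) ≤ n * n := Nat.mul_le_mul_left _ hL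
      have h4 : (t + 1) * ((m + 1) * (X + 17)) ≤ n * n * ((t + 1) * (X + 17)) := by
        calc (t + 1) * ((m + 1) * (X + 17)) = (m + 1) * ((t + 1) * (X + 17)) := by ring
          _ ≤ _ := by gcongr
      have h5 : (m + 1) * X ≤ n * n * X := by gcongr
      have h6 : n * ((m + 1) * X) ≤ n * n * X := by
        calc n * ((m + 1) * X) = n * (m + 1) * X := by ring
          _ ≤ _ := by gcongr
      nlinarith

/-- The eigenvectors computed from the rows `A *ᵥ r` are close to the images under `A` of the exact
eigenvectors, which are computed from the rows `r`. -/
theorem fuelExec_solveDeflated_transform {η α : ℝ} {N X t : ℕ} (hF : FMMBudget F η N X)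
    {h : Fin n → ℝ} {A : Matrix (Fin n) (Fin n) ℝ} (hAh : A *ᵥ h = h)
    (L : List (ShaftEntry ℝ n)) (hL : L.length + 1 ≤ n)
    (H : ∀ (m : ℕ) (g : Fin m → ShaftEntry ℝ n), L = List.ofFn g →
      IsDeflated N η α (fun j => (g j).z) fun j => (g j).d)
    (hgram : ∀ x, (h ⬝ᵥ x) ^ 2 + shaftGram L x ≤ x ⬝ᵥ x)
    (hA : ∀ s, A s ⬝ᵥ A s ≤ 4) (ht : 4 ≤ η ^ 16 * 2 ^ t) :
    ∃ E E' : List (EigenPair ℝ n), E'.length = L.length + 1 ∧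
      (∀ x, pairGram E' x = (h ⬝ᵥ x) ^ 2 + shaftGram L x) ∧
      (∀ x, |pairForm E' x - (α * (h ⬝ᵥ x) ^ 2 + shaftForm h L x)| ≤ η ^ 4 * (x ⬝ᵥ x)) ∧
      List.Forall₂ (fun e e' => e.val = e'.val ∧
        ∀ s, |e.vec s - (A *ᵥ e'.vec) s| ≤ 6 * η ^ 17) E E' ∧
      FuelExec F (fun fuel => solveDeflated fuel (powTolerances η) α h (L.map (·.transform A)))
        E (n * n * ((t + 4) * (X + 17))) := by
  obtain ⟨LA, hLA⟩ : ∃ LA, LA = L.map (·.transform A) := ⟨_, rfl⟩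
  rw [← hLA]
  have hlen : LA.length = L.length := hLA ▸ List.length_map _
  -- The untransformed entries are indexed by the length of the transformed list, the index type in
  -- the program; this avoids casts in all sums.
  obtain ⟨g, hg⟩ : ∃ g : Fin LA.length → ShaftEntry ℝ n, g = fun j => L.get (j.cast hlen) :=
    ⟨_, rfl⟩
  have hLg : L = List.ofFn g := by
    refine List.ext_getElem (by simp [hlen]) fun i h1 h2 => ?_
    simp [hg]
  have hget : ∀ j, LA.get j = (g j).transform A := fun j => by
    simp [hg, hLA]
  have hgz : ∀ j, (LA.get j).z = (g j).z := fun j => by rw [hget]; rfl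
  have hgd : ∀ j, (LA.get j).d = (g j).d := fun j => by rw [hget]; rfl
  have hgr : ∀ j, (LA.get j).row = A *ᵥ (g j).row := fun j => by rw [hget]; rfl
  have H' := H _ g hLg
  have hη := H'.eta_pos
  have hη' := H'.eta_small
  have hγ : 0 < η ^ 10 := pow_pos hη _
  have hrow : ∀ r s, (A *ᵥ r) s = r ⬝ᵥ A s := fun r s => dotProduct_comm _ _
  obtain ⟨e, zh, u, a, heb, hzh, ha, hroot, hu, hex⟩ :=
    fuelExec_solveDeflated (t := t) hF h LA (by rw [hlen]; exact hL)
      (by simp only [hgz, hgd]; exact H') (fun s => by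
        simp only [hgr]
        have h1 := hgram (A s)
        rw [hLg, shaftGram_ofFn] at h1
        have h2 : h s = h ⬝ᵥ A s := by rw [← hrow, hAh]
        simp only [hrow]
        rw [h2]
        exact h1.trans (hA s)) ht
  simp only [hgz, hgd, hgr] at heb hzh hroot hu
  have hdiag := fun x : Fin n → ℝ => arrow_diagonalization (H'.injective_of_between heb)
    (fun i j => (heb i).ne hγ j) hroot (h ⬝ᵥ x) fun j => (g j).row ⬝ᵥ x
  set d := fun j => (g j).d with hd
  obtain ⟨v, hv⟩ : ∃ v : Fin (LA.length + 1) → Fin n → ℝ,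
      v = fun i s => arrowCoord zh d (e i) (h s) fun j => (g j).row s := ⟨_, rfl⟩
  have hvdot : ∀ i x, v i ⬝ᵥ x =
      arrowCoord zh d (e i) (h ⬝ᵥ x) fun j => (g j).row ⬝ᵥ x := by
    intro i x
    have h1 : v i = (arrowNorm zh d (e i))⁻¹ •
        (-h + ∑ j, (zh j / (d j - e i)) • (g j).row) := by
      ext s
      simp [hv, arrowCoord, div_eq_inv_mul]
    rw [h1, smul_dotProduct, add_dotProduct, neg_dotProduct, sum_dotProduct, arrowCoord,
      div_eq_inv_mul, smul_eq_mul]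
    simp only [smul_dotProduct, smul_eq_mul]
  refine ⟨_, List.ofFn fun i => ⟨e i, v i⟩, by simp [hlen], fun x => ?_, fun x => ?_, ?_, hex⟩
  · rw [pairGram_ofFn]
    simp only [hvdot]
    rw [(hdiag x).1, hLg, shaftGram_ofFn]
  · rw [pairForm_ofFn]
    simp only [hvdot]
    rw [(hdiag x).2, hLg, shaftForm_ofFn]
    set p := h ⬝ᵥ x
    -- Poles and rows are unchanged, so the forms of the given and of the reconstructed arrowhead
    -- matrix differ only through head and shaft.
    have h1 : a * p ^ 2 + ∑ j, (d j * ((g j).row ⬝ᵥ x) ^ 2 + 2 * zh j * p * ((g j).row ⬝ᵥ x)) -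
        (α * p ^ 2 + ∑ j, ((g j).d * ((g j).row ⬝ᵥ x) ^ 2 +
          2 * (g j).z * p * ((g j).row ⬝ᵥ x))) =
        (a - α) * p ^ 2 + ∑ j, (zh j - (g j).z) * (2 * p * ((g j).row ⬝ᵥ x)) := by
      have h2 : ∑ j, (zh j - (g j).z) * (2 * p * ((g j).row ⬝ᵥ x)) =
          ∑ j, (d j * ((g j).row ⬝ᵥ x) ^ 2 + 2 * zh j * p * ((g j).row ⬝ᵥ x)) -
          ∑ j, ((g j).d * ((g j).row ⬝ᵥ x) ^ 2 + 2 * (g j).z * p * ((g j).row ⬝ᵥ x)) := by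
        rw [← Finset.sum_sub_distrib]
        exact Finset.sum_congr rfl fun j _ => by simp only [hd]; ring
      rw [h2]; ring
    rw [h1]
    have hg1 := hgram x
    rw [hLg, shaftGram_ofFn] at hg1
    have hx0 : 0 ≤ ∑ j, ((g j).row ⬝ᵥ x) ^ 2 := Finset.sum_nonneg fun j _ => sq_nonneg _
    have h3 : ∀ j, |(zh j - (g j).z) * (2 * p * ((g j).row ⬝ᵥ x))| ≤
        2 * η ^ 5 * (x ⬝ᵥ x) := by
      intro j
      have h4 : |2 * p * ((g j).row ⬝ᵥ x)| ≤ x ⬝ᵥ x := by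
        have h5 := Finset.single_le_sum (f := fun j => ((g j).row ⬝ᵥ x) ^ 2)
          (fun j _ => sq_nonneg _) (Finset.mem_univ j)
        have h6 := sq_nonneg (p + (g j).row ⬝ᵥ x)
        have h7 := sq_nonneg (p - (g j).row ⬝ᵥ x)
        rw [abs_le]
        constructor <;> nlinarith
      rw [abs_mul]
      exact mul_le_mul (hzh j) h4 (abs_nonneg _) (by positivity)
    have h4 : |(a - α) * p ^ 2| ≤ η ^ 15 * (x ⬝ᵥ x) := by
      rw [abs_mul, abs_of_nonneg (sq_nonneg p)]
      exact mul_le_mul ha (by linarith) (sq_nonneg _) (by positivity)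
    have h5 : |∑ j, (zh j - (g j).z) * (2 * p * ((g j).row ⬝ᵥ x))| ≤
        (N : ℝ) * (2 * η ^ 5 * (x ⬝ᵥ x)) := by
      refine (Finset.abs_sum_le_sum_abs _ _).trans ((Finset.sum_le_sum fun j _ => h3 j).trans ?_)
      rw [Finset.sum_const, Finset.card_univ, Fintype.card_fin, nsmul_eq_mul]
      have h6 : 0 ≤ x ⬝ᵥ x := le_trans (by positivity) hg1
      have h7 : (LA.length : ℝ) ≤ N := by
        have := H'.size
        exact_mod_cast (by omega : LA.length ≤ N)
      gcongr
    refine (abs_add_le _ _).trans ((add_le_add h4 h5).trans ?_)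
    have h6 : 0 ≤ x ⬝ᵥ x := le_trans (by positivity) hg1
    have h7 : η ^ 15 + N * (2 * η ^ 5) ≤ η ^ 4 := by
      have h8 := mul_le_mul_of_nonneg_right H'.eta_le (by positivity : 0 ≤ η ^ 4)
      have h9 : η ^ 11 ≤ (1 / 128) ^ 11 := by gcongr
      have h10 := mul_le_mul_of_nonneg_right h9 (by positivity : 0 ≤ η ^ 4)
      have h11 : 0 < η ^ 4 := by positivity
      norm_num at h10
      nlinarith
    nlinarith
  · rw [List.forall₂_iff_get]
    refine ⟨by simp, fun i h1 h2 => ?_⟩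
    simp only [List.get_ofFn]
    refine ⟨rfl, fun s => ?_⟩
    -- The eigenvector formula is linear in the rows and `A` fixes the head row, so applying `A` to
    -- the result is the same as applying it to the rows.
    have h3 : ∀ i, (A *ᵥ v i) s = arrowCoord zh d (e i) (h s) fun j => (A *ᵥ (g j).row) s := by
      intro i
      rw [hrow, hvdot, ← hrow, hAh]
      simp only [hrow]
    rw [h3]
    exact hu _ s

/-- Vectors that satisfy Parseval's identity, as many as the dimension, have arbitrary
coordinates. -/
theorem exists_coordinates {ι : Type*} [Fintype ι] (hι : Fintype.card ι = n)
    {v : ι → Fin n → ℝ} (hv : ∀ x, ∑ i, (v i ⬝ᵥ x) ^ 2 = x ⬝ᵥ x) (y : ι → ℝ) :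
    ∃ x, ∀ i, v i ⬝ᵥ x = y i := by
  have hinj : Function.Injective (Matrix.mulVecLin (Matrix.of v)) := by
    rw [← LinearMap.ker_eq_bot, LinearMap.ker_eq_bot']
    intro x hx
    rw [← dotProduct_self_eq_zero, ← hv]
    refine Finset.sum_eq_zero fun i _ => ?_
    have : v i ⬝ᵥ x = 0 := congrFun hx i
    rw [this]; norm_num
  have hsurj := (LinearMap.injective_iff_surjective_of_finrank_eq_finrank (by simp [hι])).1 hinj
  obtain ⟨x, hx⟩ := hsurj y
  exact ⟨x, fun i => congrFun hx i⟩

/-- After deflation of an arrowhead matrix of norm at most `3 / 2`, an arrowhead matrix of norm at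
most `3 / 2` remains. -/
theorem isDeflated_of_form {N : ℕ} {η α : ℝ} (hη : 0 < η) (hηN : 128 * N * η ≤ 1) (hn : n ≤ N)
    {h : Fin n → ℝ} {L : List (ShaftEntry ℝ n)} {D : List (EigenPair ℝ n)}
    (hlen : L.length + D.length + 1 = n)
    (hgram : ∀ x, (h ⬝ᵥ x) ^ 2 + shaftGram L x + pairGram D x = x ⬝ᵥ x)
    (hform : ∀ x, |α * (h ⬝ᵥ x) ^ 2 + shaftForm h L x + pairForm D x| ≤ 3 / 2 * (x ⬝ᵥ x))
    (hsep : L.Pairwise fun e f => η ^ 3 < f.d - e.d) (hz : ∀ e ∈ L, η ^ 3 ≤ |e.z|)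
    (m : ℕ) (g : Fin m → ShaftEntry ℝ n) (hL : L = List.ofFn g) :
    IsDeflated N η α (fun j => (g j).z) fun j => (g j).d := by
  subst hL
  rw [List.length_ofFn] at hlen
  refine ⟨by omega, hη, hηN, fun i j hij => ?_, fun j => hz _ (by simp [List.mem_ofFn]),
    fun y₀ y => ?_⟩
  · exact (List.pairwise_ofFn.1 hsep) hij
  · obtain ⟨k, q, rfl⟩ : ∃ (k : ℕ) (q : Fin k → EigenPair ℝ n), D = List.ofFn q :=
      ⟨_, D.get, (List.ofFn_get D).symm⟩
    rw [List.length_ofFn] at hlen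
    -- Head row, retained rows and deflated vectors form an orthonormal basis. A vector whose
    -- coordinates vanish on the deflated part restricts the bound on the whole form to the
    -- remaining arrowhead matrix.
    let v : Option (Fin m ⊕ Fin k) → Fin n → ℝ := fun i =>
      i.elim h (Sum.elim (fun j => (g j).row) fun j => (q j).vec)
    obtain ⟨x, hx⟩ := exists_coordinates (v := v) (by simp; omega) (fun x => by
      rw [← hgram x, Fintype.sum_option, Fintype.sum_sum_type, shaftGram_ofFn, pairGram_ofFn,
        add_assoc]
      rfl) fun i => i.elim y₀ (Sum.elim y 0)
    have h0 : h ⬝ᵥ x = y₀ := hx none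
    have h1 : ∀ j, (g j).row ⬝ᵥ x = y j := fun j => hx (some (.inl j))
    have h2 : ∀ j, (q j).vec ⬝ᵥ x = 0 := fun j => hx (some (.inr j))
    have h3 := hform x
    rw [← hgram, shaftForm_ofFn, pairForm_ofFn, shaftGram_ofFn, pairGram_ofFn] at h3
    simpa [h0, h1, h2] using h3

/-- Each deflation pass changes the form by at most `N * η ^ 3`, and the reconstruction of the shaft
by `η ^ 4 ≤ N * η ^ 3`. The room between `5 / 4` and `3 / 2` is what deflation may use up. -/
theorem fuelExec_solveArrowhead {η α : ℝ} {N X t : ℕ} (hF : FMMBudget F η N X)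
    (hη : 0 < η) (hηN : 128 * N * η ≤ 1) (hn : n ≤ N)
    {h : Fin n → ℝ} {A : Matrix (Fin n) (Fin n) ℝ} (hAh : A *ᵥ h = h)
    (hA : ∀ s, A s ⬝ᵥ A s ≤ 4) (ht : 4 ≤ η ^ 16 * 2 ^ t)
    (L : List (ShaftEntry ℝ n)) (hlen : L.length + 1 = n)
    (hgram : ∀ x, (h ⬝ᵥ x) ^ 2 + shaftGram L x = x ⬝ᵥ x)
    (hform : ∀ x, |α * (h ⬝ᵥ x) ^ 2 + shaftForm h L x| ≤ 5 / 4 * (x ⬝ᵥ x)) :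
    ∃ E E' : List (EigenPair ℝ n), E'.length = n ∧ (∀ x, pairGram E' x = x ⬝ᵥ x) ∧
      (∀ x, |pairForm E' x - (α * (h ⬝ᵥ x) ^ 2 + shaftForm h L x)| ≤
        3 * N * η ^ 3 * (x ⬝ᵥ x)) ∧
      List.Forall₂ (fun e e' => e.val = e'.val ∧
        ∀ s, |e.vec s - (A *ᵥ e'.vec) s| ≤ 6 * η ^ 17) E E' ∧
      FuelExec F (fun fuel => solveArrowhead fuel (powTolerances η) α h (L.map (·.transform A)))
        E (n * n * ((t + 7) * (X + 17))) := by
  have hN1 : (1 : ℝ) ≤ N := by exact_mod_cast (by omega : 1 ≤ N)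
  have hη' : η ≤ 1 / 128 := by nlinarith
  have hη3 : 0 < η ^ 3 := by positivity
  obtain ⟨L₁, hp₁, hs₁, hx₁⟩ := exec_sortByD (F := F) A L
  obtain ⟨L₂, D₂, hs₂, hz₂, hl₂, hg₂, hf₂, hx₂⟩ := exec_deflateShaft (F := F) A h hη3 L₁
  obtain ⟨L₃, D₃, hs₃, hz₃, -, hl₃, hg₃, hf₃, hx₃⟩ :=
    exec_deflateDiagonal (F := F) A h hη3 L₂ (hs₁.sublist hs₂) hz₂
  have hl₁ := hp₁.length_eq
  have hlen' : L₃.length + (D₃ ++ D₂).length + 1 = n := by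
    rw [List.length_append]; omega
  have hgram' : ∀ x, (h ⬝ᵥ x) ^ 2 + shaftGram L₃ x + pairGram (D₃ ++ D₂) x = x ⬝ᵥ x := fun x => by
    rw [pairGram_append, ← hgram x, ← shaftGram_perm hp₁, ← hg₂, ← hg₃]; ring
  have hxx : ∀ x : Fin n → ℝ, 0 ≤ x ⬝ᵥ x := fun x =>
    Finset.sum_nonneg fun i _ => mul_self_nonneg _
  have hdiff : ∀ x, |α * (h ⬝ᵥ x) ^ 2 + shaftForm h L₃ x + pairForm (D₃ ++ D₂) x -
      (α * (h ⬝ᵥ x) ^ 2 + shaftForm h L x)| ≤ 2 * N * η ^ 3 * (x ⬝ᵥ x) := fun x => by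
    have h1 := hf₂ x
    have h2 := hf₃ x
    rw [shaftForm_perm hp₁, shaftGram_perm hp₁] at h1
    have h3 : shaftGram L₂ x ≤ x ⬝ᵥ x := by
      rw [← hgram x, ← shaftGram_perm hp₁, ← hg₂]
      have := pairGram_nonneg D₂ x
      nlinarith [sq_nonneg (h ⬝ᵥ x)]
    have h4 : (L₁.length : ℝ) * (h ⬝ᵥ x) ^ 2 + shaftGram L x ≤ N * (x ⬝ᵥ x) := by
      have h5 : (L₁.length : ℝ) ≤ N := by exact_mod_cast (by omega : L₁.length ≤ N)
      have h6 := shaftGram_nonneg L x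
      rw [← hgram x]
      nlinarith [sq_nonneg (h ⬝ᵥ x)]
    have h5 : (L₂.length : ℝ) * shaftGram L₂ x ≤ N * (x ⬝ᵥ x) := by
      have h5 : (L₂.length : ℝ) ≤ N := by exact_mod_cast (by omega : L₂.length ≤ N)
      have h6 := shaftGram_nonneg L₂ x
      gcongr
    have h6 := mul_le_mul_of_nonneg_left h4 hη3.le
    have h7 := mul_le_mul_of_nonneg_left h5 hη3.le
    rw [pairForm_append]
    rw [abs_le] at h1 h2 ⊢
    constructor <;> linarith
  have hsmall : 2 * N * η ^ 3 ≤ 1 / 4 := by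
    have h1 : η ^ 2 ≤ 1 := by nlinarith
    calc 2 * N * η ^ 3 = (128 * N * η) * (η ^ 2 / 64) := by ring
      _ ≤ 1 * (1 / 64) := by gcongr
      _ ≤ _ := by norm_num
  have hform' : ∀ x, |α * (h ⬝ᵥ x) ^ 2 + shaftForm h L₃ x + pairForm (D₃ ++ D₂) x| ≤
      3 / 2 * (x ⬝ᵥ x) := fun x => by
    have h1 := hdiff x
    have h2 := hform x
    have h3 := mul_le_mul_of_nonneg_right hsmall (hxx x)
    rw [abs_le] at h1 h2 ⊢
    constructor <;> linarith
  obtain ⟨E, E', hEl, hEg, hEf, hEE, hEx⟩ := fuelExec_solveDeflated_transform hF hAh L₃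
    (by omega) (isDeflated_of_form hη hηN hn hlen' hgram' hform' hs₃ hz₃) (fun x => by
      rw [← hgram' x]
      have := pairGram_nonneg (D₃ ++ D₂) x
      linarith) hA ht
  -- Deflated pairs do not pass through the FMM: they are exact images under `A`.
  have hexact : ∀ D : List (EigenPair ℝ n), List.Forall₂ (fun e e' => e.val = e'.val ∧
      ∀ s, |e.vec s - (A *ᵥ e'.vec) s| ≤ 6 * η ^ 17) (D.map (·.transform A)) D := fun D => by
    rw [List.forall₂_map_left_iff]
    refine List.forall₂_same.2 fun e _ => ⟨rfl, fun s => ?_⟩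
    simp only [EigenPair.transform, sub_self, abs_zero]
    positivity
  refine ⟨E ++ D₃.map (·.transform A) ++ D₂.map (·.transform A), E' ++ D₃ ++ D₂, ?_, fun x => ?_,
    fun x => ?_, ?_, ?_⟩
  · simp only [List.length_append] at hlen' ⊢
    omega
  · have := hgram' x
    rw [pairGram_append] at this
    rw [pairGram_append, pairGram_append, hEg]
    linarith
  · have h1 := hEf x
    have h2 := hdiff x
    have h3 : η ^ 4 ≤ N * η ^ 3 := by
      rw [pow_succ' η 3]
      gcongr
      linarith
    have h4 := mul_le_mul_of_nonneg_right h3 (hxx x)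
    rw [pairForm_append] at h2
    rw [pairForm_append, pairForm_append]
    rw [abs_le] at h1 h2 ⊢
    constructor <;> linarith
  · exact List.rel_append (List.rel_append hEE (hexact D₃)) (hexact D₂)
  · unfold solveArrowhead
    refine FuelExec.mono (Exec.bindFuel hx₁ (Exec.bindFuel hx₂ (Exec.bindFuel hx₃
      (FuelExec.bind hEx (Exec.pure _).fuelExec)))) ?_
    have h1 : L.length * L.length ≤ n * n := Nat.mul_le_mul (by omega) (by omega)
    have h2 : L₁.length ≤ n := by omega
    have h3 : L₂.length * (22 + 6 * n) ≤ n * (22 + 6 * n) := Nat.mul_le_mul_right _ (by omega)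
    have h4 : n ≤ n * n := Nat.le_mul_self n
    nlinarith
end GuEisenstat

/-! ## Spectral norms -/

namespace Matrix

variable {m n : ℕ}

theorem norm_toLp_sq (x : Fin n → ℝ) : ‖WithLp.toLp 2 x‖ ^ 2 = x ⬝ᵥ x := by
  rw [EuclideanSpace.real_norm_sq_eq, dotProduct]
  exact Finset.sum_congr rfl fun i _ => sq (x i)

theorem mulVec_dotProduct_mulVec_le (A : Matrix (Fin m) (Fin n) ℝ) (x : Fin n → ℝ) :
    (A *ᵥ x) ⬝ᵥ (A *ᵥ x) ≤ ‖A‖ ^ 2 * (x ⬝ᵥ x) := by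
  have h : ‖WithLp.toLp 2 (A *ᵥ x)‖ ≤ ‖A‖ * ‖WithLp.toLp 2 x‖ :=
    l2_opNorm_mulVec A (WithLp.toLp 2 x)
  rw [← norm_toLp_sq, ← norm_toLp_sq, ← mul_pow]
  exact pow_le_pow_left₀ (norm_nonneg _) h 2

theorem l2_opNorm_le_of_mulVec_le {A : Matrix (Fin m) (Fin n) ℝ} {c : ℝ} (hc : 0 ≤ c)
    (h : ∀ x, (A *ᵥ x) ⬝ᵥ (A *ᵥ x) ≤ c ^ 2 * (x ⬝ᵥ x)) : ‖A‖ ≤ c := by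
  rw [l2_opNorm_def]
  refine ContinuousLinearMap.opNorm_le_bound _ hc fun x => ?_
  have h1 := h x.ofLp
  rw [← norm_toLp_sq, ← norm_toLp_sq, ← mul_pow] at h1
  exact le_of_sq_le_sq h1 (by positivity)

theorem l2_opNorm_transpose (A : Matrix (Fin m) (Fin n) ℝ) : ‖Aᵀ‖ = ‖A‖ := by
  rw [← l2_opNorm_conjTranspose A, conjTranspose_eq_transpose_of_trivial]

theorem l2_opNorm_le_one_of_isometry {A : Matrix (Fin m) (Fin n) ℝ} (h : Aᵀ * A = 1) :
    ‖A‖ ≤ 1 := by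
  refine l2_opNorm_le_of_mulVec_le zero_le_one fun x => ?_
  rw [dotProduct_mulVec, vecMul_mulVec, h, vecMul_one, one_pow, one_mul]

/-- Cauchy–Schwarz in every row. The bound is crude, but a factor `N` is harmless beside `η ^ 17`.
-/
theorem l2_opNorm_le_of_entries {A : Matrix (Fin m) (Fin n) ℝ} {c : ℝ} (hc : 0 ≤ c) {N : ℕ}
    (hm : m ≤ N) (hn : n ≤ N) (h : ∀ i j, |A i j| ≤ c) : ‖A‖ ≤ N * c := by
  refine l2_opNorm_le_of_mulVec_le (by positivity) fun x => ?_
  have hx : 0 ≤ x ⬝ᵥ x := Finset.sum_nonneg fun i _ => mul_self_nonneg _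
  have h1 : ∀ i, (A *ᵥ x) i * (A *ᵥ x) i ≤ N * c ^ 2 * (x ⬝ᵥ x) := by
    intro i
    have h2 := Finset.sum_mul_sq_le_sq_mul_sq Finset.univ (A i) x
    have h3 : ∑ j, A i j ^ 2 ≤ N * c ^ 2 := by
      refine (Finset.sum_le_sum (g := fun _ => c ^ 2) fun j _ => ?_).trans ?_
      · rw [← sq_abs]
        exact pow_le_pow_left₀ (abs_nonneg _) (h i j) 2
      · rw [Finset.sum_const, Finset.card_univ, Fintype.card_fin, nsmul_eq_mul]
        gcongr
    have h4 : ∑ j, x j ^ 2 = x ⬝ᵥ x := Finset.sum_congr rfl fun j _ => sq (x j)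
    rw [h4] at h2
    rw [← sq]
    exact h2.trans (mul_le_mul_of_nonneg_right h3 hx)
  refine (Finset.sum_le_sum fun i _ => h1 i).trans ?_
  rw [Finset.sum_const, Finset.card_univ, Fintype.card_fin, nsmul_eq_mul, mul_pow, sq (N : ℝ)]
  have : (m : ℝ) ≤ N := by exact_mod_cast hm
  calc (m : ℝ) * (N * c ^ 2 * (x ⬝ᵥ x)) ≤ N * (N * c ^ 2 * (x ⬝ᵥ x)) := by gcongr
    _ = _ := by ring

theorem two_mul_abs_dotProduct_mulVec_le (A : Matrix (Fin m) (Fin n) ℝ) (x : Fin m → ℝ)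
    (y : Fin n → ℝ) : 2 * |x ⬝ᵥ (A *ᵥ y)| ≤ ‖A‖ * (x ⬝ᵥ x + y ⬝ᵥ y) := by
  have h1 : (x ⬝ᵥ (A *ᵥ y)) ^ 2 ≤ (x ⬝ᵥ x) * (‖A‖ ^ 2 * (y ⬝ᵥ y)) := by
    have h2 := Finset.sum_mul_sq_le_sq_mul_sq Finset.univ x (A *ᵥ y)
    have h3 : ∀ {k : ℕ} (z : Fin k → ℝ), ∑ j, z j ^ 2 = z ⬝ᵥ z :=
      fun z => Finset.sum_congr rfl fun j _ => sq (z j)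
    rw [h3, h3] at h2
    have hx : 0 ≤ x ⬝ᵥ x := Finset.sum_nonneg fun i _ => mul_self_nonneg _
    exact h2.trans (mul_le_mul_of_nonneg_left (mulVec_dotProduct_mulVec_le A y) hx)
  have hx : 0 ≤ x ⬝ᵥ x := Finset.sum_nonneg fun i _ => mul_self_nonneg _
  have hy : 0 ≤ y ⬝ᵥ y := Finset.sum_nonneg fun i _ => mul_self_nonneg _
  have hA := norm_nonneg A
  refine abs_le_of_sq_le_sq' ?_ (by positivity) |>.2
  rw [mul_pow, sq_abs]
  nlinarith [mul_nonneg (sq_nonneg ‖A‖) (sq_nonneg (x ⬝ᵥ x - y ⬝ᵥ y))]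

/-- The norm of a symmetric matrix is bounded by its numerical radius. -/
theorem IsSymm.l2_opNorm_le {M : Matrix (Fin n) (Fin n) ℝ} (hM : M.IsSymm) {c : ℝ} (hc : 0 ≤ c)
    (h : ∀ x, |x ⬝ᵥ (M *ᵥ x)| ≤ c * (x ⬝ᵥ x)) : ‖M‖ ≤ c := by
  have hsymm : ∀ x y, x ⬝ᵥ (M *ᵥ y) = y ⬝ᵥ (M *ᵥ x) := fun x y => by
    rw [dotProduct_mulVec, dotProduct_comm, ← mulVec_transpose, hM.eq]
  have hpol : ∀ x y, 2 * (x ⬝ᵥ (M *ᵥ y)) ≤ c * (x ⬝ᵥ x + y ⬝ᵥ y) := fun x y => by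
    have h1 := (abs_le.1 (h (x + y))).2
    have h2 := (abs_le.1 (h (x - y))).1
    simp only [mulVec_add, mulVec_sub, add_dotProduct, dotProduct_add, sub_dotProduct,
      dotProduct_sub, hsymm y x, dotProduct_comm y x] at h1 h2
    linarith
  have h0 : ∀ x : Fin n → ℝ, 0 ≤ x ⬝ᵥ x := fun x =>
    Finset.sum_nonneg fun i _ => mul_self_nonneg _
  refine l2_opNorm_le_of_mulVec_le hc fun x => ?_
  rcases hc.eq_or_lt with rfl | hc
  · have h1 := hpol (M *ᵥ x) x
    have h2 := h0 (M *ᵥ x)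
    linarith
  -- The scaling by `c` balances the two terms of the polarized bound, so that half of the left side
  -- can be absorbed.
  · have h1 := hpol (M *ᵥ x) (c • x)
    simp only [mulVec_smul, dotProduct_smul, smul_dotProduct, smul_eq_mul] at h1
    have h2 := h0 (M *ᵥ x)
    have h3 : c * ((M *ᵥ x) ⬝ᵥ (M *ᵥ x)) ≤ c * (c ^ 2 * (x ⬝ᵥ x)) := by linarith
    exact le_of_mul_le_mul_left h3 hc

end Matrix

/-! ## Embedding of diagonal blocks -/

namespace GuEisenstat

open Matrix

/-- The matrix of the embedding of the coordinates `o`, …, `o + k - 1`. -/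
def blockEmbedding (n k o : ℕ) : Matrix (Fin n) (Fin k) ℝ :=
  Matrix.of fun i j => if i.val = o + j.val then 1 else 0

variable {n k o : ℕ}

theorem blockEmbedding_transpose_mulVec (ho : o + k ≤ n) (x : Fin n → ℝ) (j : Fin k) :
    ((blockEmbedding n k o)ᵀ *ᵥ x) j = x ⟨o + j.val, by omega⟩ := by
  rw [mulVec, dotProduct, Finset.sum_eq_single ⟨o + j.val, by omega⟩]
  · simp [blockEmbedding]
  · intro i _ hi
    have : i.val ≠ o + j.val := fun h => hi (Fin.ext h)
    simp [blockEmbedding, this]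
  · simp

theorem blockEmbedding_mulVec (y : Fin k → ℝ) (i : Fin n) :
    (blockEmbedding n k o *ᵥ y) i =
      if h : o ≤ i.val ∧ i.val < o + k then y ⟨i.val - o, by omega⟩ else 0 := by
  rw [mulVec, dotProduct]
  split_ifs with h
  · rw [Finset.sum_eq_single ⟨i.val - o, by omega⟩]
    · have : i.val = o + (i.val - o) := by omega
      simp [blockEmbedding, ← this]
    · intro j _ hj
      have : i.val ≠ o + j.val := fun h => hj (Fin.ext (by simp only; omega))
      simp [blockEmbedding, this]
    · simp
  · refine Finset.sum_eq_zero fun j _ => ?_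
    have : i.val ≠ o + j.val := fun h' => h (by omega)
    simp [blockEmbedding, this]

theorem blockEmbedding_transpose_mul (ho : o + k ≤ n) :
    (blockEmbedding n k o)ᵀ * blockEmbedding n k o = 1 := by
  ext j j'
  have h := blockEmbedding_transpose_mulVec ho (fun i => blockEmbedding n k o i j') j
  refine (show _ = _ from h).trans ?_
  simp [blockEmbedding, one_apply, Fin.ext_iff]

theorem blockEmbedding_transpose_mul_of_disjoint {k' o' : ℕ} (ho : o + k ≤ n)
    (hoo : o + k ≤ o' ∨ o' + k' ≤ o) :
    (blockEmbedding n k o)ᵀ * blockEmbedding n k' o' = 0 := by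
  ext j j'
  have h := blockEmbedding_transpose_mulVec ho (fun i => blockEmbedding n k' o' i j') j
  refine (show _ = _ from h).trans ?_
  have : o + j.val ≠ o' + j'.val := by omega
  simp [blockEmbedding, this]

theorem blockEmbedding_mul_transpose (i i' : Fin n) :
    (blockEmbedding n k o * (blockEmbedding n k o)ᵀ) i i' =
      if o ≤ i.val ∧ i.val < o + k ∧ i = i' then 1 else 0 := by
  have h := blockEmbedding_mulVec (o := o) (fun j => blockEmbedding n k o i' j) i
  refine (show _ = _ from h).trans ?_
  by_cases hi : o ≤ i.val ∧ i.val < o + k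
  · have h1 : i'.val = o + (i.val - o) ↔ i = i' := by rw [Fin.ext_iff]; omega
    rw [dif_pos hi]
    simp only [blockEmbedding, of_apply, h1, hi.1, hi.2, true_and]
  · rw [dif_neg hi, if_neg fun h => hi ⟨h.1, h.2.1⟩]

theorem sum_blockEmbedding_mul_transpose {l : ℕ} (hn : n = k + 1 + l) :
    blockEmbedding n k 0 * (blockEmbedding n k 0)ᵀ +
      blockEmbedding n 1 k * (blockEmbedding n 1 k)ᵀ +
      blockEmbedding n l (k + 1) * (blockEmbedding n l (k + 1))ᵀ = 1 := by
  ext i i'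
  simp only [Matrix.add_apply, blockEmbedding_mul_transpose, one_apply]
  have := i.2
  by_cases h : i = i'
  · subst h
    rcases lt_trichotomy i.val k with hi | hi | hi
    · have h1 : i.val < k + 1 := by omega
      simp [hi, hi.not_ge, h1.not_ge]
    · simp [hi]
    · have h1 : ¬ i.val < k := by omega
      have h2 : ¬ i.val < k + 1 := by omega
      have h3 : k + 1 ≤ i.val := by omega
      have h4 : i.val < k + 1 + l := by omega
      simp [h1, h2, h3, h4]
  · simp [h]

theorem l2_opNorm_blockEmbedding_conj_le (ho : o + k ≤ n) (B : Matrix (Fin k) (Fin k) ℝ) :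
    ‖blockEmbedding n k o * B * (blockEmbedding n k o)ᵀ‖ ≤ ‖B‖ := by
  have h := l2_opNorm_le_one_of_isometry (blockEmbedding_transpose_mul ho)
  calc ‖blockEmbedding n k o * B * (blockEmbedding n k o)ᵀ‖
      ≤ ‖blockEmbedding n k o‖ * ‖B‖ * ‖(blockEmbedding n k o)ᵀ‖ :=
        (l2_opNorm_mul _ _).trans (mul_le_mul_of_nonneg_right (l2_opNorm_mul _ _) (norm_nonneg _))
    _ ≤ 1 * ‖B‖ * 1 := by
        rw [l2_opNorm_transpose]
        gcongr
    _ = ‖B‖ := by ring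

/-- The continuation of a vector by zeros. -/
def padded (x : Fin n → ℝ) (i : ℕ) : ℝ := if h : i < n then x ⟨i, h⟩ else 0

/-- The quadratic form of the diagonal block of size `n` that starts at index `s`, of the symmetric
tridiagonal matrix with diagonal `a` and off-diagonal `b`. -/
def tridiagForm (a b : ℕ → ℝ) (n s : ℕ) (x : Fin n → ℝ) : ℝ :=
  ∑ i ∈ Finset.range n,
    (a (s + i) * padded x i ^ 2 + 2 * b (s + i) * padded x i * padded x (i + 1))

theorem padded_blockEmbedding_transpose (ho : o + k ≤ n) (x : Fin n → ℝ) {i : ℕ} (hi : i < k) :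
    padded ((blockEmbedding n k o)ᵀ *ᵥ x) i = padded x (o + i) := by
  rw [padded, dif_pos hi, blockEmbedding_transpose_mulVec ho, padded, dif_pos (by omega)]

/-- The part of the large sum that belongs to a block has one term more than the form of the block:
the coupling to its right neighbour, which `padded` sets to zero in the block itself. -/
theorem tridiagForm_block (a b : ℕ → ℝ) (s : ℕ) (ho : o + k ≤ n) (hk : 0 < k) (x : Fin n → ℝ) :
    ∑ i ∈ Finset.range k, (a (s + (o + i)) * padded x (o + i) ^ 2 +
      2 * b (s + (o + i)) * padded x (o + i) * padded x (o + i + 1)) =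
    tridiagForm a b k (s + o) ((blockEmbedding n k o)ᵀ *ᵥ x) +
      2 * b (s + (o + (k - 1))) * padded x (o + (k - 1)) * padded x (o + k) := by
  obtain ⟨k, rfl⟩ : ∃ k', k = k' + 1 := ⟨k - 1, by omega⟩
  rw [tridiagForm, Finset.sum_range_succ, Finset.sum_range_succ, Nat.add_sub_cancel]
  have h1 : ∀ i ∈ Finset.range k, a (s + o + i) *
      padded ((blockEmbedding n (k + 1) o)ᵀ *ᵥ x) i ^ 2 +
      2 * b (s + o + i) * padded ((blockEmbedding n (k + 1) o)ᵀ *ᵥ x) i *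
        padded ((blockEmbedding n (k + 1) o)ᵀ *ᵥ x) (i + 1) =
      a (s + (o + i)) * padded x (o + i) ^ 2 +
      2 * b (s + (o + i)) * padded x (o + i) * padded x (o + i + 1) := by
    intro i hi
    rw [Finset.mem_range] at hi
    rw [padded_blockEmbedding_transpose ho x (by omega),
      padded_blockEmbedding_transpose ho x (by omega), Nat.add_assoc, Nat.add_assoc]
  have h2 : padded ((blockEmbedding n (k + 1) o)ᵀ *ᵥ x) (k + 1) = 0 := by
    rw [padded, dif_neg (lt_irrefl _)]
  rw [Finset.sum_congr rfl h1, h2, padded_blockEmbedding_transpose ho x (Nat.lt_succ_self k),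
    Nat.add_assoc s, Nat.add_assoc o]
  ring

/-- Decomposition of a tridiagonal matrix into two diagonal blocks, a head and two couplings. -/
theorem tridiagForm_split {l : ℕ} (a b : ℕ → ℝ) (s : ℕ) (hk : 0 < k) (hl : 0 < l)
    (hn : n = k + 1 + l) (x : Fin n → ℝ) :
    tridiagForm a b n s x = a (s + k) * padded x k ^ 2 +
      tridiagForm a b k s ((blockEmbedding n k 0)ᵀ *ᵥ x) +
      tridiagForm a b l (s + k + 1) ((blockEmbedding n l (k + 1))ᵀ *ᵥ x) +
      2 * b (s + k - 1) * padded x k * padded x (k - 1) +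
      2 * b (s + k) * padded x k * padded x (k + 1) := by
  have h1 := tridiagForm_block a b s (o := 0) (k := k) (n := n) (by omega) hk x
  have h2 := tridiagForm_block a b s (o := k + 1) (k := l) (n := n) (by omega) hl x
  have h3 : padded x (k + 1 + l) = 0 := by rw [padded, dif_neg (by omega)]
  rw [h3] at h2
  simp only [Nat.zero_add, Nat.add_zero] at h1
  have h4 : tridiagForm a b n s x = ∑ i ∈ Finset.range (k + 1 + l),
      (a (s + i) * padded x i ^ 2 + 2 * b (s + i) * padded x i * padded x (i + 1)) := by
    exact Finset.sum_congr (by rw [hn]) fun _ _ => rfl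
  rw [h4, Finset.sum_range_add, Finset.sum_range_succ, h1, h2, Nat.add_assoc s k 1,
    Nat.add_sub_assoc hk]
  ring

theorem dotProduct_self_split {l : ℕ} (hn : n = k + 1 + l) (x : Fin n → ℝ) :
    x ⬝ᵥ x = padded x k ^ 2 + ((blockEmbedding n k 0)ᵀ *ᵥ x) ⬝ᵥ ((blockEmbedding n k 0)ᵀ *ᵥ x) +
      ((blockEmbedding n l (k + 1))ᵀ *ᵥ x) ⬝ᵥ ((blockEmbedding n l (k + 1))ᵀ *ᵥ x) := by
  have h := congrArg (fun M => x ⬝ᵥ (M *ᵥ x)) (sum_blockEmbedding_mul_transpose hn)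
  have h1 : ∀ k o, x ⬝ᵥ ((blockEmbedding n k o * (blockEmbedding n k o)ᵀ) *ᵥ x) =
      ((blockEmbedding n k o)ᵀ *ᵥ x) ⬝ᵥ ((blockEmbedding n k o)ᵀ *ᵥ x) := fun k o => by
    rw [← mulVec_mulVec, dotProduct_mulVec, mulVec_transpose]
  simp only [add_mulVec, dotProduct_add, h1, one_mulVec] at h
  have h2 : ((blockEmbedding n 1 k)ᵀ *ᵥ x) ⬝ᵥ ((blockEmbedding n 1 k)ᵀ *ᵥ x) = padded x k ^ 2 := by
    rw [dotProduct, Fin.sum_univ_one, blockEmbedding_transpose_mulVec (by omega), padded,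
      dif_pos (by omega), sq]
    rfl
  rw [← h, h2]
  ring

end GuEisenstat

/-! ## Assembly of the eigendecomposition from those of the blocks -/

namespace Matrix

variable {n : ℕ}

theorem dotProduct_self_nonneg_real (x : Fin n → ℝ) : 0 ≤ x ⬝ᵥ x :=
  Finset.sum_nonneg fun i _ => mul_self_nonneg (x i)

/-- A symmetric matrix with vanishing quadratic form is zero, here `Vᵀ * V - 1`. -/
theorem transpose_mul_self_eq_one {V : Matrix (Fin n) (Fin n) ℝ}
    (h : ∀ x, (V *ᵥ x) ⬝ᵥ (V *ᵥ x) = x ⬝ᵥ x) : Vᵀ * V = 1 := by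
  have hs : (Vᵀ * V - 1).IsSymm := by
    rw [IsSymm, transpose_sub, transpose_mul, transpose_transpose, transpose_one]
  have h1 : ‖Vᵀ * V - 1‖ ≤ 0 := hs.l2_opNorm_le le_rfl fun x => by
    rw [sub_mulVec, one_mulVec, dotProduct_sub, ← mulVec_mulVec, dotProduct_mulVec,
      vecMul_transpose, h, sub_self, abs_zero, zero_mul]
  exact sub_eq_zero.1 (norm_le_zero_iff.1 h1)

theorem two_mul_abs_mul_mulVec_le (B : Matrix (Fin n) (Fin n) ℝ) (i : Fin n) (s : ℝ)
    (y : Fin n → ℝ) : 2 * |s * (B *ᵥ y) i| ≤ ‖B‖ * (s ^ 2 + y ⬝ᵥ y) := by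
  have h := two_mul_abs_dotProduct_mulVec_le B (Pi.single i s) y
  rwa [single_dotProduct, single_dotProduct, Pi.single_eq_same, ← sq] at h

theorem row_dotProduct_self_le (A : Matrix (Fin n) (Fin n) ℝ) (i : Fin n) :
    A i ⬝ᵥ A i ≤ ‖A‖ ^ 2 := by
  have h := mulVec_dotProduct_mulVec_le Aᵀ (Pi.single i 1)
  rw [l2_opNorm_transpose, single_dotProduct, Pi.single_eq_same, mul_one, mul_one,
    mulVec_single_one] at h
  exact h

end Matrix

namespace GuEisenstat

open Matrix

variable {n : ℕ}

theorem exists_eq_ofFn {α : Type*} {l : List α} (h : l.length = n) :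
    ∃ g : Fin n → α, l = List.ofFn g := by
  subst h
  exact ⟨l.get, (List.ofFn_get l).symm⟩

/-- The matrix with the vectors of orthonormal pairs as rows. -/
theorem transpose_mul_self_of_pairGram {g : Fin n → EigenPair ℝ n}
    (hg : ∀ x, pairGram (List.ofFn g) x = x ⬝ᵥ x) :
    (Matrix.of fun j => (g j).vec)ᵀ * Matrix.of (fun j => (g j).vec) = 1 :=
  transpose_mul_self_eq_one fun x => by
    rw [← hg x, pairGram_ofFn, dotProduct]
    exact Finset.sum_congr rfl fun j _ => (sq _).symm

/-- The errors of the columns form a matrix `R`, and the vectors of `E'` are the rows of an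
orthogonal matrix `V`. Then `A + R * V` maps each of them exactly to the computed vector, so
entrywise errors become a perturbation of `A` of norm at most `‖R‖`. -/
theorem exists_transform {E E' : List (EigenPair ℝ n)} {A : Matrix (Fin n) (Fin n) ℝ} {κ : ℝ}
    {N : ℕ} (hκ : 0 ≤ κ) (hn : n ≤ N) (hlen : E'.length = n)
    (hgram : ∀ x, pairGram E' x = x ⬝ᵥ x)
    (hE : List.Forall₂ (fun e e' => e.val = e'.val ∧
      ∀ s, |e.vec s - (A *ᵥ e'.vec) s| ≤ κ) E E') :
    ∃ A', E = E'.map (·.transform A') ∧ ‖A' - A‖ ≤ N * κ := by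
  obtain ⟨f, rfl⟩ := exists_eq_ofFn (hE.length_eq.trans hlen)
  obtain ⟨g, rfl⟩ := exists_eq_ofFn hlen
  have hfg : ∀ j, (f j).val = (g j).val ∧ ∀ s, |(f j).vec s - (A *ᵥ (g j).vec) s| ≤ κ := by
    intro j
    have := (List.forall₂_iff_get.1 hE).2 j.val (by simp) (by simp)
    simpa using this
  set V : Matrix (Fin n) (Fin n) ℝ := Matrix.of fun j => (g j).vec with hV
  have hVV : Vᵀ * V = 1 := transpose_mul_self_of_pairGram hgram
  set R : Matrix (Fin n) (Fin n) ℝ := Matrix.of fun i j => (f j).vec i - (A *ᵥ (g j).vec) i with hR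
  refine ⟨A + R * V, ?_, ?_⟩
  · rw [List.map_ofFn]
    congr 1
    funext j
    have h1 : V *ᵥ (g j).vec = Pi.single j 1 := by
      have h2 : V * Vᵀ = 1 := mul_eq_one_comm.1 hVV
      have h3 : (g j).vec = Vᵀ *ᵥ Pi.single j 1 := by rw [mulVec_single_one]; rfl
      rw [h3, mulVec_mulVec, h2, one_mulVec]
    have h4 : (A + R * V) *ᵥ (g j).vec = (f j).vec := by
      rw [add_mulVec, ← mulVec_mulVec, h1, mulVec_single_one]
      funext i
      simp [hR, Matrix.col]
    simp only [Function.comp, EigenPair.transform, h4, ← (hfg j).1]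
  · rw [add_sub_cancel_left]
    refine (l2_opNorm_mul R V).trans ?_
    have h1 : ‖R‖ ≤ N * κ := l2_opNorm_le_of_entries hκ hn hn fun i j => (hfg j).2 i
    have h2 := l2_opNorm_le_one_of_isometry hVV
    calc ‖R‖ * ‖V‖ ≤ N * κ * 1 := by gcongr
      _ = N * κ := mul_one _

/-- The pairs `E` are the images of exact eigenpairs, of a matrix with quadratic form within `e` of
`q`, under a matrix within `δ` of the identity. -/
def ApproxDiagonalizes (E : List (EigenPair ℝ n)) (q : (Fin n → ℝ) → ℝ) (δ e : ℝ) : Prop :=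
  ∃ (E' : List (EigenPair ℝ n)) (A : Matrix (Fin n) (Fin n) ℝ),
    E = E'.map (·.transform A) ∧ E'.length = n ∧ (∀ x, pairGram E' x = x ⬝ᵥ x) ∧
      ‖A - 1‖ ≤ δ ∧ ∀ x, |pairForm E' x - q x| ≤ e * (x ⬝ᵥ x)

/-- The part of the shaft that belongs to a diagonal block, which is embedded by `P` and coupled to
the head by `β`. -/
def coupledShaft {k : ℕ} (P : Matrix (Fin n) (Fin k) ℝ) (β : ℝ) (c : Fin k → ℝ)
    (E : List (EigenPair ℝ k)) : List (ShaftEntry ℝ n) :=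
  E.map fun e => ⟨β * (c ⬝ᵥ e.vec), e.val, P *ᵥ e.vec⟩

theorem mulVec_dotProduct_eq {k : ℕ} (P : Matrix (Fin n) (Fin k) ℝ) (v : Fin k → ℝ)
    (x : Fin n → ℝ) : (P *ᵥ v) ⬝ᵥ x = v ⬝ᵥ (Pᵀ *ᵥ x) := by
  rw [dotProduct_mulVec, vecMul_transpose]

theorem shaftGram_coupledShaft {k : ℕ} (P : Matrix (Fin n) (Fin k) ℝ) (β : ℝ) (c : Fin k → ℝ)
    (E : List (EigenPair ℝ k)) (x : Fin n → ℝ) :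
    shaftGram (coupledShaft P β c E) x = pairGram E (Pᵀ *ᵥ x) := by
  induction E with
  | nil => rfl
  | cons e E ih =>
    rw [coupledShaft, List.map_cons, shaftGram_cons, pairGram_cons, ← ih, mulVec_dotProduct_eq]
    rfl

/-- Polarized Parseval gives `∑ (c ⬝ᵥ e.vec) * (e.vec ⬝ᵥ y) = c ⬝ᵥ y`. An orthonormal list thus
contributes to the coupling only through the vector `c`. -/
theorem shaftForm_coupledShaft {k : ℕ} (P : Matrix (Fin n) (Fin k) ℝ) (β : ℝ) (c : Fin k → ℝ)
    {E : List (EigenPair ℝ k)} (hE : ∀ y, pairGram E y = y ⬝ᵥ y) (h x : Fin n → ℝ) :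
    shaftForm h (coupledShaft P β c E) x =
      pairForm E (Pᵀ *ᵥ x) + 2 * β * (h ⬝ᵥ x) * (c ⬝ᵥ (Pᵀ *ᵥ x)) := by
  set y := Pᵀ *ᵥ x with hy
  have h1 : shaftForm h (coupledShaft P β c E) x = pairForm E y +
      β * (h ⬝ᵥ x) * ((pairGram E (c + y) - pairGram E (c - y)) / 2) := by
    clear hE
    induction E with
    | nil => simp [coupledShaft]
    | cons e E ih =>
      rw [coupledShaft] at ih
      rw [coupledShaft, List.map_cons, shaftForm_cons, pairForm_cons, pairGram_cons, pairGram_cons,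
        ih, mulVec_dotProduct_eq, dotProduct_add, dotProduct_sub, dotProduct_comm c, ← hy]
      ring
  rw [h1, hE, hE]
  simp only [add_dotProduct, sub_dotProduct, dotProduct_add, dotProduct_sub, dotProduct_comm y c]
  ring

section Blocks

variable {k l : ℕ}

/-- The block diagonal matrix with blocks `A₁`, `1`, `A₂`. -/
def blockTransform (n : ℕ) (A₁ : Matrix (Fin k) (Fin k) ℝ) (A₂ : Matrix (Fin l) (Fin l) ℝ) :
    Matrix (Fin n) (Fin n) ℝ :=
  blockEmbedding n k 0 * A₁ * (blockEmbedding n k 0)ᵀ +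
    blockEmbedding n 1 k * (blockEmbedding n 1 k)ᵀ +
    blockEmbedding n l (k + 1) * A₂ * (blockEmbedding n l (k + 1))ᵀ

variable (A₁ : Matrix (Fin k) (Fin k) ℝ) (A₂ : Matrix (Fin l) (Fin l) ℝ)

theorem l2_opNorm_blockTransform_sub_one_le (hn : n = k + 1 + l) :
    ‖blockTransform n A₁ A₂ - 1‖ ≤ ‖A₁ - 1‖ + ‖A₂ - 1‖ := by
  have h : blockTransform n A₁ A₂ - 1 =
      blockEmbedding n k 0 * (A₁ - 1) * (blockEmbedding n k 0)ᵀ +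
      blockEmbedding n l (k + 1) * (A₂ - 1) * (blockEmbedding n l (k + 1))ᵀ := by
    rw [← sum_blockEmbedding_mul_transpose hn, blockTransform]
    simp only [Matrix.mul_sub, Matrix.sub_mul, Matrix.mul_one]
    abel
  rw [h]
  exact (norm_add_le _ _).trans (add_le_add (l2_opNorm_blockEmbedding_conj_le (by omega) _)
    (l2_opNorm_blockEmbedding_conj_le (by omega) _))

theorem blockTransform_mul_fst (hn : n = k + 1 + l) :
    blockTransform n A₁ A₂ * blockEmbedding n k 0 = blockEmbedding n k 0 * A₁ := by
  simp only [blockTransform, Matrix.add_mul, Matrix.mul_assoc]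
  rw [blockEmbedding_transpose_mul (by omega),
    blockEmbedding_transpose_mul_of_disjoint (by omega) (by omega),
    blockEmbedding_transpose_mul_of_disjoint (by omega) (by omega)]
  simp

theorem blockTransform_mul_head (hn : n = k + 1 + l) :
    blockTransform n A₁ A₂ * blockEmbedding n 1 k = blockEmbedding n 1 k := by
  simp only [blockTransform, Matrix.add_mul, Matrix.mul_assoc]
  rw [blockEmbedding_transpose_mul (by omega),
    blockEmbedding_transpose_mul_of_disjoint (by omega) (by omega),
    blockEmbedding_transpose_mul_of_disjoint (by omega) (by omega)]
  simp

theorem blockTransform_mul_snd (hn : n = k + 1 + l) :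
    blockTransform n A₁ A₂ * blockEmbedding n l (k + 1) = blockEmbedding n l (k + 1) * A₂ := by
  simp only [blockTransform, Matrix.add_mul, Matrix.mul_assoc]
  rw [blockEmbedding_transpose_mul (by omega),
    blockEmbedding_transpose_mul_of_disjoint (by omega) (by omega),
    blockEmbedding_transpose_mul_of_disjoint (by omega) (by omega)]
  simp

/-- The program reads the shaft off the computed vectors `B *ᵥ e.vec`, whose entry `i` is the
product of row `i` of `B` with `e.vec`. With that row as `c`, the ideal shaft followed by `A` is
exactly the input of the program. -/
theorem coupledShaft_map_transform {o : ℕ} {A : Matrix (Fin n) (Fin n) ℝ}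
    {B : Matrix (Fin k) (Fin k) ℝ} (hA : A * blockEmbedding n k o = blockEmbedding n k o * B)
    (β : ℝ) (i : Fin k) (E : List (EigenPair ℝ k)) :
    (coupledShaft (blockEmbedding n k o) β (B i) E).map (·.transform A) =
      (E.map (·.transform B)).map fun e =>
        ⟨β * e.vec i, e.val, blockEmbedding n k o *ᵥ e.vec⟩ := by
  rw [coupledShaft, List.map_map, List.map_map]
  refine List.map_congr_left fun e _ => ?_
  simp only [Function.comp, ShaftEntry.transform, EigenPair.transform, mulVec_mulVec, hA]
  rfl

end Blocks

end GuEisenstat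

/-! ### Error and cost of one assembly step -/

namespace GuEisenstat

open Matrix RAM

variable {ξ : ℝ} {F : ApproxFMM ξ} {n k l : ℕ}

theorem padded_zero (i : ℕ) : padded (0 : Fin n → ℝ) i = 0 := by
  rw [padded]
  split_ifs <;> rfl

theorem tridiagForm_zero (a b : ℕ → ℝ) (n s : ℕ) : tridiagForm a b n s 0 = 0 :=
  Finset.sum_eq_zero fun i _ => by simp only [padded_zero]; ring

theorem padded_blockEmbedding_mulVec {o i : ℕ} (h : i < o ∨ o + k ≤ i) (y : Fin k → ℝ) :
    padded (blockEmbedding n k o *ᵥ y) i = 0 := by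
  rw [padded]
  split_ifs with hi
  · rw [blockEmbedding_mulVec, dif_neg (by simp only; omega)]
  · rfl

theorem blockEmbedding_mulVec_dotProduct_self {o : ℕ} (ho : o + k ≤ n) (y : Fin k → ℝ) :
    (blockEmbedding n k o *ᵥ y) ⬝ᵥ (blockEmbedding n k o *ᵥ y) = y ⬝ᵥ y := by
  rw [mulVec_dotProduct_eq, mulVec_mulVec, blockEmbedding_transpose_mul ho, one_mulVec]

theorem tridiagForm_fst (a b : ℕ → ℝ) (s : ℕ) (hk : 0 < k) (hl : 0 < l) (hn : n = k + 1 + l)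
    (y : Fin k → ℝ) :
    tridiagForm a b n s (blockEmbedding n k 0 *ᵥ y) = tridiagForm a b k s y := by
  rw [tridiagForm_split a b s hk hl hn, mulVec_mulVec, mulVec_mulVec,
    blockEmbedding_transpose_mul (by omega),
    blockEmbedding_transpose_mul_of_disjoint (by omega) (by omega), one_mulVec, zero_mulVec,
    tridiagForm_zero, padded_blockEmbedding_mulVec (by omega)]
  ring

theorem tridiagForm_snd (a b : ℕ → ℝ) (s : ℕ) (hk : 0 < k) (hl : 0 < l) (hn : n = k + 1 + l)
    (y : Fin l → ℝ) :
    tridiagForm a b n s (blockEmbedding n l (k + 1) *ᵥ y) = tridiagForm a b l (s + k + 1) y := by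
  rw [tridiagForm_split a b s hk hl hn, mulVec_mulVec, mulVec_mulVec,
    blockEmbedding_transpose_mul (by omega),
    blockEmbedding_transpose_mul_of_disjoint (by omega) (by omega), one_mulVec, zero_mulVec,
    tridiagForm_zero, padded_blockEmbedding_mulVec (by omega)]
  ring

/-- The unit vector of the head. -/
def headVec (n k : ℕ) : Fin n → ℝ := fun i => if i.val = k then 1 else 0

theorem headVec_eq : headVec n k = blockEmbedding n 1 k *ᵥ fun _ => 1 := by
  funext i
  rw [blockEmbedding_mulVec, headVec]
  by_cases h : i.val = k
  · rw [if_pos h, dif_pos (by omega)]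
  · rw [if_neg h, dif_neg (by omega)]

theorem headVec_dotProduct (x : Fin n → ℝ) : headVec n k ⬝ᵥ x = padded x k := by
  rw [padded, dotProduct]
  split_ifs with h
  · rw [Finset.sum_eq_single ⟨k, h⟩]
    · simp [headVec]
    · intro i _ hi
      have : i.val ≠ k := fun h' => hi (Fin.ext h')
      simp [headVec, this]
    · simp
  · refine Finset.sum_eq_zero fun i _ => ?_
    have : i.val ≠ k := fun h' => h (h' ▸ i.2)
    simp [headVec, this]

/-- The exact coupling uses a unit row vector where the ideal shaft has row `i` of `B`. The loss of
orthogonality in the computed block thus enters the form only through `‖B - 1‖`. -/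
theorem abs_two_mul_coupling_le {B : Matrix (Fin k) (Fin k) ℝ} {β δ : ℝ} (hβ : |β| ≤ 1)
    (hδ : ‖B - 1‖ ≤ δ) (i : Fin k) (p : ℝ) (y : Fin k → ℝ) :
    |2 * β * p * (B i ⬝ᵥ y) - 2 * β * p * y i| ≤ δ * (p ^ 2 + y ⬝ᵥ y) := by
  have h1 : 2 * β * p * (B i ⬝ᵥ y) - 2 * β * p * y i = β * (2 * (p * ((B - 1) *ᵥ y) i)) := by
    rw [sub_mulVec, one_mulVec, Pi.sub_apply, show (B *ᵥ y) i = B i ⬝ᵥ y from rfl]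
    ring
  have h2 := two_mul_abs_mul_mulVec_le (B - 1) i p y
  have h3 := dotProduct_self_nonneg_real y
  rw [h1, abs_mul, abs_mul, abs_two]
  calc |β| * (2 * |p * ((B - 1) *ᵥ y) i|) ≤ 1 * (2 * |p * ((B - 1) *ᵥ y) i|) := by gcongr
    _ ≤ ‖B - 1‖ * (p ^ 2 + y ⬝ᵥ y) := by rwa [one_mul]
    _ ≤ δ * (p ^ 2 + y ⬝ᵥ y) := by gcongr

theorem abs_arrow_form_sub_le (a b : ℕ → ℝ) (s : ℕ) (hk : 0 < k) (hl : 0 < l) (hn : n = k + 1 + l)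
    (hb : ∀ i, |b i| ≤ 1) {E₁ : List (EigenPair ℝ k)} {E₂ : List (EigenPair ℝ l)}
    {A₁ : Matrix (Fin k) (Fin k) ℝ} {A₂ : Matrix (Fin l) (Fin l) ℝ} {δ₁ δ₂ e₁ e₂ : ℝ}
    (hg₁ : ∀ x, pairGram E₁ x = x ⬝ᵥ x) (hg₂ : ∀ x, pairGram E₂ x = x ⬝ᵥ x)
    (hδ₁ : ‖A₁ - 1‖ ≤ δ₁) (hδ₂ : ‖A₂ - 1‖ ≤ δ₂)
    (hf₁ : ∀ x, |pairForm E₁ x - tridiagForm a b k s x| ≤ e₁ * (x ⬝ᵥ x))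
    (hf₂ : ∀ x, |pairForm E₂ x - tridiagForm a b l (s + k + 1) x| ≤ e₂ * (x ⬝ᵥ x))
    (he₁ : 0 ≤ e₁) (he₂ : 0 ≤ e₂) (x : Fin n → ℝ) :
    |a (s + k) * (headVec n k ⬝ᵥ x) ^ 2 + shaftForm (headVec n k)
        (coupledShaft (blockEmbedding n k 0) (b (s + k - 1)) (A₁ ⟨k - 1, by omega⟩) E₁ ++
          coupledShaft (blockEmbedding n l (k + 1)) (b (s + k)) (A₂ ⟨0, hl⟩) E₂) x -
      tridiagForm a b n s x| ≤ (e₁ + e₂ + δ₁ + δ₂) * (x ⬝ᵥ x) := by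
  rw [shaftForm_append, shaftForm_coupledShaft _ _ _ hg₁, shaftForm_coupledShaft _ _ _ hg₂,
    headVec_dotProduct, tridiagForm_split a b s hk hl hn, dotProduct_self_split hn]
  have hy₁ : ((blockEmbedding n k 0)ᵀ *ᵥ x) ⟨k - 1, by omega⟩ = padded x (k - 1) := by
    rw [blockEmbedding_transpose_mulVec (by omega), padded, dif_pos (by omega)]
    simp
  have hy₂ : ((blockEmbedding n l (k + 1))ᵀ *ᵥ x) ⟨0, hl⟩ = padded x (k + 1) := by
    rw [blockEmbedding_transpose_mulVec (by omega), padded, dif_pos (by omega)]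
    simp
  rw [← hy₁, ← hy₂]
  set y := (blockEmbedding n k 0)ᵀ *ᵥ x
  set z := (blockEmbedding n l (k + 1))ᵀ *ᵥ x
  set p := padded x k
  have h1 := abs_le.1 (hf₁ y)
  have h2 := abs_le.1 (hf₂ z)
  have h3 := abs_le.1 (abs_two_mul_coupling_le (hb (s + k - 1)) hδ₁ ⟨k - 1, by omega⟩ p y)
  have h4 := abs_le.1 (abs_two_mul_coupling_le (hb (s + k)) hδ₂ ⟨0, hl⟩ p z)
  have hy := dotProduct_self_nonneg_real y
  have hz := dotProduct_self_nonneg_real z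
  have hd₁ := (norm_nonneg _).trans hδ₁
  have hd₂ := (norm_nonneg _).trans hδ₂
  have h5 : (e₁ + e₂ + δ₁ + δ₂) * (p ^ 2 + y ⬝ᵥ y + z ⬝ᵥ z) = e₁ * (y ⬝ᵥ y) + e₂ * (z ⬝ᵥ z) +
      δ₁ * (p ^ 2 + y ⬝ᵥ y) + δ₂ * (p ^ 2 + z ⬝ᵥ z) + (e₁ * (p ^ 2 + z ⬝ᵥ z) +
      e₂ * (p ^ 2 + y ⬝ᵥ y) + δ₁ * (z ⬝ᵥ z) + δ₂ * (y ⬝ᵥ y)) := by ring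
  have h6 : 0 ≤ e₁ * (p ^ 2 + z ⬝ᵥ z) +
      e₂ * (p ^ 2 + y ⬝ᵥ y) + δ₁ * (z ⬝ᵥ z) + δ₂ * (y ⬝ᵥ y) := by positivity
  rw [h5, abs_le]
  constructor <;> linarith

theorem exec_mapTimes {α : Type} (β : ℝ) (i : Fin k) (g : ℝ → EigenPair ℝ k → α)
    (E : List (EigenPair ℝ k)) :
    Exec F (mapList (fun e => do let z ← times β (e.vec i); pure (g z e)) E)
      (E.map fun e => g (β * e.vec i) e) (E.length * 1) := by
  refine exec_mapList (fun e => ?_) E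
  exact Exec.bind (C' := 0) (exec_times β (e.vec i)) (Exec.pure _)

/-- The induction step. The bound `1` on the form of the block grows to `5 / 4` for the arrowhead
matrix, since the accumulated errors are at most `1 / 4`; the bound is not passed up the recursion,
where each block again refers to the exact form. -/
theorem fuelExec_assemble {η : ℝ} {N X t : ℕ} (hF : FMMBudget F η N X) (hη : 0 < η)
    (hηN : 128 * N * η ≤ 1) (hnN : n ≤ N) (ht : 4 ≤ η ^ 16 * 2 ^ t) (hk : 0 < k) (hl : 0 < l)
    (hn : n = k + 1 + l) (a b : ℕ → ℝ) (s : ℕ) (hb : ∀ i, |b i| ≤ 1)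
    (hq : ∀ x, |tridiagForm a b n s x| ≤ x ⬝ᵥ x)
    {E₁ : List (EigenPair ℝ k)} {E₂ : List (EigenPair ℝ l)}
    (hE₁ : ApproxDiagonalizes E₁ (tridiagForm a b k s) (k * (6 * N * η ^ 17)) (k * (4 * N * η ^ 3)))
    (hE₂ : ApproxDiagonalizes E₂ (tridiagForm a b l (s + k + 1)) (l * (6 * N * η ^ 17))
      (l * (4 * N * η ^ 3))) :
    ∃ E, ApproxDiagonalizes E (tridiagForm a b n s) (n * (6 * N * η ^ 17)) (n * (4 * N * η ^ 3)) ∧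
      FuelExec F (fun fuel => assemble fuel (powTolerances η) hk hl hn (a (s + k)) (b (s + k - 1))
        (b (s + k)) E₁ E₂) E (2 + (k + l) + n * n * ((t + 7) * (X + 17))) := by
  obtain ⟨E₁, A₁, rfl, hl₁, hg₁, hδ₁, hf₁⟩ := hE₁
  obtain ⟨E₂, A₂, rfl, hl₂, hg₂, hδ₂, hf₂⟩ := hE₂
  have hN0 : (0 : ℝ) ≤ N := Nat.cast_nonneg N
  have hnr : (n : ℝ) = k + 1 + l := by rw [hn]; push_cast; ring
  have hnN' : (n : ℝ) ≤ N := by exact_mod_cast hnN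
  have hk0 : (0 : ℝ) ≤ k := Nat.cast_nonneg k
  have hl0 : (0 : ℝ) ≤ l := Nat.cast_nonneg l
  have hN1 : (1 : ℝ) ≤ N := by linarith
  have hη1 : η ≤ 1 / 128 := by nlinarith
  have hη3 : N * (N * η ^ 3) ≤ 1 / 128 * (1 / 128) * (1 / 128) := by
    have h1 : N * η ≤ 1 / 128 := by linarith
    calc N * (N * η ^ 3) = (N * η) * (N * η) * η := by ring
      _ ≤ _ := by gcongr
  have hη17 : 6 * (N * (N * η ^ 17)) ≤ N * η ^ 3 := by
    have h1 : N * η ≤ 1 / 128 := by linarith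
    have h2 : η ^ 13 ≤ 1 := pow_le_one₀ hη.le (by linarith)
    calc 6 * (N * (N * η ^ 17)) = (N * η ^ 3) * (6 * (N * η) * η ^ 13) := by ring
      _ ≤ (N * η ^ 3) * (6 * (1 / 128) * 1) := by gcongr
      _ ≤ N * η ^ 3 := by nlinarith [show 0 ≤ N * η ^ 3 by positivity]
  set δ := 6 * N * η ^ 17 with hδ
  set e := 4 * N * η ^ 3 with he
  have hδ0 : 0 ≤ δ := by positivity
  have he0 : 0 ≤ e := by positivity
  -- As `n = k + 1 + l`, one share `e = 4 * N * η ^ 3` is still free: one quarter pays for the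
  -- perturbed couplings, three quarters for the arrowhead problem.
  have hsum : (k * e + l * e + k * δ + l * δ) ≤ n * e - 3 * N * η ^ 3 := by
    have h1 : (k + l : ℝ) * δ ≤ N * δ := by gcongr; linarith
    have h2 : N * δ ≤ N * η ^ 3 := by rw [hδ]; linarith
    rw [hnr]
    linarith
  have hsmall : n * e ≤ 1 / 4 := by
    have h1 : n * e ≤ N * e := by gcongr
    have h2 : N * e = 4 * (N * (N * η ^ 3)) := by rw [he]; ring
    linarith
  have hδ2 : k * δ + l * δ ≤ 1 / 4 := by
    have : 0 ≤ k * e + l * e + 3 * N * η ^ 3 := by positivity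
    linarith
  have hform := abs_arrow_form_sub_le a b s hk hl hn hb hg₁ hg₂ hδ₁ hδ₂ hf₁ hf₂ (by positivity)
    (by positivity)
  set A := blockTransform n A₁ A₂ with hA
  have hA1 : ‖A - 1‖ ≤ k * δ + l * δ :=
    (l2_opNorm_blockTransform_sub_one_le A₁ A₂ hn).trans (add_le_add hδ₁ hδ₂)
  have hAnorm : ‖A‖ ≤ 2 := by
    have h1 : ‖A‖ ≤ ‖A - 1‖ + ‖(1 : Matrix (Fin n) (Fin n) ℝ)‖ := by
      simpa using norm_add_le (A - 1) 1
    have h2 : ‖(1 : Matrix (Fin n) (Fin n) ℝ)‖ ≤ 1 := l2_opNorm_le_one_of_isometry (by simp)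
    linarith
  set L := coupledShaft (blockEmbedding n k 0) (b (s + k - 1)) (A₁ ⟨k - 1, by omega⟩) E₁ ++
    coupledShaft (blockEmbedding n l (k + 1)) (b (s + k)) (A₂ ⟨0, hl⟩) E₂ with hL
  obtain ⟨E, E', hlen, hgram, hE', hEE, hex⟩ := fuelExec_solveArrowhead (α := a (s + k))
    (h := headVec n k) (A := A) hF hη hηN hnN
    (by rw [headVec_eq, mulVec_mulVec, blockTransform_mul_head _ _ hn])
    (fun i => (row_dotProduct_self_le A i).trans (by nlinarith [norm_nonneg A])) ht L
    (by rw [hL, List.length_append, coupledShaft, coupledShaft, List.length_map, List.length_map,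
          hl₁, hl₂]; omega)
    (fun x => by
      rw [hL, shaftGram_append, shaftGram_coupledShaft, shaftGram_coupledShaft, hg₁, hg₂,
        headVec_dotProduct, dotProduct_self_split hn]
      ring)
    (fun x => by
      have h1 := abs_le.1 (hform x)
      have h2 := abs_le.1 (hq x)
      have h3 := dotProduct_self_nonneg_real x
      have h4 : (k * e + l * e + k * δ + l * δ) * (x ⬝ᵥ x) ≤ 1 / 4 * (x ⬝ᵥ x) := by
        gcongr
        have : 0 ≤ 3 * N * η ^ 3 := by positivity
        linarith
      rw [abs_le]
      constructor <;> linarith)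
  obtain ⟨A', rfl, hA'⟩ := exists_transform (by positivity) hnN hlen hgram hEE
  refine ⟨_, ⟨E', A', rfl, hlen, hgram, ?_, fun x => ?_⟩, ?_⟩
  · have h1 : ‖A' - 1‖ ≤ ‖A' - A‖ + ‖A - 1‖ := norm_sub_le_norm_sub_add_norm_sub _ _ _
    have h2 : N * (6 * η ^ 17) = δ := by rw [hδ]; ring
    rw [hnr]
    linarith
  · have h1 := abs_le.1 (hform x)
    have h2 := abs_le.1 (hE' x)
    have h3 := dotProduct_self_nonneg_real x
    have h4 := mul_le_mul_of_nonneg_right hsum h3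
    rw [abs_le]
    constructor <;> linarith
  · have hrow₁ : ∀ e : EigenPair ℝ k, (fun i : Fin n => if h : i.val < k then e.vec ⟨i.val, h⟩
        else 0) = blockEmbedding n k 0 *ᵥ e.vec := fun e => by
      funext i
      rw [blockEmbedding_mulVec]
      simp
    have hrow₂ : ∀ e : EigenPair ℝ l, (fun i : Fin n => if h : k < i.val then
        e.vec ⟨i.val - (k + 1), by omega⟩ else 0) = blockEmbedding n l (k + 1) *ᵥ e.vec :=
      fun e => by
        funext i
        rw [blockEmbedding_mulVec]
        by_cases h : k < i.val
        · rw [dif_pos h, dif_pos (by omega)]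
        · rw [dif_neg h, dif_neg (by omega)]
    rw [hL, List.map_append, hA,
      coupledShaft_map_transform (blockTransform_mul_fst A₁ A₂ hn),
      coupledShaft_map_transform (blockTransform_mul_snd A₁ A₂ hn)] at hex
    simp only [← hrow₁, ← hrow₂] at hex
    refine FuelExec.mono (Exec.bindFuel exec_lit_zero (Exec.bindFuel exec_lit_one
      (Exec.bindFuel (exec_mapTimes _ _ _ _)
        (Exec.bindFuel (exec_mapTimes _ _ _ _)
          (C' := n * n * ((t + 7) * (X + 17))) hex)))) ?_
    simp only [List.length_map, hl₁, hl₂]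
    omega

end GuEisenstat

/-! ## The recursion -/

namespace GuEisenstat

open Matrix RAM

variable {ξ : ℝ} {F : ApproxFMM ξ} {n : ℕ}

theorem approxDiagonalizes_of_exact {E : List (EigenPair ℝ n)} {q : (Fin n → ℝ) → ℝ} {δ e : ℝ}
    (hlen : E.length = n) (hgram : ∀ x, pairGram E x = x ⬝ᵥ x) (hform : ∀ x, pairForm E x = q x)
    (hδ : 0 ≤ δ) (he : 0 ≤ e) : ApproxDiagonalizes E q δ e := by
  refine ⟨E, 1, ?_, hlen, hgram, by rwa [sub_self, norm_zero], fun x => ?_⟩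
  · conv_lhs => rw [← List.map_id E]
    refine List.map_congr_left fun e _ => ?_
    rw [EigenPair.transform, one_mulVec]
    rfl
  · rw [hform, sub_self, abs_zero]
    exact mul_nonneg he (dotProduct_self_nonneg_real x)

/-- Nonvanishing of `q` gives `h < t`, so that `y > 0` and neither division fails; this is where the
assumption that the input is unreduced enters. The identity `q * q + y * y = 2 * t * y` makes the
rotation diagonalize the matrix. -/
theorem exec_solveTwo (p q r : ℝ) (hq : q ≠ 0) :
    ∃ E : List (EigenPair ℝ 2), E.length = 2 ∧ (∀ x, pairGram E x = x ⬝ᵥ x) ∧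
      (∀ x, pairForm E x = p * x 0 ^ 2 + 2 * q * x 0 * x 1 + r * x 1 ^ 2) ∧
      Exec F (solveTwo p q r) E 20 := by
  have hq2 : 0 < q * q := mul_self_pos.2 hq
  set h := (p - r) / (2 : ℝ) with hh
  set t := √(h * h + q * q) with ht
  have ht2 : t * t = h * h + q * q := Real.mul_self_sqrt (by nlinarith [mul_self_nonneg h])
  have ht0 : 0 < t := Real.sqrt_pos.2 (by nlinarith [mul_self_nonneg h])
  set y := t - h with hy
  have hy0 : 0 < y := by
    have : h < t := lt_of_le_of_lt (le_abs_self h) (abs_lt_of_sq_lt_sq (by nlinarith) ht0.le)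
    linarith
  have hs : q * q + y * y = 2 * t * y := by rw [hy]; nlinarith
  have hs0 : 0 < q * q + y * y := by nlinarith [mul_self_nonneg y]
  set w := √(q * q + y * y) with hw
  have hw0 : 0 < w := Real.sqrt_pos.2 hs0
  have hw2 : w * w = q * q + y * y := Real.mul_self_sqrt hs0.le
  have huv : (q / w) ^ 2 + (y / w) ^ 2 = 1 := by
    rw [div_pow, div_pow, ← add_div, div_eq_one_iff_eq (by positivity)]
    linarith
  have h1 : t * ((q / w) ^ 2 - (y / w) ^ 2) = h := by
    rw [div_pow, div_pow, ← sub_div, sq w, hw2, hs, mul_div_assoc', div_eq_iff (by positivity)]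
    have : q * q = 2 * t * y - y * y := by linarith
    rw [sq q, this, hy]
    ring
  have h2 : t * (2 * (q / w) * (y / w)) = q := by
    rw [show t * (2 * (q / w) * (y / w)) = 2 * t * y * q / (w * w) by field_simp, hw2, hs]
    field_simp
  refine ⟨[⟨(p + r) / (2 : ℝ) + t, ![q / w, y / w]⟩, ⟨(p + r) / (2 : ℝ) - t, ![-(y / w), q / w]⟩],
    rfl, fun x => ?_, fun x => ?_, ?_⟩
  · simp only [pairGram_cons, pairGram_nil, dotProduct, Fin.sum_univ_two, cons_val_zero,
      cons_val_one]
    linear_combination (x 0 * x 0 + x 1 * x 1) * huv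
  · simp only [pairForm_cons, pairForm_nil, dotProduct, Fin.sum_univ_two, cons_val_zero,
      cons_val_one]
    have hp : p = (p + r) / 2 + h := by rw [hh]; ring
    have hr : r = (p + r) / 2 - h := by rw [hh]; ring
    linear_combination ((p + r) / 2 * (x 0 ^ 2 + x 1 ^ 2)) * huv + (x 0 ^ 2 - x 1 ^ 2) * h1 +
      2 * x 0 * x 1 * h2 + (x 0 ^ 2 - x 1 ^ 2) * hh
  · unfold solveTwo
    refine Exec.mono (Exec.bind (by simpa only [Nat.cast_ofNat] using exec_lit (F := F) 2)
      (Exec.bind (exec_plus _ _)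
      (Exec.bind (exec_divide _ two_ne_zero) (Exec.bind (exec_minus _ _)
      (Exec.bind (exec_divide _ two_ne_zero) (Exec.bind (exec_times _ _)
      (Exec.bind (exec_times _ _) (Exec.bind (exec_plus _ _)
      (Exec.bind (exec_root (add_nonneg (mul_self_nonneg _) (mul_self_nonneg _))) (Exec.bind (exec_plus _ _)
      (Exec.bind (exec_minus _ _) (Exec.bind (exec_minus _ _)
      (Exec.bind (exec_times _ _) (Exec.bind (exec_plus _ _)
      (Exec.bind (exec_root (add_nonneg (mul_self_nonneg _) (mul_self_nonneg _))) (Exec.bind (exec_divide _ hw0.ne')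
      (Exec.bind (exec_divide _ hw0.ne') (Exec.bind (exec_negate _)
        (Exec.pure _))))))))))))))))))) ?_
    norm_num

theorem tridiagForm_one (a b : ℕ → ℝ) (s : ℕ) (x : Fin 1 → ℝ) :
    tridiagForm a b 1 s x = a s * x 0 ^ 2 := by
  simp [tridiagForm, padded]

theorem tridiagForm_two (a b : ℕ → ℝ) (s : ℕ) (x : Fin 2 → ℝ) :
    tridiagForm a b 2 s x =
      a s * x 0 ^ 2 + 2 * b s * x 0 * x 1 + a (s + 1) * x 1 ^ 2 := by
  simp [tridiagForm, padded, Finset.sum_range_succ]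

/-- Nearly equal halves satisfy `2 * (k * k + l * l) + 1 ≤ n * n`, so the two recursive calls use at
most about half of `4 * n * n * W`. The rest covers the assembly, and no additional logarithm arises
from the depth. -/
theorem recursion_cost_le {k l n W : ℕ} (hn : n = k + 1 + l) (hkl : k ≤ l) (hlk : l ≤ k + 1)
    (hW : 1 ≤ W) :
    4 * (k * k * W) + (4 * (l * l * W) + (2 + (k + l) + n * n * W)) ≤ 4 * (n * n * W) := by
  have h1 : 2 * (k * k + l * l) + 1 ≤ n * n := by
    rw [hn]
    obtain h | h : l = k ∨ l = k + 1 := by omega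
    · rw [h]; nlinarith
    · rw [h]; nlinarith
  have h2 := Nat.mul_le_mul_right W h1
  have h3 : n ≤ n * n * W := (Nat.le_mul_self n).trans (Nat.le_mul_of_pos_right _ hW)
  have h4 : (2 * (k * k + l * l) + 1) * W = 2 * (k * k * W) + 2 * (l * l * W) + W := by ring
  omega

theorem fuelExec_diagonalizeBlock {η : ℝ} {N X t : ℕ} (hF : FMMBudget F η N X) (hη : 0 < η)
    (hηN : 128 * N * η ≤ 1) (ht : 4 ≤ η ^ 16 * 2 ^ t) (a b : ℕ → ℝ) (hb : ∀ i, |b i| ≤ 1)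
    (n s : ℕ) (hn0 : 0 < n) (hnN : n ≤ N) (hb0 : ∀ i, i + 1 < n → b (s + i) ≠ 0)
    (hq : ∀ x, |tridiagForm a b n s x| ≤ x ⬝ᵥ x) :
    ∃ E, ApproxDiagonalizes E (tridiagForm a b n s) (n * (6 * N * η ^ 17)) (n * (4 * N * η ^ 3)) ∧
      FuelExec F (fun fuel => diagonalizeBlock fuel (powTolerances η) a b n s) E
        (4 * (n * n * ((t + 7) * (X + 17)))) := by
  induction n using Nat.strong_induction_on generalizing s with
  | _ n ih =>
  have hW : 119 ≤ (t + 7) * (X + 17) := Nat.mul_le_mul (by omega : 7 ≤ t + 7) (by omega : 17 ≤ X + 17)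
  match n, ih, hn0, hnN, hb0, hq with
  | 1, _, _, _, _, _ =>
    refine ⟨[⟨a s, fun _ => 1⟩], approxDiagonalizes_of_exact rfl (fun x => ?_) (fun x => ?_)
      (by positivity) (by positivity), ?_⟩
    · simp [dotProduct, sq]
    · rw [tridiagForm_one]
      simp [dotProduct]
    · simp only [diagonalizeBlock]
      refine (Exec.bind (C' := 0) exec_lit_one ?_).fuelExec.mono (by omega)
      exact Exec.pure _
  | 2, _, _, _, hb0, _ =>
    obtain ⟨E, hlen, hgram, hform, hex⟩ := exec_solveTwo (F := F) (a s) (b s) (a (s + 1))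
      (hb0 0 (by omega))
    refine ⟨E, approxDiagonalizes_of_exact hlen hgram
      (fun x => by rw [hform, tridiagForm_two]) (by positivity) (by positivity), ?_⟩
    simp only [diagonalizeBlock]
    exact hex.fuelExec.mono (by omega)
  | n + 3, ih, _, hnN, hb0, hq =>
    set k := (n + 2) / 2 with hk
    set l := (n + 3) / 2 with hl
    have hkl : n + 3 = k + 1 + l := by omega
    have hk0 : 0 < k := by omega
    have hl0 : 0 < l := by omega
    obtain ⟨E₁, hE₁, hx₁⟩ := ih k (by omega) s hk0 (by omega) (fun i hi => hb0 i (by omega))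
      fun y => by
        -- The form of a diagonal block is the restriction of the whole form to padded vectors, so
        -- it inherits the bound.
        rw [← tridiagForm_fst a b s hk0 hl0 hkl,
          ← blockEmbedding_mulVec_dotProduct_self (n := n + 3) (o := 0) (by omega) y]
        exact hq _
    obtain ⟨E₂, hE₂, hx₂⟩ := ih l (by omega) (s + k + 1) hl0 (by omega)
      (fun i hi => by
        rw [show s + k + 1 + i = s + (k + 1 + i) by omega]
        exact hb0 _ (by omega))
      fun y => by
        rw [← tridiagForm_snd a b s hk0 hl0 hkl,
          ← blockEmbedding_mulVec_dotProduct_self (n := n + 3) (o := k + 1) (by omega) y]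
        exact hq _
    obtain ⟨E, hE, hx⟩ := fuelExec_assemble hF hη hηN hnN ht hk0 hl0 hkl a b s hb hq hE₁ hE₂
    refine ⟨E, hE, ?_⟩
    simp only [diagonalizeBlock]
    refine (hx₁.bind (hx₂.bind hx)).mono ?_
    exact recursion_cost_le hkl (by omega) (by omega) (by omega)

end GuEisenstat

/-! ## The quadratic form of the input matrix -/

namespace GuEisenstat

open Matrix RAM

variable {ξ : ℝ} {F : ApproxFMM ξ} {n : ℕ}

theorem sum_sum_band {t : ℕ → ℕ → ℝ} (hs : ∀ i j, t i j = t j i)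
    (ht : ∀ i j, i + 1 < j → t i j = 0) (m : ℕ) :
    ∑ i ∈ Finset.range (m + 1), ∑ j ∈ Finset.range (m + 1), t i j =
      ∑ i ∈ Finset.range m, (t i i + 2 * t i (i + 1)) + t m m := by
  induction m with
  | zero => simp
  | succ m ih =>
    have h1 : ∑ i ∈ Finset.range (m + 1), t i (m + 1) = t m (m + 1) := by
      rw [Finset.sum_range_succ, Finset.sum_eq_zero, zero_add]
      intro i hi
      exact ht i (m + 1) (by rw [Finset.mem_range] at hi; omega)
    have h2 : ∑ j ∈ Finset.range (m + 1), t (m + 1) j = t m (m + 1) := by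
      rw [← h1]
      exact Finset.sum_congr rfl fun j _ => hs _ _
    rw [Finset.sum_range_succ _ (m + 1), Finset.sum_range_succ _ (m + 1), h2,
      Finset.sum_congr rfl fun i _ => Finset.sum_range_succ (t i) (m + 1),
      Finset.sum_add_distrib, ih, h1, Finset.sum_range_succ _ m]
    ring

theorem tridiagForm_entries {T : Matrix (Fin n) (Fin n) ℝ} (hT : IsUnreducedSymmTridiagonal T)
    (x : Fin n → ℝ) :
    tridiagForm (diagEntries T) (offDiagEntries T) n 0 x = x ⬝ᵥ (T *ᵥ x) := by
  set t : ℕ → ℕ → ℝ := fun i j =>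
    if h : i < n ∧ j < n then x ⟨i, h.1⟩ * T ⟨i, h.1⟩ ⟨j, h.2⟩ * x ⟨j, h.2⟩ else 0 with ht
  have hs : ∀ i j, t i j = t j i := by
    intro i j
    by_cases h : i < n ∧ j < n
    · simp only [ht, dif_pos h, dif_pos h.symm]
      rw [← hT.symm.apply]
      ring
    · have h' : ¬ (j < n ∧ i < n) := fun h' => h h'.symm
      simp only [ht, dif_neg h, dif_neg h']
  have hband : ∀ i j, i + 1 < j → t i j = 0 := by
    intro i j hij
    simp only [ht]
    split_ifs with h
    · rw [hT.tridiagonal _ _ hij]; ring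
    · rfl
  have h1 : x ⬝ᵥ (T *ᵥ x) = ∑ i ∈ Finset.range n, ∑ j ∈ Finset.range n, t i j := by
    simp only [Finset.sum_range, dotProduct, mulVec, Finset.mul_sum]
    refine Finset.sum_congr rfl fun i _ => Finset.sum_congr rfl fun j _ => ?_
    simp only [ht, i.2, j.2, and_self, dite_true, mul_assoc]
  obtain rfl | ⟨m, rfl⟩ : n = 0 ∨ ∃ m, n = m + 1 := by
    cases n
    · exact Or.inl rfl
    · exact Or.inr ⟨_, rfl⟩
  · simp [tridiagForm]
  · rw [h1, sum_sum_band hs hband, tridiagForm, Finset.sum_range_succ]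
    congr 1
    · refine Finset.sum_congr rfl fun i hi => ?_
      rw [Finset.mem_range] at hi
      have h2 : i < m + 1 := by omega
      have h3 : i + 1 < m + 1 := by omega
      simp only [ht, padded, diagEntries, offDiagEntries, Nat.zero_add, h2, h3, and_self, dite_true]
      ring
    · simp only [ht, padded, diagEntries, Nat.zero_add, Nat.lt_succ_self, and_self, dite_true,
        lt_irrefl, dite_false]
      ring

theorem abs_entry_le (T : Matrix (Fin n) (Fin n) ℝ) (i j : Fin n) : |T i j| ≤ ‖T‖ := by
  have h := two_mul_abs_mul_mulVec_le T i 1 (Pi.single j 1)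
  rw [mulVec_single_one, single_dotProduct, Pi.single_eq_same, one_mul] at h
  have h1 : |T.col j i| = |T i j| := rfl
  linarith

theorem abs_dotProduct_mulVec_self_le (T : Matrix (Fin n) (Fin n) ℝ) (x : Fin n → ℝ) :
    |x ⬝ᵥ (T *ᵥ x)| ≤ ‖T‖ * (x ⬝ᵥ x) := by
  have h := two_mul_abs_dotProduct_mulVec_le T x x
  linarith

/-! ## The computed factorization -/

theorem ApproxDiagonalizes.exists_factorization {T : Matrix (Fin n) (Fin n) ℝ} (hT : T.IsSymm)
    {E : List (EigenPair ℝ n)} {q : (Fin n → ℝ) → ℝ} {δ e : ℝ} (he : 0 ≤ e)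
    (hq : ∀ x, q x = x ⬝ᵥ (T *ᵥ x)) (hE : ApproxDiagonalizes E q δ e) :
    ∃ (A U : Matrix (Fin n) (Fin n) ℝ) (Λ : Fin n → ℝ), E = outputPairs (A * U) Λ ∧
      Uᵀ * U = 1 ∧ ‖A - 1‖ ≤ δ ∧ ‖T - U * diagonal Λ * Uᵀ‖ ≤ e := by
  obtain ⟨E', A, rfl, hlen, hgram, hδ, hform⟩ := hE
  obtain ⟨g, rfl⟩ := exists_eq_ofFn hlen
  set V : Matrix (Fin n) (Fin n) ℝ := Matrix.of fun j => (g j).vec with hV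
  have hVV : Vᵀ * V = 1 := transpose_mul_self_of_pairGram hgram
  refine ⟨A, Vᵀ, fun j => (g j).val, ?_, ?_, hδ, ?_⟩
  · rw [List.map_ofFn]
    rfl
  · rw [transpose_transpose]
    exact mul_eq_one_comm.1 hVV
  · rw [transpose_transpose]
    refine IsSymm.l2_opNorm_le ?_ he fun x => ?_
    · rw [IsSymm, transpose_sub, transpose_mul, transpose_mul, transpose_transpose,
        diagonal_transpose, hT.eq, Matrix.mul_assoc]
    · have h1 : x ⬝ᵥ ((Vᵀ * diagonal (fun j => (g j).val) * V) *ᵥ x) =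
          pairForm (List.ofFn g) x := by
        rw [pairForm_ofFn, ← mulVec_mulVec, ← mulVec_mulVec, dotProduct_mulVec, vecMul_transpose,
          dotProduct]
        refine Finset.sum_congr rfl fun j _ => ?_
        rw [mulVec_diagonal, show (V *ᵥ x) j = (g j).vec ⬝ᵥ x from rfl]
        ring
      rw [sub_mulVec, dotProduct_sub, h1, abs_sub_comm, ← hq]
      exact hform x

/-- With `B = A - 1` the difference equals `Uᵀ * (B + Bᵀ + Bᵀ * B) * U`. -/
theorem norm_transpose_mul_self_sub_one_le {A U : Matrix (Fin n) (Fin n) ℝ} {δ : ℝ}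
    (hU : Uᵀ * U = 1) (hA : ‖A - 1‖ ≤ δ) : ‖(A * U)ᵀ * (A * U) - 1‖ ≤ 2 * δ + δ ^ 2 := by
  set B := A - 1
  have hU1 := l2_opNorm_le_one_of_isometry hU
  have hδ := (norm_nonneg B).trans hA
  have h1 : (A * U)ᵀ * (A * U) - 1 = Uᵀ * (B + Bᵀ + Bᵀ * B) * U := by
    rw [← hU, show A = B + 1 from (sub_add_cancel A 1).symm]
    simp only [transpose_mul, transpose_add, Matrix.add_mul, Matrix.mul_add,
      Matrix.one_mul, Matrix.mul_assoc]
    abel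
  have h2 : ‖B + Bᵀ + Bᵀ * B‖ ≤ 2 * δ + δ ^ 2 := by
    refine (norm_add₃_le).trans ?_
    have h3 := l2_opNorm_mul Bᵀ B
    rw [l2_opNorm_transpose] at h3
    rw [l2_opNorm_transpose]
    nlinarith [norm_nonneg B]
  rw [h1]
  calc ‖Uᵀ * (B + Bᵀ + Bᵀ * B) * U‖ ≤ ‖Uᵀ‖ * ‖B + Bᵀ + Bᵀ * B‖ * ‖U‖ :=
        (l2_opNorm_mul _ _).trans (mul_le_mul_of_nonneg_right (l2_opNorm_mul _ _) (norm_nonneg _))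
    _ ≤ 1 * (2 * δ + δ ^ 2) * 1 := by
        rw [l2_opNorm_transpose]
        gcongr
    _ = 2 * δ + δ ^ 2 := by ring

theorem norm_sub_conj_le {T M A : Matrix (Fin n) (Fin n) ℝ} {δ e : ℝ} (hT : ‖T‖ ≤ 1)
    (he1 : e ≤ 1) (hM : ‖T - M‖ ≤ e) (hA : ‖A - 1‖ ≤ δ) :
    ‖T - A * M * Aᵀ‖ ≤ e + 2 * (2 * δ + δ ^ 2) := by
  set B := A - 1
  have hδ := (norm_nonneg B).trans hA
  have hM2 : ‖M‖ ≤ 2 := by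
    have := norm_sub_le_norm_sub_add_norm_sub M T 0
    rw [sub_zero, sub_zero, norm_sub_rev] at this
    linarith
  have h1 : T - A * M * Aᵀ = (T - M) - (B * M + M * Bᵀ + B * M * Bᵀ) := by
    rw [show A = B + 1 from (sub_add_cancel A 1).symm]
    simp only [transpose_add, transpose_one, Matrix.add_mul, Matrix.mul_add, Matrix.one_mul,
      Matrix.mul_one]
    abel
  have h2 : ‖B * M‖ ≤ 2 * δ := by
    refine (l2_opNorm_mul B M).trans ?_
    nlinarith [norm_nonneg B, norm_nonneg M]
  have h3 : ‖M * Bᵀ‖ ≤ 2 * δ := by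
    refine (l2_opNorm_mul M Bᵀ).trans ?_
    rw [l2_opNorm_transpose]
    nlinarith [norm_nonneg B, norm_nonneg M]
  have h4 : ‖B * M * Bᵀ‖ ≤ 2 * δ ^ 2 := by
    refine (l2_opNorm_mul _ Bᵀ).trans ?_
    rw [l2_opNorm_transpose]
    nlinarith [norm_nonneg B, norm_nonneg (B * M)]
  rw [h1]
  refine (norm_sub_le _ _).trans ?_
  have h5 := norm_add₃_le (a := B * M) (b := M * Bᵀ) (c := B * M * Bᵀ)
  linarith

/-! ## The number of operations -/

/-- Bounds the logarithm below by `1 / 2`, so that additive constants in operation counts can be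
absorbed into multiples of it. -/
theorem half_le_log_div {N : ℕ} {ε : ℝ} (hN : 0 < N) (hε : 0 < ε) (hε' : ε < 1 / 2) :
    Real.log 2 ≤ Real.log (N / ε) ∧ (1 : ℝ) / 2 ≤ Real.log 2 := by
  have hN1 : (1 : ℝ) ≤ N := by exact_mod_cast hN
  refine ⟨Real.log_le_log two_pos ?_, by linarith [Real.log_two_gt_d9]⟩
  rw [le_div_iff₀ hε]
  linarith

theorem neg_log_tolerance_le {N : ℕ} {ε : ℝ} (hN : 0 < N) (hε : 0 < ε) (hε' : ε < 1 / 2) :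
    -Real.log (ε / (64 * N)) ≤ 7 * Real.log (N / ε) := by
  have hN0 : (0 : ℝ) < N := by exact_mod_cast hN
  have h1 := (half_le_log_div hN hε hε').1
  have h2 : Real.log 64 = 6 * Real.log 2 := by
    rw [show (64 : ℝ) = 2 ^ 6 by norm_num, Real.log_pow]
    norm_num
  rw [Real.log_div hN0.ne' hε.ne'] at h1 ⊢
  rw [Real.log_div hε.ne' (by positivity), Real.log_mul (by norm_num) hN0.ne', h2]
  linarith

theorem fmmBudget (hξ : 1 ≤ ξ) {K₀ : ℝ} (hK₀ : ∀ (k : FMMKernel) (ε : ℝ) (m n : ℕ)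
      (x : Fin m → ℝ) (c y : Fin n → ℝ), FMMAdmissible ε 8 1 1 m n x c y →
      (F.ops k ε 8 1 1 m n x c y : ℝ) ≤ K₀ * n * Real.log (n / ε) ^ ξ)
    {N : ℕ} {ε : ℝ} (hN : 0 < N) (hε : 0 < ε) (hε' : ε < 1 / 2) :
    FMMBudget F (ε / (64 * N)) N ⌈max K₀ 0 * (120 * Real.log (N / ε)) ^ ξ⌉₊ := by
  intro k m x c y hm hadm
  have hN1 : (1 : ℝ) ≤ N := by exact_mod_cast hN
  set η := ε / (64 * N) with hη
  have hη0 : 0 < η := by positivity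
  have hη1 : η ≤ 1 := by
    rw [hη, div_le_one (by positivity)]
    linarith
  have hη17 : η ^ 17 ≤ 1 := pow_le_one₀ hη0.le hη1
  have hm1 : (1 : ℝ) ≤ ((m + 1 : ℕ) : ℝ) := by exact_mod_cast Nat.le_add_left 1 m
  have hmN : ((m + 1 : ℕ) : ℝ) ≤ N := by exact_mod_cast hm
  have hlogN : Real.log ((m + 1 : ℕ) : ℝ) ≤ Real.log (N / ε) := by
    refine Real.log_le_log (by linarith) (hmN.trans ?_)
    rw [le_div_iff₀ hε]
    nlinarith
  have hlog0 : 0 ≤ Real.log (((m + 1 : ℕ) : ℝ) / η ^ 17) := by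
    refine Real.log_nonneg ?_
    rw [le_div_iff₀ (by positivity)]
    linarith
  -- One multiple of the logarithm for the number of sources, and `17 * 7` for the accuracy `η ^
  -- 17`.
  have hlog : Real.log (((m + 1 : ℕ) : ℝ) / η ^ 17) ≤ 120 * Real.log (N / ε) := by
    rw [Real.log_div (by linarith) (by positivity), Real.log_pow]
    have := neg_log_tolerance_le hN hε hε'
    push_cast at hlogN ⊢
    linarith
  have h1 := hK₀ k (η ^ 17) (m + 1) (m + 1) x c y hadm
  have h2 : (F.ops k (η ^ 17) 8 1 1 (m + 1) (m + 1) x c y : ℝ) ≤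
      ((m + 1 : ℕ) : ℝ) * (max K₀ 0 * (120 * Real.log (N / ε)) ^ ξ) := by
    refine h1.trans ?_
    calc K₀ * ((m + 1 : ℕ) : ℝ) * Real.log (((m + 1 : ℕ) : ℝ) / η ^ 17) ^ ξ
        ≤ max K₀ 0 * ((m + 1 : ℕ) : ℝ) * (120 * Real.log (N / ε)) ^ ξ := by
          gcongr
          exact le_max_left _ _
      _ = _ := by ring
  have h3 : (F.ops k (η ^ 17) 8 1 1 (m + 1) (m + 1) x c y : ℝ) ≤
      (((m + 1) * ⌈max K₀ 0 * (120 * Real.log (N / ε)) ^ ξ⌉₊ : ℕ) : ℝ) := by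
    refine h2.trans ?_
    push_cast
    gcongr
    exact Nat.le_ceil _
  exact_mod_cast h3

/-- The initial intervals lie in `[-2, 2]` and have to shrink to `η ^ 16`. This needs `t * log 2` to
be at least `(16 * 7 + 2) * log (N / ε)`, and `log 2 ≥ 1 / 2` doubles `114` to `228`. -/
theorem four_le_pow_mul_two_pow {N : ℕ} {ε : ℝ} (hN : 0 < N) (hε : 0 < ε) (hε' : ε < 1 / 2) :
    4 ≤ (ε / (64 * N)) ^ 16 * 2 ^ ⌈228 * Real.log (N / ε)⌉₊ := by
  have hN0 : (0 : ℝ) < N := by exact_mod_cast hN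
  obtain ⟨h1, h2⟩ := half_le_log_div hN hε hε'
  have h3 := neg_log_tolerance_le hN hε hε'
  set t := ⌈228 * Real.log (N / ε)⌉₊
  have h4 : 228 * Real.log (N / ε) ≤ t := Nat.le_ceil _
  rw [← Real.log_le_log_iff (by norm_num) (by positivity),
    Real.log_mul (by positivity) (by positivity), Real.log_pow, Real.log_pow,
    show (4 : ℝ) = 2 ^ 2 by norm_num, Real.log_pow]
  push_cast
  have h5 : (t : ℝ) * (1 / 2) ≤ t * Real.log 2 := by gcongr
  linarith

theorem cost_le (hξ : 1 ≤ ξ) {K₀ : ℝ} (hK₀ : 0 ≤ K₀) {N : ℕ} {ε : ℝ} (hN : 0 < N) (hε : 0 < ε)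
    (hε' : ε < 1 / 2) :
    ((60 + 4 * (N * N * ((⌈228 * Real.log (N / ε)⌉₊ + 7) *
      (⌈K₀ * (120 * Real.log (N / ε)) ^ ξ⌉₊ + 17))) : ℕ) : ℝ) ≤
      (60 * 2 ^ (ξ + 1) + 976 * (K₀ * 120 ^ ξ + 18 * 2 ^ ξ)) * N ^ 2 *
        Real.log (N / ε) ^ (ξ + 1) := by
  have hN1 : (1 : ℝ) ≤ N := by exact_mod_cast hN
  obtain ⟨h1, h2⟩ := half_le_log_div hN hε hε'
  set ℓ := Real.log (N / ε) with hℓ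
  have hℓ1 : 1 / 2 ≤ ℓ := h2.trans h1
  have hℓ0 : 0 < ℓ := by linarith
  -- Rounding up and the summand `7` cost at most `8 ≤ 16 * ℓ`.
  have ht : ((⌈228 * ℓ⌉₊ : ℕ) : ℝ) + 7 ≤ 244 * ℓ := by
    have := Nat.ceil_lt_add_one (show 0 ≤ 228 * ℓ by positivity)
    linarith
  have hpow : ∀ ζ : ℝ, 0 ≤ ζ → 1 ≤ (2 : ℝ) ^ ζ * ℓ ^ ζ := fun ζ hζ => by
    rw [← Real.mul_rpow two_pos.le hℓ0.le]
    exact Real.one_le_rpow (by linarith) hζ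
  have hX : ((⌈K₀ * (120 * ℓ) ^ ξ⌉₊ : ℕ) : ℝ) + 17 ≤ (K₀ * 120 ^ ξ + 18 * 2 ^ ξ) * ℓ ^ ξ := by
    have h3 := Nat.ceil_lt_add_one (show 0 ≤ K₀ * (120 * ℓ) ^ ξ by positivity)
    have h4 : (120 * ℓ) ^ ξ = 120 ^ ξ * ℓ ^ ξ := Real.mul_rpow (by norm_num) hℓ0.le
    rw [h4] at h3 ⊢
    have h5 := hpow ξ (by linarith)
    linarith
  have hsq : (1 : ℝ) ≤ N ^ 2 := one_le_pow₀ hN1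
  have h60 := hpow (ξ + 1) (by linarith)
  have hℓξ : ℓ ^ (ξ + 1) = ℓ ^ ξ * ℓ := Real.rpow_add_one hℓ0.ne' ξ
  push_cast
  calc (60 : ℝ) + 4 * (N * N * ((⌈228 * ℓ⌉₊ + 7) * (⌈K₀ * (120 * ℓ) ^ ξ⌉₊ + 17)))
      ≤ 60 * (2 ^ (ξ + 1) * ℓ ^ (ξ + 1)) * N ^ 2 +
        4 * (N * N * ((244 * ℓ) * ((K₀ * 120 ^ ξ + 18 * 2 ^ ξ) * ℓ ^ ξ))) := by
        gcongr
        nlinarith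
    _ = _ := by rw [hℓξ]; ring

theorem tolerance_bounds {N : ℕ} {ε : ℝ} (hN : 0 < N) (hε : 0 < ε) (hε' : ε < 1 / 2) :
    N * (6 * N * (ε / (64 * N)) ^ 17) ≤ ε / N ^ 2 / 32 ∧
      N * (4 * N * (ε / (64 * N)) ^ 3) ≤ ε / 4 := by
  have hN1 : (1 : ℝ) ≤ N := by exact_mod_cast hN
  set η := ε / (64 * N) with hη
  have hη0 : 0 < η := by positivity
  have hNη : N * η = ε / 64 := by rw [hη]; field_simp
  have hη1 : η ≤ 1 := by nlinarith
  have h1 : η ^ 13 ≤ 1 := pow_le_one₀ hη0.le hη1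
  have h2 : (ε / 64) ^ 3 ≤ (1 / 128) ^ 3 := by
    gcongr ?_ ^ 3
    linarith
  constructor
  · rw [div_div, le_div_iff₀ (by positivity)]
    calc N * (6 * N * η ^ 17) * (N ^ 2 * 32) = 192 * ((N * η) ^ 3 * (N * η)) * η ^ 13 := by ring
      _ ≤ 192 * ((1 / 128) ^ 3 * (ε / 64)) * 1 := by rw [hNη]; gcongr
      _ ≤ ε := by linarith
  · calc N * (4 * N * η ^ 3) = 4 * ((N * η) * (N * η)) * η := by ring
      _ ≤ 4 * ((ε / 64) * 1) * 1 := by rw [hNη]; gcongr; linarith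
      _ ≤ ε / 4 := by linarith

end GuEisenstat

theorem mainTheorem1 (ξ : ℝ) (hξ : 1 ≤ ξ) (F : ApproxFMM ξ) :
    ∃ K : ℝ, 0 < K ∧ ∀ (n : ℕ) (T : Matrix (Fin n) (Fin n) ℝ) (ε : ℝ),
      0 < n → IsUnreducedSymmTridiagonal T → ‖T‖ ≤ 1 → 0 < ε → ε < 1 / 2 →
      ∃ (U' : Matrix (Fin n) (Fin n) ℝ) (Λ' : Fin n → ℝ) (ops fuel₀ : ℕ),
        (∀ fuel : ℕ, fuel₀ ≤ fuel →
          (GuEisenstat.diagonalize fuel n (diagEntries T) (offDiagEntries T) ε).run F =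
            some (outputPairs U' Λ', ops)) ∧
        (ops : ℝ) ≤ K * (n : ℝ) ^ 2 * Real.log (n / ε) ^ (ξ + 1) ∧
        ‖T - U' * Matrix.diagonal Λ' * U'.transpose‖ ≤ ε ∧
        ‖U'.transpose * U' - 1‖ ≤ ε / (n : ℝ) ^ 2 ∧
        ∃ U E : Matrix (Fin n) (Fin n) ℝ,
          U' = U + E ∧ U.transpose * U = 1 ∧ ‖E‖ ≤ ε / (n : ℝ) ^ 2 ∧
          ‖T - U * Matrix.diagonal Λ' * U.transpose‖ ≤ ε := by
  obtain ⟨K₀, hK₀⟩ := F.efficient 8 1 1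
  refine ⟨60 * 2 ^ (ξ + 1) + 976 * (max K₀ 0 * 120 ^ ξ + 18 * 2 ^ ξ), by positivity,
    fun n T ε hn hT hT1 hε hε' => ?_⟩
  have hn1 : (1 : ℝ) ≤ n := by exact_mod_cast hn
  set η := ε / (64 * n) with hη
  have hη0 : 0 < η := by positivity
  have hηn : 128 * n * η ≤ 1 := by
    have : 128 * n * η = 2 * ε := by rw [hη]; field_simp; norm_num
    linarith
  have hb : ∀ i, |offDiagEntries T i| ≤ 1 := fun i => by
    rw [offDiagEntries]
    split_ifs
    · exact (GuEisenstat.abs_entry_le T _ _).trans hT1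
    · simp
  have hb0 : ∀ i, i + 1 < n → offDiagEntries T (0 + i) ≠ 0 := fun i hi => by
    rw [Nat.zero_add, offDiagEntries, dif_pos hi]
    exact hT.unreduced _ _ rfl
  have hq : ∀ x, |GuEisenstat.tridiagForm (diagEntries T) (offDiagEntries T) n 0 x| ≤ x ⬝ᵥ x := fun x => by
    rw [GuEisenstat.tridiagForm_entries hT]
    refine (GuEisenstat.abs_dotProduct_mulVec_self_le T x).trans ?_
    exact mul_le_of_le_one_left (Matrix.dotProduct_self_nonneg_real x) hT1
  obtain ⟨L, hL, hex⟩ := GuEisenstat.fuelExec_diagonalizeBlock (GuEisenstat.fmmBudget hξ hK₀ hn hε hε') hη0 hηn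
    (GuEisenstat.four_le_pow_mul_two_pow hn hε hε') (diagEntries T) (offDiagEntries T) hb n 0 hn le_rfl hb0 hq
  obtain ⟨A, U, Λ, rfl, hU, hA, hTU⟩ :=
    hL.exists_factorization hT.symm (by positivity) (GuEisenstat.tridiagForm_entries hT)
  obtain ⟨c, hc, f₀, hrun⟩ := RAM.Exec.bindFuel
    (f := fun fuel P => GuEisenstat.diagonalizeBlock fuel P (diagEntries T) (offDiagEntries T) n 0)
    (GuEisenstat.exec_tolerances hn ε) hex
  obtain ⟨hδ, he⟩ := GuEisenstat.tolerance_bounds hn hε hε'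
  set δ := (n : ℝ) * (6 * n * η ^ 17)
  set e := (n : ℝ) * (4 * n * η ^ 3)
  have hεn : ε / (n : ℝ) ^ 2 ≤ ε := div_le_self hε.le (one_le_pow₀ hn1)
  have hδ0 : 0 ≤ δ := by positivity
  have hδ1 : 2 * δ + δ ^ 2 ≤ 3 * δ := by nlinarith
  have hUn := Matrix.l2_opNorm_le_one_of_isometry hU
  refine ⟨A * U, Λ, c, f₀, hrun, ?_, ?_, ?_, U, (A - 1) * U, ?_, hU, ?_, ?_⟩
  · have h1 : (c : ℝ) ≤ _ := Nat.cast_le.2 hc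
    exact h1.trans (GuEisenstat.cost_le hξ (le_max_right _ _) hn hε hε')
  -- The total is at most `e + 6 * δ`, with `e ≤ ε / 4` and `δ ≤ ε / 32`.
  · have h1 := GuEisenstat.norm_sub_conj_le hT1 (by linarith) hTU hA
    rw [Matrix.transpose_mul, show A * U * Matrix.diagonal Λ * (U.transpose * A.transpose) =
      A * (U * Matrix.diagonal Λ * U.transpose) * A.transpose by simp only [Matrix.mul_assoc]]
    linarith
  · have h1 := GuEisenstat.norm_transpose_mul_self_sub_one_le hU hA
    linarith
  · rw [Matrix.sub_mul, Matrix.one_mul, add_sub_cancel]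
  · refine (Matrix.l2_opNorm_mul _ _).trans ?_
    have h1 : ‖A - 1‖ * ‖U‖ ≤ δ * 1 := by gcongr
    linarith
  · linarith
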